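/- Let $m\ge 1$ and $d\ge 3$ be integers and let $0<\epsilon<\frac{2}{m+1}$. For $0\le i\le m$ put $a_i=\frac{2i-m-1}{m+1}$ and $K_i=[-1,1]\times[a_i,a_i+\epsilon]\subset\mathbb{R}^2$, and let $M=\mathbb{R}^2\setminus\bigcup_{i=0}^m K_i$. Let $N$ be either the disjoint union $\coprod_{1}^m\mathbb{R}$ of $m$ lines, with reference embedding $e:N\to\mathbb{R}^d$ sending $t$ in the $i$-th line to $(t,i,0,\dots,0)$ (that is, $m$ parallel lines in a plane, numbered $0,\dots,m-1$), or $N=M$, with reference embedding $e(s,t)=(s,t,0,\dots,0)$. Let $\mathrm{Emb}_c(N,\mathbb{R}^d)$ and $\mathrm{Imm}_c(N,\mathbb{R}^d)$ be the sets of smooth embeddings, respectively immersions, $N\to\mathbb{R}^d$ that coincide with $e$ outside a compact subset $C$ of the ambient Euclidean space ($\mathbb{R}$ for each line, $\mathbb{R}^2$ for $M$). For fixed $C$ these maps carry the topology of uniform convergence of all derivatives on compact subsets of $N$, and $\mathrm{Emb}_c$, $\mathrm{Imm}_c$ carry the colimit topology over all such $C$. Let $\overline{\mathrm{Emb}}_c(N,\mathbb{R}^d)$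 be the homotopy fiber over $e$ of the inclusion $\mathrm{Emb}_c(N,\mathbb{R}^d)\hookrightarrow\mathrm{Imm}_c(N,\mathbb{R}^d)$, and let $\overline{\mathcal L}_m^d=\overline{\mathrm{Emb}}_c(\coprod_1^m\mathbb{R},\mathbb{R}^d)$ be the space of long links of $m$ strands modulo immersions. Then $\overline{\mathcal L}_m^d$ and $\overline{\mathrm{Emb}}_c(M,\mathbb{R}^d)$ are weakly equivalent, that is, they are joined by a finite zigzag of continuous maps each of which induces a bijection on path components and isomorphisms on all homotopy groups at all base points. -/

import Mathlib

open scoped ContDiff unitInterval Topology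
open TopologicalSpace

noncomputable section

namespace LongLinks

/-! ### Weak homotopy equivalences -/

section Weak

variable {X Y : Type*} [TopologicalSpace X] [TopologicalSpace Y]

/-- The map induced on path components by a continuous map. -/
def mapPi0 (f : C(X, Y)) : ZerothHomotopy X → ZerothHomotopy Y :=
  Quotient.map f fun _ _ h => h.map f.continuous

/-- The map induced on based generalized loops by a continuous map. -/
def mapGenLoop (N : Type) (f : C(X, Y)) (x : X) (p : GenLoop N X x) : GenLoop N Y (f x) :=
  ⟨f.comp p.1, fun y hy => congrArg f (p.2 y hy)⟩

/-- The map induced on the `n`-th homotopy group by a continuous map. -/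
def mapPi (n : ℕ) (f : C(X, Y)) (x : X) :
    HomotopyGroup (Fin n) X x → HomotopyGroup (Fin n) Y (f x) :=
  Quotient.map (mapGenLoop (Fin n) f x) fun _ _ h => h.map fun H => H.compContinuousMap f

/-- A continuous map that is bijective on path components and on all homotopy groups at all
base points. -/
def IsWeakHomotopyEquiv (f : C(X, Y)) : Prop :=
  Function.Bijective (mapPi0 f) ∧
    ∀ n : ℕ, 1 ≤ n → ∀ x : X, Function.Bijective (mapPi n f x)

end Weak

/-- Two spaces are weakly equivalent if they are joined by a finite zigzag of weak homotopy
equivalences. -/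
def WeaklyEquivalent (X Y : Type) [TopologicalSpace X] [TopologicalSpace Y] : Prop :=
  Relation.EqvGen (fun A B : TopCat.{0} => ∃ f : C(A, B), IsWeakHomotopyEquiv f)
    (TopCat.of X) (TopCat.of Y)

/-- The homotopy fiber of `f` over `y`: pairs of a point `x` and a path in `Y` from `y` to `f x`. -/
def HomotopyFiber {X Y : Type*} [TopologicalSpace X] [TopologicalSpace Y] (f : C(X, Y)) (y : Y) :
    Type _ :=
  {p : X × C(I, Y) // p.2 0 = y ∧ p.2 1 = f p.1}

instance {X Y : Type*} [TopologicalSpace X] [TopologicalSpace Y] (f : C(X, Y)) (y : Y) :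
    TopologicalSpace (HomotopyFiber f y) :=
  inferInstanceAs (TopologicalSpace {p : X × C(I, Y) // p.2 0 = y ∧ p.2 1 = f p.1})

/-! ### Spaces of smooth maps on a disjoint union of open subsets of a normed space -/

/-- Extension by zero of a function on an open set. It is used only to speak of derivatives at
points of that open set. -/
def extendZero {V F : Type} [TopologicalSpace V] [Zero F] {U : Opens V} (f : U → F) : V → F :=
  Function.extend Subtype.val f 0

lemma extendZero_apply {V F : Type} [TopologicalSpace V] [Zero F] {U : Opens V} (f : U → F)
    (x : U) : extendZero f (x : V) = f x :=
  Subtype.val_injective.extend_apply f 0 x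

section Maps

variable {ι V F : Type} [NormedAddCommGroup V] [NormedSpace ℝ V]
  [NormedAddCommGroup F] [NormedSpace ℝ F]

/-- Smooth maps from the disjoint union of the open sets `U i ⊆ V` to `F`. -/
structure SmoothMap (U : ι → Opens V) (F : Type) [NormedAddCommGroup F] [NormedSpace ℝ F] where
  /-- the underlying function on the disjoint union -/
  toFun : (Σ i, U i) → F
  smooth : ∀ i, ContDiffOn ℝ ∞ (extendZero fun x : U i => toFun ⟨i, x⟩) (U i)

namespace SmoothMap

variable {U : ι → Opens V}

/-- The restriction to the `i`-th piece, extended by zero to `V`. -/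
def piece (f : SmoothMap U F) (i : ι) : V → F := extendZero fun x : U i => f.toFun ⟨i, x⟩

/-- The `k`-th derivative on the `i`-th piece, as a continuous map on `U i`. -/
def jet (f : SmoothMap U F) (i : ι) (k : ℕ) : C(U i, V [×k]→L[ℝ] F) where
  toFun x := iteratedFDeriv ℝ k (f.piece i) x
  continuous_toFun := by
    have h := (f.smooth i).continuousOn_iteratedFDerivWithin (m := k)
      (by exact_mod_cast le_top) (U i).isOpen.uniqueDiffOn
    have h2 := h.congr (fun x hx => (iteratedFDerivWithin_of_isOpen k (U i).isOpen hx).symm)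
    exact continuousOn_iff_continuous_domRestrict.1 h2

/-- The (weak) smooth topology: uniform convergence of all derivatives on compact subsets of the
domain. -/
instance : TopologicalSpace (SmoothMap U F) :=
  ⨅ i : ι, ⨅ k : ℕ, TopologicalSpace.induced (fun f => f.jet i k) inferInstance

/-- Immersion: the derivative is injective at every point of the domain. -/
def IsImmersion (f : SmoothMap U F) : Prop :=
  ∀ (i : ι) (x : U i), Function.Injective (fderiv ℝ (f.piece i) x)

/-- Smooth embedding: an immersion that is a homeomorphism onto its image. -/
def IsSmoothEmbedding (f : SmoothMap U F) : Prop :=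
  f.IsImmersion ∧ Topology.IsEmbedding f.toFun

/-- `f` and `e` coincide at all points of the domain that lie outside `K ⊆ V`. -/
def AgreeOutside (f e : SmoothMap U F) (K : Set V) : Prop :=
  ∀ (i : ι) (x : U i), (x : V) ∉ K → f.toFun ⟨i, x⟩ = e.toFun ⟨i, x⟩

/-- A globally given smooth map, restricted to the pieces. -/
def ofContDiff (U : ι → Opens V) (g : ι → V → F) (hg : ∀ i, ContDiff ℝ ∞ (g i)) :
    SmoothMap U F where
  toFun p := g p.1 p.2
  smooth i := (hg i).contDiffOn.congr fun x hx =>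
    extendZero_apply (fun x : U i => g i x) ⟨x, hx⟩

lemma ofContDiff_fderiv (U : ι → Opens V) (g : ι → V → F) (hg : ∀ i, ContDiff ℝ ∞ (g i))
    (i : ι) (x : U i) : fderiv ℝ ((ofContDiff U g hg).piece i) x = fderiv ℝ (g i) x := by
  apply Filter.EventuallyEq.fderiv_eq
  filter_upwards [(U i).isOpen.mem_nhds x.2] with y hy
  exact extendZero_apply (fun x : U i => g i x) ⟨y, hy⟩

end SmoothMap

variable {U : ι → Opens V}

/-- The maps with the property `P` that coincide with `e` outside some compact subset of the
ambient space `V`. -/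
def CptSupp (P : SmoothMap U F → Prop) (e : SmoothMap U F) : Type :=
  {f : SmoothMap U F // P f ∧ ∃ K : Set V, IsCompact K ∧ f.AgreeOutside e K}

/-- The maps with the property `P` that coincide with `e` outside the compact set `K`, with the
smooth topology. -/
abbrev SuppIn (P : SmoothMap U F → Prop) (e : SmoothMap U F) (K : Compacts V) : Type :=
  {f : SmoothMap U F // P f ∧ f.AgreeOutside e K}

/-- Inclusion of the maps supported in a given compact set. -/
def SuppIn.incl (P : SmoothMap U F → Prop) (e : SmoothMap U F) (K : Compacts V) :
    SuppIn P e K → CptSupp P e :=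
  fun f => ⟨f.1, f.2.1, K, K.isCompact, f.2.2⟩

/-- The colimit topology over all compact sets `K ⊆ V`. -/
instance (P : SmoothMap U F → Prop) (e : SmoothMap U F) : TopologicalSpace (CptSupp P e) :=
  ⨆ K : Compacts V, TopologicalSpace.coinduced (SuppIn.incl P e K) inferInstance

/-- The space of compactly supported immersions. -/
abbrev ImmC (e : SmoothMap U F) : Type := CptSupp SmoothMap.IsImmersion e

/-- The space of compactly supported embeddings. -/
abbrev EmbC (e : SmoothMap U F) : Type := CptSupp SmoothMap.IsSmoothEmbedding e

/-- The inclusion of embeddings into immersions. -/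
def embToImm (e : SmoothMap U F) : C(EmbC e, ImmC e) where
  toFun f := ⟨f.1, f.2.1.1, f.2.2⟩
  continuous_toFun := by
    refine continuous_iSup_dom.2 fun K => continuous_coinduced_dom.2 ?_
    have h1 : Continuous (SuppIn.incl SmoothMap.IsImmersion e K) :=
      continuous_iSup_rng (i := K) continuous_coinduced_rng
    exact h1.comp (f := fun f : SuppIn SmoothMap.IsSmoothEmbedding e K =>
      (⟨f.1, f.2.1.1, f.2.2⟩ : SuppIn SmoothMap.IsImmersion e K))
      (continuous_subtype_val.subtype_mk _)

/-- The reference map as a base point of the space of compactly supported immersions. -/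
def immBase (e : SmoothMap U F) (he : e.IsImmersion) : ImmC e :=
  ⟨e, he, ∅, isCompact_empty, fun _ _ _ => rfl⟩

/-- Compactly supported embeddings modulo immersions: the homotopy fiber, over the reference
map, of the inclusion of embeddings into immersions. -/
abbrev EmbModImm (e : SmoothMap U F) (he : e.IsImmersion) : Type :=
  HomotopyFiber (embToImm e) (immBase e he)

end Maps

/-! ### Long links and the planar domain -/

/-- The standard linear inclusion `ℝ² → ℝ^d`, `(s, t) ↦ (s, t, 0, …, 0)`. -/
def planeIncl (d : ℕ) : EuclideanSpace ℝ (Fin 2) →L[ℝ] EuclideanSpace ℝ (Fin d) :=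
  LinearMap.toContinuousLinearMap
    { toFun := fun x => WithLp.toLp 2 fun j : Fin d =>
        if j.val = 0 then x 0 else if j.val = 1 then x 1 else 0
      map_add' := fun x y => by ext j; simp only [PiLp.add_apply]; split_ifs <;> simp
      map_smul' := fun c x => by
        ext j; simp only [PiLp.smul_apply, RingHom.id_apply]; split_ifs <;> simp }

lemma planeIncl_injective {d : ℕ} (hd : 3 ≤ d) : Function.Injective (planeIncl d) := by
  intro x y h
  have h0 := congrArg (fun v : EuclideanSpace ℝ (Fin d) => v ⟨0, by omega⟩) h
  have h1 := congrArg (fun v : EuclideanSpace ℝ (Fin d) => v ⟨1, by omega⟩) h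
  ext j
  fin_cases j
  · simpa [planeIncl] using h0
  · simpa [planeIncl] using h1

/-- The `i`-th standard strand `t ↦ (t, i, 0, …, 0)`. -/
def strand (d i : ℕ) (t : ℝ) : EuclideanSpace ℝ (Fin d) := planeIncl d !₂[t, (i : ℝ)]

lemma strand_eq (d i : ℕ) (t : ℝ) :
    strand d i t = t • planeIncl d !₂[(1 : ℝ), 0] + planeIncl d !₂[(0 : ℝ), (i : ℝ)] := by
  rw [strand, ← map_smul, ← map_add]
  congr 1
  ext j
  fin_cases j <;> simp

lemma strand_hasDerivAt (d i : ℕ) (t : ℝ) :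
    HasDerivAt (strand d i) (planeIncl d !₂[(1 : ℝ), 0]) t := by
  have h : strand d i = fun t => t • planeIncl d !₂[(1 : ℝ), 0] +
      planeIncl d !₂[(0 : ℝ), (i : ℝ)] := funext (strand_eq d i)
  rw [h]
  simpa using ((hasDerivAt_id t).smul_const (planeIncl d !₂[(1 : ℝ), 0])).add_const
    (planeIncl d !₂[(0 : ℝ), (i : ℝ)])

lemma strand_contDiff (d i : ℕ) : ContDiff ℝ ∞ (strand d i) := by
  have h : strand d i = fun t => t • planeIncl d !₂[(1 : ℝ), 0] +
      planeIncl d !₂[(0 : ℝ), (i : ℝ)] := funext (strand_eq d i)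
  rw [h]
  fun_prop

/-- The standard link of `m` parallel lines in `ℝ^d`, a map on the disjoint union of `m` copies
of `ℝ`. -/
def stdLink (m d : ℕ) :
    SmoothMap (fun _ : Fin m => (⊤ : Opens ℝ)) (EuclideanSpace ℝ (Fin d)) :=
  SmoothMap.ofContDiff _ (fun i => strand d i) fun i => strand_contDiff d i

lemma stdLink_isImmersion (m : ℕ) {d : ℕ} (hd : 3 ≤ d) : (stdLink m d).IsImmersion := by
  intro i x
  rw [stdLink, SmoothMap.ofContDiff_fderiv, (strand_hasDerivAt d i x).hasFDerivAt.fderiv]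
  have h0 : planeIncl d !₂[(1 : ℝ), 0] ≠ 0 := fun h => by
    have h2 := planeIncl_injective hd (h.trans (map_zero _).symm)
    simpa using congrArg (fun v : EuclideanSpace ℝ (Fin 2) => v 0) h2
  intro s t h
  exact smul_left_injective ℝ h0 (by simpa using h)

/-- The space of long links of `m` strands in `ℝ^d` modulo immersions. -/
abbrev LongLinksModImm (m d : ℕ) (hd : 3 ≤ d) : Type :=
  EmbModImm (stdLink m d) (stdLink_isImmersion m hd)

/-- `a i = (2 i - m - 1) / (m + 1)`. -/
def lowerHeight (m i : ℕ) : ℝ := (2 * (i : ℝ) - m - 1) / (m + 1)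

/-- The thickened interval `[-1, 1] × [a i, a i + ε]`. -/
def thickInterval (m : ℕ) (ε : ℝ) (i : ℕ) : Set (EuclideanSpace ℝ (Fin 2)) :=
  {x | x 0 ∈ Set.Icc (-1) 1 ∧ x 1 ∈ Set.Icc (lowerHeight m i) (lowerHeight m i + ε)}

lemma isClosed_thickInterval (m : ℕ) (ε : ℝ) (i : ℕ) : IsClosed (thickInterval m ε i) :=
  (isClosed_Icc.preimage (by fun_prop : Continuous fun x : EuclideanSpace ℝ (Fin 2) => x 0)).inter
    (isClosed_Icc.preimage (by fun_prop : Continuous fun x : EuclideanSpace ℝ (Fin 2) => x 1))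

/-- The complement in `ℝ²` of the `m + 1` thickened intervals. -/
def planarDomain (m : ℕ) (ε : ℝ) : Opens (EuclideanSpace ℝ (Fin 2)) :=
  ⟨(⋃ i : Fin (m + 1), thickInterval m ε i)ᶜ,
    (isClosed_iUnion_of_finite fun i : Fin (m + 1) => isClosed_thickInterval m ε i).isOpen_compl⟩

/-- The standard inclusion of the planar domain in `ℝ^d`. -/
def stdPlanar (m d : ℕ) (ε : ℝ) :
    SmoothMap (fun _ : Unit => planarDomain m ε) (EuclideanSpace ℝ (Fin d)) :=
  SmoothMap.ofContDiff _ (fun _ => planeIncl d) fun _ => (planeIncl d).contDiff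

lemma stdPlanar_isImmersion (m : ℕ) {d : ℕ} (hd : 3 ≤ d) (ε : ℝ) :
    (stdPlanar m d ε).IsImmersion := by
  intro i x
  rw [stdPlanar, SmoothMap.ofContDiff_fderiv, ContinuousLinearMap.fderiv]
  exact planeIncl_injective hd

/-- The space of compactly supported embeddings of the planar domain in `ℝ^d` modulo
immersions. -/
abbrev PlanarEmbModImm (m d : ℕ) (hd : 3 ≤ d) (ε : ℝ) : Type :=
  EmbModImm (stdPlanar m d ε) (stdPlanar_isImmersion m hd ε)

end LongLinks

end

/-!
The planar domain `M` contains the `m` horizontal lines that run through the middle of the strips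
between consecutive removed rectangles. Restriction to these lines, followed by the affine change
of one coordinate that moves their heights to `0, …, m - 1`, is a map from the embeddings of `M`
modulo immersions to the long links modulo immersions. This map, `restrictModImm`, is itself a weak
equivalence.

By `LiftsUpToHomotopy.isWeakHomotopyEquiv` it is enough that every square formed by a family `α` of
planar embeddings modulo immersions over a closed subset `A` of a compact space `D`, and a family
`β` of long links modulo immersions over `D`, is homotopic through such squares to one with a
diagonal lift: the homotopy of squares can be performed in a collar of the boundary of a cube. A
compact family in the colimit topology has a common support (`CptSupp.exists_agreeOutside`), and a
continuous family in the smooth topology is one whose derivatives are jointly continuous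
(`SmoothMap.continuous_iff_sfam`), so the square consists of families of smooth functions.

A point of `β` is a path of immersed strands from the reference lines to a link. Along this path,
the tangent vectors are transported by linear automorphisms starting at the identity
(`exists_frames`). The images of the vertical unit vector give a thickening of the strands to maps
of the plane that are immersive along the lines (`framedThicken`). A given path of immersions of
`M` is joined to the thickening of its restriction (`interpolate`): first its values near the lines
are interpolated linearly to its first order expansion, then the vertical derivative at the
current time is replaced by the one at earlier and earlier times, transported to the current time;
at time zero it is the vertical unit vector. The derivative along the lines is at each moment
injective, since it is a linear automorphism applied to the derivative of an immersion.

These maps are immersions, respectively embeddings, only near the lines and far from the removed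
rectangles. By compactness this holds on a uniform tube (`LineImmersive.exists_immersive_tube`,
`LineImmersive.exists_embedded_tube`), where properness upgrades injectivity to an embedding. An
isotopy of the plane that fixes the lines pushes `M` into that tube (`exists_isCompression`), and
is the composition of a vertical shear, contracting the strips, and a horizontal shear, moving
points that are not close to the lines out of a large square. Precomposition with it turns the maps
above into immersions and embeddings of all of `M`, without changing their restrictions to the
lines. The compression takes place while the path of immersions still rests at the reference map,
so that the path can start at the reference map.
-/

noncomputable section

namespace LongLinks

/-! ### Continuous families of smooth maps -/

section Fam

open Set

variable {P P' V V' E F G : Type} [TopologicalSpace P] [TopologicalSpace P']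
  [NormedAddCommGroup V] [NormedSpace ℝ V] [NormedAddCommGroup V'] [NormedSpace ℝ V']
  [NormedAddCommGroup E] [NormedSpace ℝ E] [NormedAddCommGroup F] [NormedSpace ℝ F]
  [NormedAddCommGroup G] [NormedSpace ℝ G]

/-- A family `f p : V → E` of maps, indexed by a topological space, that are `n` times
differentiable on `U` with all derivatives of order at most `n` jointly continuous in the parameter
and the point. The recursion is on the order, the family of derivatives being again such a
family. -/
def CFam : ℕ → {E : Type} → [NormedAddCommGroup E] → [NormedSpace ℝ E] →
    (P → V → E) → Set V → Prop
  | 0, _, _, _, f, U => ContinuousOn (fun x : P × V => f x.1 x.2) (univ ×ˢ U)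
  | n + 1, _, _, _, f, U => ContinuousOn (fun x : P × V => f x.1 x.2) (univ ×ˢ U) ∧
      (∀ p, DifferentiableOn ℝ (f p) U) ∧ CFam n (fun p => fderiv ℝ (f p)) U

/-- A continuous family of smooth maps on `U`: all derivatives in the direction of `V` exist on `U`
and are jointly continuous in the parameter and the point. -/
def SFam (f : P → V → E) (U : Set V) : Prop := ∀ n, CFam n f U

namespace CFam

variable {n : ℕ} {U : Set V} {U' : Set V'}

lemma continuousOn {f : P → V → E} (h : CFam n f U) :
    ContinuousOn (fun x : P × V => f x.1 x.2) (univ ×ˢ U) := by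
  cases n with
  | zero => exact h
  | succ n => exact h.1

lemma congr (hU : IsOpen U) {f g : P → V → E} (h : CFam n f U)
    (e : ∀ p, ∀ u ∈ U, g p u = f p u) : CFam n g U := by
  induction n generalizing E with
  | zero => exact ContinuousOn.congr h fun x hx => e _ _ hx.2
  | succ n ih =>
    refine ⟨h.1.congr fun x hx => e _ _ hx.2, fun p => (h.2.1 p).congr (e p), ih h.2.2 ?_⟩
    intro p u hu
    apply Filter.EventuallyEq.fderiv_eq
    filter_upwards [hU.mem_nhds hu] with w hw using e p w hw

lemma of_succ {f : P → V → E} (h : CFam (n + 1) f U) : CFam n f U := by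
  induction n generalizing E with
  | zero => exact h.1
  | succ n ih => exact ⟨h.1, h.2.1, ih h.2.2⟩

lemma mono {f : P → V → E} {W : Set V} (h : CFam n f U) (hW : W ⊆ U) : CFam n f W := by
  induction n generalizing E with
  | zero => exact ContinuousOn.mono h (prod_mono le_rfl hW)
  | succ n ih => exact ⟨h.1.mono (prod_mono le_rfl hW), fun p => (h.2.1 p).mono hW, ih h.2.2⟩

lemma reparam {f : P → V → E} (h : CFam n f U) {q : P' → P} (hq : Continuous q) :
    CFam n (fun p => f (q p)) U := by
  have key : ∀ {E : Type} [NormedAddCommGroup E] [NormedSpace ℝ E] {f : P → V → E},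
      ContinuousOn (fun x : P × V => f x.1 x.2) (univ ×ˢ U) →
      ContinuousOn (fun x : P' × V => f (q x.1) x.2) (univ ×ˢ U) := by
    intro E _ _ f h
    exact h.comp (f := fun x : P' × V => (q x.1, x.2)) (by fun_prop) fun x hx => ⟨trivial, hx.2⟩
  induction n generalizing E with
  | zero => exact key h
  | succ n ih => exact ⟨key h.1, fun p => h.2.1 _, ih h.2.2⟩

lemma differentiableAt (hU : IsOpen U) {f : P → V → E} (h : CFam (n + 1) f U) (p : P) {u : V}
    (hu : u ∈ U) : DifferentiableAt ℝ (f p) u :=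
  (h.2.1 p).differentiableAt (hU.mem_nhds hu)

lemma add (hU : IsOpen U) {f g : P → V → E} (hf : CFam n f U) (hg : CFam n g U) :
    CFam n (fun p u => f p u + g p u) U := by
  induction n generalizing E with
  | zero => exact ContinuousOn.add hf hg
  | succ n ih =>
    refine ⟨hf.1.add hg.1, fun p => (hf.2.1 p).add (hg.2.1 p), (ih hf.2.2 hg.2.2).congr hU ?_⟩
    intro p u hu
    exact fderiv_add (hf.differentiableAt hU p hu) (hg.differentiableAt hU p hu)

lemma clm_apply (hU : IsOpen U) (L : E →L[ℝ] F) {f : P → V → E} (hf : CFam n f U) :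
    CFam n (fun p u => L (f p u)) U := by
  induction n generalizing E F with
  | zero => exact L.continuous.comp_continuousOn hf
  | succ n ih =>
    refine ⟨L.continuous.comp_continuousOn hf.1, fun p => L.differentiable.comp_differentiableOn
      (hf.2.1 p), (ih (ContinuousLinearMap.compL ℝ V E F L) hf.2.2).congr hU ?_⟩
    intro p u hu
    exact (L.hasFDerivAt.comp u (hf.differentiableAt hU p hu).hasFDerivAt).fderiv

lemma bilin (hU : IsOpen U) (B : E →L[ℝ] F →L[ℝ] G) {f : P → V → E} {g : P → V → F}
    (hf : CFam n f U) (hg : CFam n g U) : CFam n (fun p u => B (f p u) (g p u)) U := by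
  have hc : ∀ {f : P → V → E} {g : P → V → F},
      ContinuousOn (fun x : P × V => f x.1 x.2) (univ ×ˢ U) →
      ContinuousOn (fun x : P × V => g x.1 x.2) (univ ×ˢ U) →
      ContinuousOn (fun x : P × V => B (f x.1 x.2) (g x.1 x.2)) (univ ×ˢ U) := by
    intro f g h h'
    exact (B.continuous.comp_continuousOn h).clm_apply h'
  induction n generalizing E F G with
  | zero => exact hc hf hg
  | succ n ih =>
    refine ⟨hc hf.1 hg.1, fun p u hu => ?_, ?_⟩
    · exact (B.hasFDerivAt_of_bilinear (hf.differentiableAt hU p hu).hasFDerivAt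
        (hg.differentiableAt hU p hu).hasFDerivAt).differentiableAt.differentiableWithinAt
    · refine ((ih (B.precompR V) hf.of_succ hg.2.2 ?_).add hU
        (ih (B.precompL V) hf.2.2 hg.of_succ ?_)).congr hU ?_
      · intro f g h h'
        exact ((B.precompR V).continuous.comp_continuousOn h).clm_apply h'
      · intro f g h h'
        exact ((B.precompL V).continuous.comp_continuousOn h).clm_apply h'
      · intro p u hu
        exact B.fderiv_of_bilinear (hf.differentiableAt hU p hu) (hg.differentiableAt hU p hu)

lemma comp (hU : IsOpen U) (hU' : IsOpen U') {f : P → V → E} {g : P → V' → V}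
    (hf : CFam n f U) (hg : CFam n g U') (hm : ∀ p, MapsTo (g p) U' U) :
    CFam n (fun p u => f p (g p u)) U' := by
  have hc : ∀ {E : Type} [NormedAddCommGroup E] [NormedSpace ℝ E] {f : P → V → E},
      ContinuousOn (fun x : P × V => f x.1 x.2) (univ ×ˢ U) →
      ContinuousOn (fun x : P × V' => g x.1 x.2) (univ ×ˢ U') →
      ContinuousOn (fun x : P × V' => f x.1 (g x.1 x.2)) (univ ×ˢ U') := by
    intro E _ _ f h h'
    exact h.comp (f := fun x : P × V' => (x.1, g x.1 x.2)) (continuousOn_fst.prodMk h')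
      fun x hx => ⟨trivial, hm _ hx.2⟩
  induction n generalizing E with
  | zero => exact hc hf hg
  | succ n ih =>
    refine ⟨hc hf.1 hg.1, fun p => (hf.2.1 p).comp (hg.2.1 p) (hm p), ?_⟩
    refine (bilin hU' (ContinuousLinearMap.compL ℝ V' V E) (ih hf.2.2 hg.of_succ) hg.2.2).congr
      hU' ?_
    intro p u hu
    exact fderiv_comp u (hf.differentiableAt hU p (hm p hu)) (hg.differentiableAt hU' p hu)

lemma of_contDiffOn (hU : IsOpen U) {f : V → E} (h : ContDiffOn ℝ n f U) :
    CFam n (fun _ : P => f) U := by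
  have hc : ∀ {E : Type} [NormedAddCommGroup E] [NormedSpace ℝ E] {f : V → E},
      ContinuousOn f U → ContinuousOn (fun x : P × V => f x.2) (univ ×ˢ U) := by
    intro E _ _ f h
    exact h.comp continuousOn_snd fun x hx => hx.2
  induction n generalizing E with
  | zero => exact hc h.continuousOn
  | succ n ih =>
    have h' := (contDiffOn_succ_iff_fderiv_of_isOpen (n := n) hU).1 (by exact_mod_cast h)
    exact ⟨hc h.continuousOn, fun _ => h'.1, ih h'.2.2⟩

lemma of_continuous {f : P → E} (hf : Continuous f) : CFam n (fun p (_ : V) => f p) U := by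
  cases n with
  | zero => exact (hf.comp continuous_fst).continuousOn
  | succ n =>
    refine ⟨(hf.comp continuous_fst).continuousOn, fun p => differentiableOn_const _, ?_⟩
    have : (fun p => fderiv ℝ fun _ : V => f p) = fun (_ : P) (_ : V) => (0 : V →L[ℝ] E) := by
      funext p u
      simp
    rw [this]
    -- The zero family is a constant family, and is smooth of every order by induction.
    have h0 : ∀ k : ℕ, ∀ {E : Type} [NormedAddCommGroup E] [NormedSpace ℝ E],
        CFam k (fun (_ : P) (_ : V) => (0 : E)) U := by
      intro k
      induction k with
      | zero => intro E _ _; exact continuousOn_const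
      | succ k ih =>
        intro E _ _
        refine ⟨continuousOn_const, fun p => differentiableOn_const _, ?_⟩
        have h1 : (fun _ : P => fderiv ℝ fun _ : V => (0 : E)) = fun _ _ => 0 := by
          funext p u
          simp
        rw [h1]
        exact ih
    exact h0 n

lemma contDiffOn (hU : IsOpen U) {f : P → V → E} (h : CFam n f U) (p : P) :
    ContDiffOn ℝ n (f p) U := by
  induction n generalizing E with
  | zero =>
    refine contDiffOn_zero.2 ?_
    exact ContinuousOn.comp (g := fun x : P × V => f x.1 x.2) (f := fun u => (p, u)) h
      (by fun_prop) fun u hu => ⟨trivial, hu⟩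
  | succ n ih =>
    have := (contDiffOn_succ_iff_fderiv_of_isOpen (f := f p) (n := n) hU).2
      ⟨h.2.1 p, by simp, ih h.2.2⟩
    exact_mod_cast this

/-- The recursive notion of a continuous family agrees with the one in terms of iterated
derivatives. -/
lemma iff_iteratedFDeriv (hU : IsOpen U) {f : P → V → E} (hf : ∀ p, ContDiffOn ℝ ∞ (f p) U) :
    CFam n f U ↔ ∀ k ≤ n,
      ContinuousOn (fun x : P × V => iteratedFDeriv ℝ k (f x.1) x.2) (univ ×ˢ U) := by
  have h0 : ∀ {E : Type} [NormedAddCommGroup E] [NormedSpace ℝ E] {f : P → V → E},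
      ContinuousOn (fun x : P × V => iteratedFDeriv ℝ 0 (f x.1) x.2) (univ ×ˢ U) ↔
      ContinuousOn (fun x : P × V => f x.1 x.2) (univ ×ˢ U) := by
    intro E _ _ f
    have : (fun x : P × V => iteratedFDeriv ℝ 0 (f x.1) x.2) =
        (continuousMultilinearCurryFin0 ℝ V E).symm ∘ fun x : P × V => f x.1 x.2 := by
      funext x
      exact congrFun iteratedFDeriv_zero_eq_comp x.2
    rw [this, LinearIsometryEquiv.comp_continuousOn_iff]
  induction n generalizing E with
  | zero =>
    refine ⟨fun h k hk => ?_, fun h => h0.1 (h 0 le_rfl)⟩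
    obtain rfl : k = 0 := by omega
    exact h0.2 h
  | succ n ih =>
    have hf' : ∀ p, ContDiffOn ℝ ∞ (fderiv ℝ (f p)) U := fun p =>
      (hf p).fderiv_of_isOpen hU (by simp)
    have h1 : ∀ k, ContinuousOn (fun x : P × V => iteratedFDeriv ℝ (k + 1) (f x.1) x.2)
        (univ ×ˢ U) ↔ ContinuousOn
          (fun x : P × V => iteratedFDeriv ℝ k (fderiv ℝ (f x.1)) x.2) (univ ×ˢ U) := by
      intro k
      have : (fun x : P × V => iteratedFDeriv ℝ (k + 1) (f x.1) x.2) =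
          (continuousMultilinearCurryRightEquiv' ℝ k V E).symm ∘
            fun x : P × V => iteratedFDeriv ℝ k (fderiv ℝ (f x.1)) x.2 := by
        funext x
        rw [iteratedFDeriv_succ_eq_comp_right]
        rfl
      rw [this, LinearIsometryEquiv.comp_continuousOn_iff]
    constructor
    · rintro ⟨ha, -, hc⟩ k hkn
      cases k with
      | zero => exact h0.2 ha
      | succ k => exact (h1 k).2 ((ih hf').1 hc k (by omega))
    · intro h
      exact ⟨h0.1 (h 0 (by omega)), fun p => (hf p).differentiableOn (by simp),
        (ih hf').2 fun k hkn => (h1 k).1 (h (k + 1) (by omega))⟩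

end CFam

namespace SFam

variable {U : Set V} {U' : Set V'}

lemma continuousOn {f : P → V → E} (h : SFam f U) :
    ContinuousOn (fun x : P × V => f x.1 x.2) (univ ×ˢ U) := (h 0).continuousOn

lemma congr (hU : IsOpen U) {f g : P → V → E} (h : SFam f U)
    (e : ∀ p, ∀ u ∈ U, g p u = f p u) : SFam g U := fun n => (h n).congr hU e

lemma mono {f : P → V → E} {W : Set V} (h : SFam f U) (hW : W ⊆ U) : SFam f W :=
  fun n => (h n).mono hW

lemma reparam {f : P → V → E} (h : SFam f U) {q : P' → P} (hq : Continuous q) :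
    SFam (fun p => f (q p)) U := fun n => (h n).reparam hq

lemma differentiableAt (hU : IsOpen U) {f : P → V → E} (h : SFam f U) (p : P) {u : V}
    (hu : u ∈ U) : DifferentiableAt ℝ (f p) u := (h 1).differentiableAt hU p hu

lemma fderiv {f : P → V → E} (h : SFam f U) : SFam (fun p => fderiv ℝ (f p)) U :=
  fun n => (h (n + 1)).2.2

lemma add (hU : IsOpen U) {f g : P → V → E} (hf : SFam f U) (hg : SFam g U) :
    SFam (fun p u => f p u + g p u) U := fun n => (hf n).add hU (hg n)

lemma clm_apply (hU : IsOpen U) (L : E →L[ℝ] F) {f : P → V → E} (hf : SFam f U) :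
    SFam (fun p u => L (f p u)) U := fun n => (hf n).clm_apply hU L

lemma sub (hU : IsOpen U) {f g : P → V → E} (hf : SFam f U) (hg : SFam g U) :
    SFam (fun p u => f p u - g p u) U := by
  simpa [sub_eq_add_neg] using hf.add hU (hg.clm_apply hU (-ContinuousLinearMap.id ℝ E))

lemma bilin (hU : IsOpen U) (B : E →L[ℝ] F →L[ℝ] G) {f : P → V → E} {g : P → V → F}
    (hf : SFam f U) (hg : SFam g U) : SFam (fun p u => B (f p u) (g p u)) U :=
  fun n => (hf n).bilin hU B (hg n)

lemma smul (hU : IsOpen U) {f : P → V → ℝ} {g : P → V → E} (hf : SFam f U) (hg : SFam g U) :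
    SFam (fun p u => f p u • g p u) U :=
  hf.bilin hU (ContinuousLinearMap.lsmul ℝ ℝ) hg

lemma app (hU : IsOpen U) {f : P → V → E →L[ℝ] F} {g : P → V → E} (hf : SFam f U)
    (hg : SFam g U) : SFam (fun p u => f p u (g p u)) U :=
  hf.bilin hU (ContinuousLinearMap.id ℝ (E →L[ℝ] F)) hg

lemma clm_comp (hU : IsOpen U) {f : P → V → F →L[ℝ] G} {g : P → V → E →L[ℝ] F} (hf : SFam f U)
    (hg : SFam g U) : SFam (fun p u => (f p u).comp (g p u)) U :=
  hf.bilin hU (ContinuousLinearMap.compL ℝ E F G) hg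

lemma comp (hU : IsOpen U) (hU' : IsOpen U') {f : P → V → E} {g : P → V' → V}
    (hf : SFam f U) (hg : SFam g U') (hm : ∀ p, MapsTo (g p) U' U) :
    SFam (fun p u => f p (g p u)) U' := fun n => (hf n).comp hU hU' (hg n) hm

lemma of_contDiffOn (hU : IsOpen U) {f : V → E} (h : ContDiffOn ℝ ∞ f U) :
    SFam (fun _ : P => f) U :=
  fun _ => CFam.of_contDiffOn hU (h.of_le (by exact_mod_cast le_top))

lemma of_contDiff {f : V → E} (h : ContDiff ℝ ∞ f) : SFam (fun _ : P => f) univ :=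
  of_contDiffOn isOpen_univ h.contDiffOn

lemma of_continuous {f : P → E} (hf : Continuous f) : SFam (fun p (_ : V) => f p) U :=
  fun _ => CFam.of_continuous hf

lemma sum (hU : IsOpen U) {ι : Type} (s : Finset ι) {f : ι → P → V → E}
    (h : ∀ i, SFam (f i) U) : SFam (fun p u => ∑ i ∈ s, f i p u) U := by
  classical
  induction s using Finset.induction_on with
  | empty => simpa using of_continuous (f := fun _ : P => (0 : E)) continuous_const
  | insert i s hi ih => simpa [Finset.sum_insert hi] using (h i).add hU ih

/-- Composition of a family with a fixed smooth map. -/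
lemma contDiffOn_comp (hU : IsOpen U) (hU' : IsOpen U') {f : V → E} {g : P → V' → V}
    (hf : ContDiffOn ℝ ∞ f U) (hg : SFam g U') (hm : ∀ p, MapsTo (g p) U' U) :
    SFam (fun p u => f (g p u)) U' := (of_contDiffOn hU hf).comp hU hU' hg hm

lemma contDiffOn (hU : IsOpen U) {f : P → V → E} (h : SFam f U) (p : P) :
    ContDiffOn ℝ ∞ (f p) U := contDiffOn_infty.2 fun n => (h n).contDiffOn hU p

lemma continuous {f : P → V → E} (h : SFam f univ) :
    Continuous (fun x : P × V => f x.1 x.2) := by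
  simpa [continuousOn_univ] using h.continuousOn

end SFam

lemma sfam_iff_iteratedFDeriv {U : Set V} (hU : IsOpen U) {f : P → V → E}
    (hf : ∀ p, ContDiffOn ℝ ∞ (f p) U) : SFam f U ↔
      ∀ k, ContinuousOn (fun x : P × V => iteratedFDeriv ℝ k (f x.1) x.2) (univ ×ˢ U) :=
  ⟨fun h k => (CFam.iff_iteratedFDeriv hU hf).1 (h k) k le_rfl,
    fun h _ => (CFam.iff_iteratedFDeriv hU hf).2 fun k _ => h k⟩

end Fam

/-! ### The smooth topology and the colimit topology -/

section Top

open Set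

variable {ι V F P : Type} [NormedAddCommGroup V] [NormedSpace ℝ V]
  [NormedAddCommGroup F] [NormedSpace ℝ F] [TopologicalSpace P] {U : ι → Opens V}

lemma SmoothMap.ext_toFun {f g : SmoothMap U F} (h : ∀ i (x : U i),
    f.toFun ⟨i, x⟩ = g.toFun ⟨i, x⟩) : f = g := by
  cases f; cases g
  congr
  funext x
  exact h x.1 x.2

lemma SmoothMap.piece_apply (f : SmoothMap U F) (i : ι) (x : U i) :
    f.piece i x = f.toFun ⟨i, x⟩ := extendZero_apply _ x

lemma SmoothMap.jet_continuous (i : ι) (k : ℕ) :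
    Continuous fun f : SmoothMap U F => f.jet i k :=
  continuous_iff_le_induced.2 ((iInf_le _ i).trans (iInf_le _ k))

/-- A map into the space of smooth maps is continuous exactly when it is a continuous family of
smooth maps on each piece. -/
lemma SmoothMap.continuous_iff_sfam [FiniteDimensional ℝ V] {f : P → SmoothMap U F} :
    Continuous f ↔ ∀ i, SFam (fun p => (f p).piece i) (U i) := by
  have hj : Continuous f ↔ ∀ i k, Continuous fun p => (f p).jet i k := by
    simp only [continuous_iInf_rng, continuous_induced_rng]
    rfl
  rw [hj]
  refine forall_congr' fun i => ?_
  rw [sfam_iff_iteratedFDeriv (f := fun p => (f p).piece i) (U i).isOpen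
    fun p => (f p).smooth i]
  refine forall_congr' fun k => ?_
  have : ProperSpace V := FiniteDimensional.proper ℝ V
  have : LocallyCompactSpace (U i) := (U i).isOpen.locallyCompactSpace
  have h2 : (Continuous fun p => (f p).jet i k) ↔
      Continuous fun x : P × U i => iteratedFDeriv ℝ k ((f x.1).piece i) x.2 := by
    constructor
    · intro h
      exact ContinuousMap.continuous_uncurry_of_continuous ⟨_, h⟩
    · intro h
      exact ContinuousMap.continuous_of_continuous_uncurry _ h
  rw [h2]
  constructor
  · intro h
    rw [continuousOn_iff_continuous_domRestrict]
    exact h.comp (f := fun x : (univ ×ˢ (U i : Set V) : Set (P × V)) =>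
      ((x.1.1, ⟨x.1.2, x.2.2⟩) : P × U i)) (by fun_prop)
  · intro h
    exact h.comp_continuous (f := fun x : P × U i => (x.1, (x.2 : V))) (by fun_prop)
      fun x => ⟨trivial, x.2.2⟩

instance : T2Space (SmoothMap U F) := by
  refine T2Space.of_injective_continuous
    (f := fun (f : SmoothMap U F) (i : ι) => f.jet i 0) (fun f g h => ?_)
    (continuous_pi fun i => SmoothMap.jet_continuous i 0)
  refine SmoothMap.ext_toFun fun i x => ?_
  have h1 := congrArg (fun j : C(U i, V [×0]→L[ℝ] F) => j x 0) (congrFun h i)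
  have h2 : ∀ f : SmoothMap U F, f.jet i 0 x 0 = f.toFun ⟨i, x⟩ := fun f =>
    (iteratedFDeriv_zero_apply _).trans (f.piece_apply i x)
  rwa [h2, h2] at h1

variable {Q : SmoothMap U F → Prop} {e : SmoothMap U F}

lemma CptSupp.continuous_val : Continuous fun f : CptSupp Q e => f.1 :=
  continuous_iSup_dom.2 fun _ => continuous_coinduced_dom.2 continuous_subtype_val

/-- A continuous family of maps with support in one compact set is continuous for the colimit
topology. -/
lemma CptSupp.continuous_of {g : P → CptSupp Q e} (hg : Continuous fun p => (g p).1)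
    (K : Compacts V) (hK : ∀ p, (g p).1.AgreeOutside e K) : Continuous g := by
  have h1 : Continuous (SuppIn.incl Q e K) :=
    continuous_iSup_rng (i := K) continuous_coinduced_rng
  exact h1.comp (f := fun p => (⟨(g p).1, (g p).2.1, hK p⟩ : SuppIn Q e K)) (hg.subtype_mk _)

/-- A compact family in the colimit topology is supported in one ball. Otherwise it would contain a
sequence whose tails are closed, because each of them meets every stage of the colimit in a finite
set. -/
lemma CptSupp.exists_agreeOutside [CompactSpace P] {g : P → CptSupp Q e}
    (hg : Continuous g) : ∃ R : ℝ, ∀ p, (g p).1.AgreeOutside e (Metric.closedBall 0 R) := by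
  by_contra! hcon
  choose s hs using fun n : ℕ => hcon n
  have hmono : ∀ {f : SmoothMap U F} {K L : Set V}, K ⊆ L → f.AgreeOutside e K →
      f.AgreeOutside e L := fun hKL h i x hx => h i x fun hxK => hx (hKL hxK)
  have hclosed : ∀ N : ℕ, IsClosed {f : CptSupp Q e | ∃ n, N ≤ n ∧ f = g (s n)} := by
    intro N
    refine isClosed_iSup_iff.2 fun K => isClosed_coinduced.2 ?_
    obtain ⟨R, hR⟩ := K.isCompact.isBounded.subset_closedBall 0
    obtain ⟨m, hm⟩ := exists_nat_ge R
    refine Set.Finite.isClosed (Set.Finite.subset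
      (Set.Finite.biUnion (Set.finite_lt_nat m)
        (t := fun n => {f : SuppIn Q e K | f.1 = (g (s n)).1}) fun n _ => ?_) ?_)
    · exact Set.Subsingleton.finite fun a ha b hb => Subtype.ext (ha.trans hb.symm)
    · rintro f ⟨n, -, hn⟩
      have hfn : f.1 = (g (s n)).1 := congrArg Subtype.val hn
      refine mem_biUnion (x := n) (show n < m from ?_) hfn
      by_contra! hmn
      refine hs n (hmono (hR.trans (Metric.closedBall_subset_closedBall
        (hm.trans (by exact_mod_cast hmn)))) ?_)
      rw [← hfn]
      exact f.2.2
  obtain ⟨p, hp⟩ := IsCompact.nonempty_iInter_of_sequence_nonempty_isCompact_isClosed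
    (fun N : ℕ => g ⁻¹' {f : CptSupp Q e | ∃ n, N ≤ n ∧ f = g (s n)})
    (fun N p ⟨n, hn, h⟩ => ⟨n, by omega, h⟩) (fun N => ⟨s N, N, le_rfl, rfl⟩)
    ((hclosed 0).preimage hg).isCompact (fun N => (hclosed N).preimage hg)
  obtain ⟨K, hK, hKp⟩ := (g p).2.2
  obtain ⟨R, hR⟩ := hK.isBounded.subset_closedBall 0
  obtain ⟨m, hm⟩ := exists_nat_ge R
  obtain ⟨n, hmn, hn⟩ := mem_iInter.1 hp m
  refine hs n (hmono (hR.trans (Metric.closedBall_subset_closedBall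
    (hm.trans (by exact_mod_cast hmn)))) ?_)
  rw [← hn]
  exact hKp

end Top

/-! ### A criterion for weak homotopy equivalences -/

section Criterion

open Set

variable {X Y : Type*} [TopologicalSpace X] [TopologicalSpace Y]

/-- Every square formed by `α : A → X` and `β : D → Y`, with `A` closed in the compact space `D`,
is homotopic through such squares to one that has a diagonal lift. -/
def LiftsUpToHomotopy (ρ : C(X, Y)) : Prop :=
  ∀ (D : Type) [TopologicalSpace D] [CompactSpace D] (A : Set D), IsClosed A →
    ∀ (α : C(A, X)) (β : C(D, Y)), (∀ a, ρ (α a) = β a) →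
      ∃ (α' : C(I × A, X)) (β' : C(I × D, Y)) (l : C(D, X)),
        (∀ a, α' (0, a) = α a) ∧ (∀ x, β' (0, x) = β x) ∧
        (∀ t a, ρ (α' (t, a)) = β' (t, a)) ∧ (∀ a : A, α' (1, a) = l a) ∧
        ∀ x, ρ (l x) = β' (1, x)

/-- A collar of a subset `A` of `D`: a self-map `c` of `D` homotopic to the identity relative to
`A`, together with a function `τ` that is `0` on `A` and `1` at all points not mapped to `A`. -/
structure Collar (D : Type) [TopologicalSpace D] (A : Set D) where
  /-- the homotopy from the identity to the self-map that absorbs the collar into `A` -/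
  h : C(I × D, D)
  /-- the height in the collar -/
  τ : C(D, I)
  h_zero : ∀ x, h (0, x) = x
  h_mem : ∀ t, ∀ a ∈ A, h (t, a) = a
  τ_mem : ∀ a ∈ A, τ a = 0
  cover : ∀ x, h (1, x) ∈ A ∨ τ x = 1

/-- In the presence of a collar, a lift up to homotopy of squares can be replaced by one that
restricts to the given map, with the homotopy relative to `A`: the homotopy of squares is performed
in the collar. -/
lemma LiftsUpToHomotopy.exists_lift {ρ : C(X, Y)} (hρ : LiftsUpToHomotopy ρ) {D : Type}
    [TopologicalSpace D] [CompactSpace D] {A : Set D} (hA : IsClosed A) (C : Collar D A)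
    (α : C(A, X)) (β : C(D, Y)) (h : ∀ a, ρ (α a) = β a) :
    ∃ l : C(D, X), (∀ a : A, l a = α a) ∧ (ρ.comp l).HomotopicRel β A := by
  classical
  obtain ⟨α', β', l, h0, h0', h1, h2, h3⟩ := hρ D A hA α β h
  let L : D → X := fun x => if hx : C.h (1, x) ∈ A then α' (C.τ x, ⟨_, hx⟩) else l (C.h (1, x))
  have hc : Continuous fun x => C.h (1, x) := by fun_prop
  have hL : Continuous L := by
    rw [← continuousOn_univ, ← show {x | C.h (1, x) ∈ A} ∪ {x | C.τ x = 1} = univ from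
      eq_univ_of_forall C.cover]
    refine ContinuousOn.union_of_isClosed ?_ ?_ (hA.preimage hc)
      (isClosed_singleton.preimage C.τ.continuous)
    · rw [continuousOn_iff_continuous_domRestrict]
      refine Continuous.congr (f := fun x : {x | C.h (1, x) ∈ A} =>
        α' (C.τ x, ⟨C.h (1, x), x.2⟩)) (by fun_prop) fun x => ?_
      exact Eq.symm (show L x = α' (C.τ x, ⟨C.h (1, x), x.2⟩) from dif_pos x.2)
    · refine ContinuousOn.congr (f := fun x => l (C.h (1, x))) (by fun_prop) fun x hx => ?_
      change C.τ x = 1 at hx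
      by_cases hx' : C.h (1, x) ∈ A
      · simp only [L, dif_pos hx', hx, h2]
      · simp only [L, dif_neg hx']
  have hρL : ∀ x, ρ (L x) = β' (C.τ x, C.h (1, x)) := by
    intro x
    by_cases hx' : C.h (1, x) ∈ A
    · simp only [L, dif_pos hx', h1]
    · simp only [L, dif_neg hx', h3, (C.cover x).resolve_left hx']
  refine ⟨⟨L, hL⟩, ?_, ?_⟩
  · rintro ⟨a, ha⟩
    have h4 : C.h (1, a) ∈ A := by rwa [C.h_mem 1 a ha]
    simp only [ContinuousMap.coe_mk, L, dif_pos h4, C.τ_mem a ha, h0]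
    exact congrArg α (Subtype.ext (C.h_mem 1 a ha))
  · refine ⟨⟨⟨⟨fun x => β' (unitInterval.symm x.1 * C.τ x.2, C.h (unitInterval.symm x.1, x.2)),
      by fun_prop⟩, ?_, ?_⟩, ?_⟩⟩
    · intro x
      simp [hρL]
    · intro x
      simp [h0', C.h_zero]
    · intro t a ha
      simp [hρL, C.τ_mem a ha, C.h_mem _ a ha]

section Cube

variable (N : Type)

/-- The position of a point of the cube relative to the centre. -/
def cubeVec (y : N → I) : N → ℝ := fun i => (y i : ℝ) - 1 / 2

lemma continuous_cubeVec : Continuous (cubeVec N) := by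
  unfold cubeVec
  fun_prop

variable {N} in
lemma abs_cubeVec_le (y : N → I) (i : N) : |cubeVec N y i| ≤ 1 / 2 := by
  have := (y i).2
  rw [abs_le]
  constructor <;> simp only [cubeVec] <;> linarith [this.1, this.2]

variable [Fintype N]

lemma isClosed_cubeBoundary : IsClosed (Cube.boundary N) := by
  have : Cube.boundary N = ⋃ i : N, ({y | y i = 0} ∪ {y | y i = 1}) := by
    ext y
    simp [Cube.boundary]
  rw [this]
  exact isClosed_iUnion_of_finite fun i =>
    (isClosed_singleton.preimage (continuous_apply i)).union
      (isClosed_singleton.preimage (continuous_apply i))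

variable {N}

lemma norm_cubeVec_le (y : N → I) : ‖cubeVec N y‖ ≤ 1 / 2 :=
  (pi_norm_le_iff_of_nonneg (by norm_num)).2 fun i => abs_cubeVec_le y i

lemma norm_cubeVec_of_mem {y : N → I} (hy : y ∈ Cube.boundary N) : ‖cubeVec N y‖ = 1 / 2 := by
  refine le_antisymm (norm_cubeVec_le y) ?_
  obtain ⟨i, hi⟩ := hy
  have h : ‖cubeVec N y i‖ = 1 / 2 := by
    rcases hi with hi | hi <;> norm_num [cubeVec, hi]
  exact h ▸ norm_le_pi_norm _ i

variable (N)

/-- The radial expansion by the factor `2`, truncated at the boundary of the cube. -/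
def cubeExpand : C(N → I, N → I) where
  toFun y i := ⟨1 / 2 + cubeVec N y i / (2 * max ‖cubeVec N y‖ (1 / 4)), by
    have h1 : |cubeVec N y i| ≤ max ‖cubeVec N y‖ (1 / 4) :=
      (norm_le_pi_norm (cubeVec N y) i).trans (le_max_left _ _)
    have h2 : 0 < max ‖cubeVec N y‖ (1 / 4) := lt_max_of_lt_right (by norm_num)
    have h3 : |cubeVec N y i / (2 * max ‖cubeVec N y‖ (1 / 4))| ≤ 1 / 2 := by
      rw [abs_div, abs_of_pos (by positivity : 0 < 2 * max ‖cubeVec N y‖ (1 / 4)),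
        div_le_iff₀ (by positivity)]
      linarith
    rw [abs_le] at h3
    constructor <;> linarith [h3.1, h3.2]⟩
  continuous_toFun := by
    have h := continuous_cubeVec N
    refine continuous_pi fun i => Continuous.subtype_mk ?_ _
    refine continuous_const.add (Continuous.div ((continuous_apply i).comp h) (by fun_prop) ?_)
    intro y
    have h2 : 0 < max ‖cubeVec N y‖ (1 / 4) := lt_max_of_lt_right (by norm_num)
    positivity

/-- The collar of the boundary of a cube given by radial expansion. -/
def cubeCollar : Collar (N → I) (Cube.boundary N) where
  h := ⟨fun x i => ⟨(1 - (x.1 : ℝ)) * x.2 i + x.1 * cubeExpand N x.2 i, by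
      have h1 := x.1.2
      have h2 := (x.2 i).2
      have h3 := (cubeExpand N x.2 i).2
      constructor
      · have := mul_nonneg (sub_nonneg.2 h1.2) h2.1
        have := mul_nonneg h1.1 h3.1
        linarith
      · have := mul_le_mul_of_nonneg_left h2.2 (sub_nonneg.2 h1.2)
        have := mul_le_mul_of_nonneg_left h3.2 h1.1
        linarith⟩, by
      refine continuous_pi fun i => Continuous.subtype_mk ?_ _
      have h : Continuous fun x : I × (N → I) => ((cubeExpand N x.2 i : I) : ℝ) :=
        continuous_subtype_val.comp
          ((continuous_apply i).comp ((cubeExpand N).continuous.comp continuous_snd))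
      fun_prop⟩
  τ := ⟨fun y => projIcc 0 1 zero_le_one (2 - 4 * ‖cubeVec N y‖), by
      have := continuous_cubeVec N
      exact continuous_projIcc.comp (by fun_prop)⟩
  h_zero x := by
    ext i
    simp
  h_mem t y hy := by
    have h := norm_cubeVec_of_mem hy
    ext i
    have h5 : ((cubeExpand N y i : I) : ℝ) = y i := by
      simp only [cubeExpand, ContinuousMap.coe_mk, h]
      norm_num [cubeVec]
    simp only [ContinuousMap.coe_mk, h5]
    ring
  τ_mem y hy := by
    have h := norm_cubeVec_of_mem hy
    simp only [ContinuousMap.coe_mk, h]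
    exact projIcc_of_le_left zero_le_one (by norm_num)
  cover y := by
    by_cases hy : ‖cubeVec N y‖ ≤ 1 / 4
    · right
      exact projIcc_of_right_le zero_le_one (by linarith)
    · left
      push Not at hy
      have hN : Nonempty N := by
        by_contra hN
        rw [not_nonempty_iff] at hN
        have : ‖cubeVec N y‖ = 0 := by simp [Subsingleton.elim (cubeVec N y) 0]
        linarith
      obtain ⟨i, hi⟩ : ∃ i, ‖cubeVec N y i‖ = ‖cubeVec N y‖ := by
        obtain ⟨i, -, hi⟩ := Finset.exists_mem_eq_sup' (s := Finset.univ)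
          Finset.univ_nonempty fun i => ‖cubeVec N y i‖
        refine ⟨i, le_antisymm (norm_le_pi_norm _ i) ?_⟩
        rw [← hi]
        refine (pi_norm_le_iff_of_nonempty _).2 fun j => ?_
        exact Finset.le_sup' (fun i => ‖cubeVec N y i‖) (Finset.mem_univ j)
      refine ⟨i, ?_⟩
      have h6 : max ‖cubeVec N y‖ (1 / 4) = |cubeVec N y i| := by
        rw [max_eq_left hy.le, ← hi, Real.norm_eq_abs]
      have h7 : |cubeVec N y i| ≠ 0 := by
        rw [← Real.norm_eq_abs, hi]
        linarith
      rcases abs_choice (cubeVec N y i) with h8 | h8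
      · right
        ext
        simp only [ContinuousMap.coe_mk, cubeExpand, h6, h8, Set.Icc.coe_one]
        rw [h8] at h7
        field_simp
        ring
      · left
        ext
        simp only [ContinuousMap.coe_mk, cubeExpand, h6, h8, Set.Icc.coe_zero, Set.Icc.coe_one]
        rw [h8] at h7
        have : cubeVec N y i ≠ 0 := by simpa using h7
        field_simp
        ring

end Cube

/-- Homotopies relative to the boundary of a cube lift along a map that lifts squares up to
homotopy. -/
lemma LiftsUpToHomotopy.homotopicRel {ρ : C(X, Y)} (hρ : LiftsUpToHomotopy ρ) {n : ℕ}
    (p q : C(Fin n → I, X)) (hpq : ∀ y ∈ Cube.boundary (Fin n), p y = q y)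
    (H : (ρ.comp p).HomotopicRel (ρ.comp q) (Cube.boundary (Fin n))) :
    p.HomotopicRel q (Cube.boundary (Fin n)) := by
  classical
  obtain ⟨H⟩ := H
  let B := Cube.boundary (Fin (n + 1))
  have htail : Continuous fun z : Fin (n + 1) → I => (fun j : Fin n => z j.succ) := by fun_prop
  let α : (Fin (n + 1) → I) → X := fun z =>
    if z 0 = 1 then q (fun j => z j.succ) else p (fun j => z j.succ)
  have hα : ContinuousOn α B := by
    have hB : B ⊆ {z | z 0 = 1} ∪
        ({z | z 0 = 0} ∪ (fun z j => z (Fin.succ j)) ⁻¹' Cube.boundary (Fin n)) := by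
      rintro z ⟨i, hi⟩
      induction i using Fin.cases with
      | zero => rcases hi with hi | hi
                · exact Or.inr (Or.inl hi)
                · exact Or.inl hi
      | succ i => exact Or.inr (Or.inr ⟨i, hi⟩)
    refine ContinuousOn.mono (ContinuousOn.union_of_isClosed ?_ ?_
      (isClosed_singleton.preimage (continuous_apply 0))
      ((isClosed_singleton.preimage (continuous_apply 0)).union
        ((isClosed_cubeBoundary _).preimage htail))) hB
    · refine ContinuousOn.congr (f := fun z => q (fun j => z j.succ)) (by fun_prop) fun z hz => ?_
      exact if_pos hz
    · refine ContinuousOn.congr (f := fun z => p (fun j => z j.succ)) (by fun_prop) fun z hz => ?_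
      by_cases h1 : z 0 = 1
      · rcases hz with hz | hz
        · exact absurd (hz.symm.trans h1) (by simp)
        · simp only [α, if_pos h1]
          exact (hpq _ hz).symm
      · exact if_neg h1
  obtain ⟨l, hl, -⟩ := hρ.exists_lift (isClosed_cubeBoundary (Fin (n + 1))) (cubeCollar _)
    ⟨B.domRestrict α, continuousOn_iff_continuous_domRestrict.1 hα⟩
    ⟨fun z => H (z 0, fun j => z j.succ), by fun_prop⟩ (by
      rintro ⟨z, i, hi⟩
      change ρ (α z) = H (z 0, fun j => z j.succ)
      have key : ∀ y ∈ Cube.boundary (Fin n), ∀ t, H (t, y) = ρ (p y) := fun y hy t =>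
        H.eq_fst t hy
      by_cases h1 : z 0 = 1
      · simp only [α, if_pos h1, h1]
        exact (H.apply_one _).symm
      · simp only [α, if_neg h1]
        induction i using Fin.cases with
        | zero =>
          rw [hi.resolve_right h1]
          exact (H.apply_zero _).symm
        | succ i => exact (key _ ⟨i, hi⟩ _).symm)
  have hl' : ∀ t y, (t = 0 ∨ t = 1 ∨ y ∈ Cube.boundary (Fin n)) →
      l (Fin.cons t y) = if t = 1 then q y else p y := by
    intro t y hty
    have hm : (Fin.cons t y : Fin (n + 1) → I) ∈ B := by
      rcases hty with h | h | ⟨i, hi⟩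
      · exact ⟨0, Or.inl h⟩
      · exact ⟨0, Or.inr h⟩
      · exact ⟨i.succ, hi⟩
    exact hl ⟨_, hm⟩
  have hcons : Continuous fun x : I × (Fin n → I) => (Fin.cons x.1 x.2 : Fin (n + 1) → I) := by
    refine continuous_pi fun i => ?_
    induction i using Fin.cases with
    | zero => exact continuous_fst
    | succ i => exact (continuous_apply i).comp continuous_snd
  refine ⟨⟨⟨⟨fun x => l (Fin.cons x.1 x.2), by fun_prop⟩, ?_, ?_⟩, ?_⟩⟩
  · intro y
    simpa using hl' 0 y (Or.inl rfl)
  · intro y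
    simpa using hl' 1 y (Or.inr (Or.inl rfl))
  · intro t y hy
    refine (hl' t y (Or.inr (Or.inr hy))).trans ?_
    split_ifs
    · exact (hpq y hy).symm
    · rfl

/-- Surjectivity on homotopy groups is the lifting property for cubes relative to their boundary,
and injectivity the one for homotopies of cubes. -/
lemma LiftsUpToHomotopy.isWeakHomotopyEquiv {ρ : C(X, Y)} (hρ : LiftsUpToHomotopy ρ) :
    IsWeakHomotopyEquiv ρ := by
  refine ⟨⟨?_, ?_⟩, fun n _ x => ⟨?_, ?_⟩⟩
  · intro a b
    induction a using Quotient.inductionOn with | _ a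
    induction b using Quotient.inductionOn with | _ b
    intro h
    obtain ⟨γ⟩ : Joined (ρ a) (ρ b) := Quotient.exact h
    obtain ⟨H⟩ := hρ.homotopicRel (n := 0) (ContinuousMap.const _ a) (ContinuousMap.const _ b)
      (fun y ⟨i, _⟩ => i.elim0)
      ⟨⟨⟨⟨fun x => γ x.1, by fun_prop⟩, fun _ => γ.source, fun _ => γ.target⟩,
        fun _ y ⟨i, _⟩ => i.elim0⟩⟩
    refine Quotient.sound ⟨⟨⟨fun t => H (t, Fin.elim0), by fun_prop⟩, ?_, ?_⟩⟩
    · exact H.apply_zero _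
    · exact H.apply_one _
  · intro b
    induction b using Quotient.inductionOn with | _ b
    obtain ⟨l, -, ⟨H⟩⟩ := hρ.exists_lift (isClosed_cubeBoundary (Fin 0)) (cubeCollar _)
      ⟨fun a => (a.2.choose.elim0 : X), by
        have : IsEmpty (Cube.boundary (Fin 0)) := ⟨fun a => a.2.choose.elim0⟩
        exact continuous_of_discreteTopology⟩
      (ContinuousMap.const _ b) (fun a => a.2.choose.elim0)
    refine ⟨⟦l Fin.elim0⟧, Quotient.sound ⟨⟨⟨fun t => H (t, Fin.elim0), by fun_prop⟩, ?_, ?_⟩⟩⟩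
    · exact H.apply_zero _
    · exact H.apply_one _
  · intro a b
    induction a using Quotient.inductionOn with | _ a
    induction b using Quotient.inductionOn with | _ b
    intro h
    have h' : GenLoop.Homotopic (mapGenLoop (Fin n) ρ x a) (mapGenLoop (Fin n) ρ x b) :=
      Quotient.exact h
    exact Quotient.sound (hρ.homotopicRel a.1 b.1
      (fun y hy => (a.2 y hy).trans (b.2 y hy).symm) h')
  · intro b
    induction b using Quotient.inductionOn with | _ b
    obtain ⟨l, hl, H⟩ := hρ.exists_lift (isClosed_cubeBoundary (Fin n)) (cubeCollar _)
      (ContinuousMap.const _ x) b.1 (fun a => (b.2 a a.2).symm)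
    exact ⟨⟦⟨l, fun y hy => hl ⟨y, hy⟩⟩⟧, Quotient.sound H⟩

end Criterion

/-! ### Injectivity near a compact set and embeddings -/

section Thickening

open Set Metric

variable {P V E : Type} [TopologicalSpace P]
  [NormedAddCommGroup V] [NormedSpace ℝ V] [FiniteDimensional ℝ V]
  [NormedAddCommGroup E] [NormedSpace ℝ E] {U C : Set V} {f : P → V → E}

lemma exists_thickening_forall [CompactSpace P] {W : Type} [PseudoMetricSpace W]
    {C : Set W} (hC : IsCompact C) {S : P × W → Prop} (h : ∀ p, ∀ w ∈ C, ∀ᶠ x in 𝓝 (p, w), S x) :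
    ∃ δ > 0, ∀ w ∈ thickening δ C, ∀ p, S (p, w) := by
  have h1 : ∀ w ∈ C, ∀ᶠ w' in 𝓝 w, ∀ p ∈ (univ : Set P), S (p, w') := fun w hw =>
    isCompact_univ.eventually_forall_of_forall_eventually fun p _ =>
      (continuous_swap.tendsto (w, p)).eventually (h p w hw)
  obtain ⟨δ, hδ, hs⟩ := hC.exists_thickening_subset_open
    (isOpen_setOfPred_eventually_nhds (p := fun w' => ∀ p ∈ (univ : Set P), S (p, w'))) h1
  exact ⟨δ, hδ, fun w hw p => (hs hw).self_of_nhds p trivial⟩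

/-- Near an immersive point, the members of a continuous family of `C¹` maps are uniformly
injective. -/
lemma CFam.eventually_injective (hU : IsOpen U) (hf : CFam 1 f U) (p : P) {u : V} (hu : u ∈ U)
    (hi : Function.Injective (fderiv ℝ (f p) u)) :
    ∀ᶠ x : P × V × V in 𝓝 (p, u, u), f x.1 x.2.1 = f x.1 x.2.2 → x.2.1 = x.2.2 := by
  obtain ⟨K, hK, hT⟩ := (fderiv ℝ (f p) u).toLinearMap.exists_antilipschitzWith
    (LinearMap.ker_eq_bot.2 hi)
  have hK' : (0 : ℝ) < K := by exact_mod_cast hK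
  have hc : ContinuousAt (fun x : P × V => fderiv ℝ (f x.1) x.2) (p, u) :=
    hf.2.2.continuousOn.continuousAt ((isOpen_univ.prod hU).mem_nhds ⟨trivial, hu⟩)
  have h1 : ∀ᶠ x : P × V in 𝓝 (p, u),
      ‖fderiv ℝ (f x.1) x.2 - fderiv ℝ (f p) u‖ < (K : ℝ)⁻¹ / 2 ∧ x.2 ∈ U := by
    refine Filter.Eventually.and ?_ ((continuous_snd.tendsto (p, u)).eventually (hU.mem_nhds hu))
    have := hc.eventually (Metric.ball_mem_nhds _ (by positivity : 0 < (K : ℝ)⁻¹ / 2))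
    filter_upwards [this] with x hx
    rwa [← dist_eq_norm]
  rw [nhds_prod_eq, Filter.eventually_prod_iff] at h1
  obtain ⟨a, ha, b, hb, hab⟩ := h1
  obtain ⟨r, hr, hrb⟩ := Metric.eventually_nhds_iff_ball.1 hb
  have h2 : ∀ᶠ x : P × V × V in 𝓝 (p, u, u), a x.1 ∧ x.2.1 ∈ ball u r ∧ x.2.2 ∈ ball u r := by
    refine (continuous_fst.tendsto _).eventually ha |>.and (Filter.Eventually.and ?_ ?_)
    · exact (continuous_snd.fst.tendsto (p, u, u)).eventually (ball_mem_nhds u hr)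
    · exact (continuous_snd.snd.tendsto (p, u, u)).eventually (ball_mem_nhds u hr)
  filter_upwards [h2] with x ⟨hx1, hx2, hx3⟩ heq
  have h3 := (convex_ball u r).norm_image_sub_le_of_norm_hasFDerivWithin_le'
    (f := f x.1) (f' := fun w => fderiv ℝ (f x.1) w) (φ := fderiv ℝ (f p) u)
    (C := (K : ℝ)⁻¹ / 2) (fun w hw => (hf.differentiableAt hU x.1
      (hab hx1 (hrb w hw)).2).hasFDerivAt.hasFDerivWithinAt)
    (fun w hw => (hab hx1 (hrb w hw)).1.le) hx3 hx2
  rw [heq, sub_self, zero_sub, norm_neg] at h3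
  have h5 : ‖x.2.1 - x.2.2‖ ≤ K * ‖fderiv ℝ (f p) u (x.2.1 - x.2.2)‖ := by
    rw [map_sub, ← dist_eq_norm, ← dist_eq_norm]
    exact hT.le_mul_dist _ _
  have h6 : ‖x.2.1 - x.2.2‖ ≤ ‖x.2.1 - x.2.2‖ / 2 := by
    calc _ ≤ K * ((K : ℝ)⁻¹ / 2 * ‖x.2.1 - x.2.2‖) :=
          h5.trans (mul_le_mul_of_nonneg_left h3 hK'.le)
      _ = _ := by field_simp
  have h7 : ‖x.2.1 - x.2.2‖ = 0 := le_antisymm (by linarith) (norm_nonneg _)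
  exact sub_eq_zero.1 (norm_eq_zero.1 h7)

/-- A compact family of `C¹` maps that are immersive along the compact set `C` is uniformly
immersive near `C`. -/
lemma CFam.exists_thickening_immersive [CompactSpace P] (hU : IsOpen U) (hf : CFam 1 f U)
    (hC : IsCompact C) (hCU : C ⊆ U) (hi : ∀ p, ∀ u ∈ C, Function.Injective (fderiv ℝ (f p) u)) :
    ∃ δ > 0, ∀ u ∈ thickening δ C, ∀ p, Function.Injective (fderiv ℝ (f p) u) := by
  refine exists_thickening_forall (S := fun x => Function.Injective (fderiv ℝ (f x.1) x.2)) hC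
    fun p u hu => ?_
  have hc : ContinuousAt (fun x : P × V => fderiv ℝ (f x.1) x.2) (p, u) :=
    hf.2.2.continuousOn.continuousAt ((isOpen_univ.prod hU).mem_nhds ⟨trivial, hCU hu⟩)
  exact hc.eventually (ContinuousLinearMap.isOpen_injective.mem_nhds (hi p u hu))

/-- A compact family of `C¹` maps that are injective and immersive along the compact set `C` is
uniformly injective near `C`. -/
lemma CFam.exists_thickening_injOn [CompactSpace P] (hU : IsOpen U) (hf : CFam 1 f U)
    (hC : IsCompact C) (hCU : C ⊆ U) (hi : ∀ p, ∀ u ∈ C, Function.Injective (fderiv ℝ (f p) u))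
    (hinj : ∀ p, InjOn (f p) C) : ∃ δ > 0, ∀ p, InjOn (f p) (thickening δ C) := by
  obtain ⟨δ, hδ, h⟩ := exists_thickening_forall (P := P) (hC.prod hC)
    (S := fun x => f x.1 x.2.1 = f x.1 x.2.2 → x.2.1 = x.2.2) (by
      rintro p ⟨u, w⟩ ⟨hu, hw⟩
      by_cases huw : u = w
      · subst huw
        exact hf.eventually_injective hU p (hCU hu) (hi p u hu)
      · have hc : ∀ u ∈ C, ContinuousAt (fun x : P × V => f x.1 x.2) (p, u) := fun u hu =>
          hf.continuousOn.continuousAt ((isOpen_univ.prod hU).mem_nhds ⟨trivial, hCU hu⟩)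
        have h1 : ContinuousAt (fun x : P × V × V => f x.1 x.2.1) (p, u, w) :=
          ContinuousAt.comp (x := (p, u, w)) (g := fun x : P × V => f x.1 x.2)
            (f := fun x : P × V × V => (x.1, x.2.1)) (hc u hu) (by fun_prop)
        have h2 : ContinuousAt (fun x : P × V × V => f x.1 x.2.2) (p, u, w) :=
          ContinuousAt.comp (x := (p, u, w)) (g := fun x : P × V => f x.1 x.2)
            (f := fun x : P × V × V => (x.1, x.2.2)) (hc w hw) (by fun_prop)
        filter_upwards [(h1.ne_iff_eventually_ne h2).1 fun h => huw (hinj p hu hw h)]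
          with x hx h using absurd h hx)
  refine ⟨δ, hδ, fun p u hu w hw => h (u, w) ?_ p⟩
  rw [mem_thickening_iff] at hu hw ⊢
  obtain ⟨a, ha, hua⟩ := hu
  obtain ⟨b, hb, hwb⟩ := hw
  exact ⟨(a, b), ⟨ha, hb⟩, by rw [Prod.dist_eq]; exact max_lt hua hwb⟩

end Thickening

section Embedding

open Set Filter

variable {V E : Type} [NormedAddCommGroup V] [NormedSpace ℝ V] [FiniteDimensional ℝ V]
  [NormedAddCommGroup E] [NormedSpace ℝ E] [FiniteDimensional ℝ E]

/-- A continuous injective map on a closed set that does not decrease the norm far away is a closed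
embedding, since it is proper. -/
lemma isClosedEmbedding_of_norm_le {Z : Set V} (hZ : IsClosed Z) {f : V → E}
    (hf : ContinuousOn f Z) (hi : InjOn f Z) {R : ℝ} (hR : ∀ u ∈ Z, R < ‖u‖ → ‖u‖ ≤ ‖f u‖) :
    Topology.IsClosedEmbedding fun x : Z => f x := by
  have : ProperSpace V := FiniteDimensional.proper ℝ V
  have : ProperSpace E := FiniteDimensional.proper ℝ E
  have hc : Continuous fun x : Z => f x := continuousOn_iff_continuous_domRestrict.1 hf
  refine Topology.IsClosedEmbedding.of_continuous_injective_isClosedMap hc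
    (fun x y h => Subtype.ext (hi x.2 y.2 h)) ?_
  refine IsProperMap.isClosedMap (isProperMap_iff_tendsto_cocompact.2 ⟨hc, ?_⟩)
  rw [← Metric.cobounded_eq_cocompact (α := E), ← tendsto_norm_atTop_iff_cobounded]
  have h1 : Tendsto (fun x : Z => ‖(x : V)‖) (cocompact Z) atTop :=
    (tendsto_norm_cocompact_atTop (E := V)).comp hZ.isClosedEmbedding_subtypeVal.tendsto_cocompact
  refine tendsto_atTop_mono' _ ?_ h1
  filter_upwards [h1.eventually_gt_atTop R] with x hx using hR x x.2 hx

end Embedding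

/-! ### Shears of the plane -/

section Shear

open Set

/-- A smooth function that is `1` on `[-B, B]` and `0` outside `[-B - 1, B + 1]`. -/
def cutoff (B t : ℝ) : ℝ := Real.smoothTransition (B + 1 - t) * Real.smoothTransition (B + 1 + t)

lemma cutoff_contDiff (B : ℝ) : ContDiff ℝ ∞ (cutoff B) := by
  unfold cutoff
  exact (Real.smoothTransition.contDiff.comp (by fun_prop)).mul
    (Real.smoothTransition.contDiff.comp (by fun_prop))

lemma cutoff_nonneg (B t : ℝ) : 0 ≤ cutoff B t :=
  mul_nonneg (Real.smoothTransition.nonneg _) (Real.smoothTransition.nonneg _)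

lemma cutoff_le_one (B t : ℝ) : cutoff B t ≤ 1 :=
  mul_le_one₀ (Real.smoothTransition.le_one _) (Real.smoothTransition.nonneg _)
    (Real.smoothTransition.le_one _)

lemma cutoff_eq_one {B t : ℝ} (h : |t| ≤ B) : cutoff B t = 1 := by
  rw [abs_le] at h
  rw [cutoff, Real.smoothTransition.one_of_one_le (by linarith),
    Real.smoothTransition.one_of_one_le (by linarith), one_mul]

lemma cutoff_eq_zero {B t : ℝ} (h : B + 1 ≤ |t|) : cutoff B t = 0 := by
  rcases le_abs.1 h with h | h
  · rw [cutoff, Real.smoothTransition.zero_of_nonpos (by linarith), zero_mul]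
  · rw [cutoff, Real.smoothTransition.zero_of_nonpos (x := B + 1 + t) (by linarith), mul_zero]

lemma cutoff_neg (B t : ℝ) : cutoff B (-t) = cutoff B t := by
  simp only [cutoff, sub_neg_eq_add, ← sub_eq_add_neg]
  rw [mul_comm]

lemma deriv_cutoff_nonpos {B t : ℝ} (hB : 0 ≤ B) (ht : 0 < t) : deriv (cutoff B) t ≤ 0 := by
  have h1 : cutoff B =ᶠ[𝓝 t] fun t => Real.smoothTransition (B + 1 - t) := by
    filter_upwards [lt_mem_nhds ht] with s hs
    rw [cutoff, Real.smoothTransition.one_of_one_le (x := B + 1 + s) (by linarith), mul_one]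
  rw [h1.deriv_eq]
  have h2 : Antitone fun t => Real.smoothTransition (B + 1 - t) := fun a b hab =>
    Real.smoothTransition.monotone (by linarith)
  exact h2.deriv_nonpos

lemma deriv_cutoff_nonneg {B t : ℝ} (hB : 0 ≤ B) (ht : t < 0) : 0 ≤ deriv (cutoff B) t := by
  have h1 : cutoff B = fun t => cutoff B (-t) := funext fun t => (cutoff_neg B t).symm
  rw [h1, deriv_comp_neg]
  have := deriv_cutoff_nonpos hB (neg_pos.2 ht)
  linarith

/-- A smooth increasing function on the line that does not move points outside
`[-B, B]` away from the origin. -/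
structure Spread (B : ℝ) (w : ℝ → ℝ) : Prop where
  contDiff : ContDiff ℝ ∞ w
  deriv_pos : ∀ t, 0 < deriv w t
  bound_nonneg : 0 ≤ B
  le_self : ∀ t, B ≤ t → w t ≤ t
  self_le : ∀ t, t ≤ -B → t ≤ w t

/-- The interpolation between the identity (for `r = 0`, and far from the origin) and `w` (for
`r = 1` on `[-B, B]`). -/
def blend (B : ℝ) (w : ℝ → ℝ) (r t : ℝ) : ℝ := t + r * (cutoff B t * (w t - t))

variable {B : ℝ} {w : ℝ → ℝ}

lemma blend_of_abs_le {r t : ℝ} (h : |t| ≤ B) : blend B w r t = (1 - r) * t + r * w t := by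
  rw [blend, cutoff_eq_one h]
  ring

/-- The interpolation is increasing: where the cutoff decreases, the difference `w t - t` has the
favourable sign. -/
lemma Spread.deriv_blend_pos (hw : Spread B w) {r : ℝ} (h0 : 0 ≤ r) (h1 : r ≤ 1) (t : ℝ) :
    0 < deriv (blend B w r) t := by
  have hd : HasDerivAt (blend B w r)
      (1 + r * (deriv (cutoff B) t * (w t - t) + cutoff B t * (deriv w t - 1))) t := by
    have hc := ((cutoff_contDiff B).differentiable (by simp) t).hasDerivAt
    have hw' := (hw.contDiff.differentiable (by simp) t).hasDerivAt
    exact (hasDerivAt_id t).add ((hc.mul (hw'.sub (hasDerivAt_id t))).const_mul r)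
  rw [hd.deriv]
  have h2 : 0 ≤ deriv (cutoff B) t * (w t - t) := by
    by_cases ht : |t| < B
    · have : cutoff B =ᶠ[𝓝 t] fun _ => 1 := by
        filter_upwards [continuous_abs.continuousAt.eventually (gt_mem_nhds ht)] with s hs
        exact cutoff_eq_one (le_of_lt hs)
      simp [this.deriv_eq]
    · rcases lt_trichotomy t 0 with h | h | h
      · rw [abs_of_neg h] at ht
        exact mul_nonneg (deriv_cutoff_nonneg hw.bound_nonneg h)
          (sub_nonneg.2 (hw.self_le t (by linarith)))
      · subst h
        have hB : B = 0 := by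
          have := hw.bound_nonneg
          simp only [abs_zero, not_lt] at ht
          linarith
        subst hB
        have e1 := hw.le_self 0 le_rfl
        have e2 := hw.self_le 0 (by simp)
        simp [le_antisymm e1 e2]
      · rw [abs_of_pos h] at ht
        exact mul_nonneg_of_nonpos_of_nonpos (deriv_cutoff_nonpos hw.bound_nonneg h)
          (sub_nonpos.2 (hw.le_self t (by linarith)))
  have h3 := hw.deriv_pos t
  have h4 := cutoff_nonneg B t
  have h5 := cutoff_le_one B t
  have h6 : 0 ≤ r * cutoff B t := mul_nonneg h0 h4
  have h7 : r * cutoff B t ≤ 1 := mul_le_one₀ h1 h4 h5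
  have h8 := mul_nonneg h0 h2
  rcases h7.lt_or_eq with h9 | h9
  · nlinarith [mul_nonneg h6 h3.le]
  · nlinarith [mul_nonneg h6 h3.le]

lemma Spread.strictMono_blend (hw : Spread B w) {r : ℝ} (h0 : 0 ≤ r) (h1 : r ≤ 1) :
    StrictMono (blend B w r) := strictMono_of_deriv_pos fun t => hw.deriv_blend_pos h0 h1 t

/-- A bounded monotone function added to a contraction of the line gives a spread. -/
lemma Spread.of_monotone {g : ℝ → ℝ} (hg : ContDiff ℝ ∞ g) (hm : Monotone g) {C κ : ℝ}
    (hC : ∀ t, |g t| ≤ C) (hκ0 : 0 < κ) (hκ1 : κ ≤ 1 / 2) :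
    Spread (2 * C) fun t => κ * t + g t := by
  have hC0 : 0 ≤ C := (abs_nonneg _).trans (hC 0)
  refine ⟨by fun_prop, fun t => ?_, by linarith, fun t ht => ?_, fun t ht => ?_⟩
  · have hd : HasDerivAt (fun t => κ * t + g t) (κ * 1 + deriv g t) t :=
      ((hasDerivAt_id t).const_mul κ).add (hg.differentiable (by simp) t).hasDerivAt
    rw [hd.deriv]
    have := hm.deriv_nonneg (x := t)
    linarith
  · have := (abs_le.1 (hC t)).2
    nlinarith
  · have := (abs_le.1 (hC t)).1
    nlinarith

/-- The Euclidean plane. -/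
abbrev Plane : Type := EuclideanSpace ℝ (Fin 2)

/-- The shear that moves the `k`-th coordinate of the plane by the interpolated function `w`, with
strength depending on the `j`-th coordinate through `θ`. -/
def shear (j k : Fin 2) (θ : ℝ → ℝ) (B : ℝ) (w : ℝ → ℝ) (κ : I) (u : Plane) : Plane :=
  u + (κ : ℝ) • (θ (u j) * (cutoff B (u k) * (w (u k) - u k))) • EuclideanSpace.single k (1 : ℝ)

variable {j k : Fin 2} {θ : ℝ → ℝ}

lemma shear_apply_other (hjk : j ≠ k) (κ : I) (u : Plane) : shear j k θ B w κ u j = u j := by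
  simp [shear, hjk]

lemma shear_apply_self (κ : I) (u : Plane) :
    shear j k θ B w κ u k = blend B w (κ * θ (u j)) (u k) := by
  simp [shear, blend, mul_assoc]

lemma shear_zero (u : Plane) : shear j k θ B w 0 u = u := by simp [shear]

lemma shear_sfam (hθ : ContDiff ℝ ∞ θ) (hw : ContDiff ℝ ∞ w) :
    SFam (shear j k θ B w) univ := by
  have hc : ∀ i : Fin 2, ContDiff ℝ ∞ fun u : Plane => u i := fun i => by fun_prop
  refine (SFam.of_contDiff contDiff_id).add isOpen_univ (SFam.smul isOpen_univ
    (SFam.of_continuous continuous_subtype_val) (SFam.of_contDiff ?_))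
  exact ((hθ.comp (hc j)).mul (((cutoff_contDiff B).comp (hc k)).mul
    ((hw.comp (hc k)).sub (hc k)))).smul contDiff_const

lemma plane_ext {j k : Fin 2} (hjk : j ≠ k) {u v : Plane} (hj : u j = v j) (hk : u k = v k) :
    u = v := by
  ext i
  have : i = j ∨ i = k := by omega
  rcases this with rfl | rfl <;> assumption

lemma Spread.shear_injective (hw : Spread B w) (hjk : j ≠ k) (h0 : ∀ t, 0 ≤ θ t)
    (h1 : ∀ t, θ t ≤ 1) (κ : I) : Function.Injective (shear j k θ B w κ) := by
  intro u v huv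
  have hj : u j = v j := by
    have := congrArg (fun z : Plane => z j) huv
    simpa only [shear_apply_other hjk] using this
  refine plane_ext hjk hj ?_
  have hk := congrArg (fun z : Plane => z k) huv
  simp only [shear_apply_self, hj] at hk
  exact (hw.strictMono_blend (mul_nonneg κ.2.1 (h0 _)) (mul_le_one₀ κ.2.2 (h0 _) (h1 _))).injective
    hk

lemma Spread.shear_immersive (hw : Spread B w) (hjk : j ≠ k) (hθ : ContDiff ℝ ∞ θ)
    (h0 : ∀ t, 0 ≤ θ t) (h1 : ∀ t, θ t ≤ 1) (κ : I) (u : Plane) :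
    Function.Injective (fderiv ℝ (shear j k θ B w κ) u) := by
  have hd : HasFDerivAt (shear j k θ B w κ) (fderiv ℝ (shear j k θ B w κ) u) u :=
    ((shear_sfam hθ hw.contDiff).differentiableAt isOpen_univ κ (mem_univ u)).hasFDerivAt
  rw [injective_iff_map_eq_zero]
  intro z hz
  have hj : z j = 0 := by
    have e1 : HasFDerivAt (fun u => shear j k θ B w κ u j)
        ((EuclideanSpace.proj j : Plane →L[ℝ] ℝ).comp (fderiv ℝ (shear j k θ B w κ) u)) u :=
      (EuclideanSpace.proj j : Plane →L[ℝ] ℝ).hasFDerivAt.comp u hd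
    simp only [shear_apply_other hjk] at e1
    have e2 : HasFDerivAt (fun u : Plane => u j) (EuclideanSpace.proj j : Plane →L[ℝ] ℝ) u :=
      (EuclideanSpace.proj j : Plane →L[ℝ] ℝ).hasFDerivAt
    have e3 := congrArg (fun L : Plane →L[ℝ] ℝ => L z) (e1.unique e2)
    simpa [hz] using e3.symm
  have hzk : z = z k • EuclideanSpace.single k (1 : ℝ) := by
    refine plane_ext hjk ?_ ?_
    · simp [hj, hjk]
    · simp
  have hl : HasDerivAt (fun s : ℝ => u + s • z) z 0 := by
    simpa using ((hasDerivAt_id (0 : ℝ)).smul_const z).const_add u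
  have e4 : HasDerivAt (fun s : ℝ => shear j k θ B w κ (u + s • z) k) 0 0 := by
    have e5 := HasFDerivAt.comp_hasDerivAt (0 : ℝ) (f := fun s : ℝ => u + s • z)
      (l := shear j k θ B w κ) (l' := fderiv ℝ (shear j k θ B w κ) u)
      (by simpa using hd) hl
    rw [hz] at e5
    have e6 := (EuclideanSpace.proj k : Plane →L[ℝ] ℝ).hasFDerivAt.comp_hasDerivAt (0 : ℝ) e5
    rw [map_zero] at e6
    exact e6
  simp only [shear_apply_self] at e4
  have hpos := hw.deriv_blend_pos (mul_nonneg κ.2.1 (h0 (u j)))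
    (mul_le_one₀ κ.2.2 (h0 _) (h1 (u j))) (u k)
  have e7 : HasDerivAt (fun s : ℝ => blend B w (κ * θ ((u + s • z) j)) ((u + s • z) k))
      (deriv (blend B w (κ * θ (u j))) (u k) * z k) 0 := by
    have e8 : HasDerivAt (fun s : ℝ => u k + s * z k) (z k) 0 := by
      simpa using ((hasDerivAt_id (0 : ℝ)).mul_const (z k)).const_add (u k)
    have e9 : HasDerivAt (blend B w (κ * θ (u j))) (deriv (blend B w (κ * θ (u j))) (u k))
        (u k + 0 * z k) := by
      rw [zero_mul, add_zero]
      exact (differentiableAt_of_deriv_ne_zero hpos.ne').hasDerivAt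
    have e10 := HasDerivAt.comp (0 : ℝ) (h := fun s : ℝ => u k + s * z k)
      (h₂ := blend B w (κ * θ (u j))) e9 e8
    refine e10.congr_of_eventuallyEq (Filter.Eventually.of_forall fun s => ?_)
    simp [hj]
  have e11 : z k = 0 := by
    rcases mul_eq_zero.1 (e7.unique e4) with h | h
    · exact absurd h hpos.ne'
    · exact h
  rw [hzk, e11, zero_smul]

end Shear

/-! ### The geometry of the planar domain -/

section Planar

open Set

/-- The distance of the lower edges of consecutive thickened intervals. -/
def period (m : ℕ) : ℝ := 2 / ((m : ℝ) + 1)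

/-- The height of the centre line of the strip between the thickened intervals `i` and `i + 1`. -/
def lineHeight (m : ℕ) (ε : ℝ) (i : ℕ) : ℝ := lowerHeight m i + (period m + ε) / 2

/-- Half the width of the strips between consecutive thickened intervals. -/
def gapRadius (m : ℕ) (ε : ℝ) : ℝ := (period m - ε) / 2

variable {m : ℕ} {ε : ℝ}

lemma period_pos : 0 < period m := by
  unfold period
  positivity

lemma lowerHeight_eq (i : ℕ) : lowerHeight m i = -1 + i * period m := by
  unfold lowerHeight period
  field_simp
  ring

lemma lineHeight_eq (i : ℕ) : lineHeight m ε i = -1 + i * period m + (period m + ε) / 2 := by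
  rw [lineHeight, lowerHeight_eq]

lemma period_mul : ((m : ℝ) + 1) * period m = 2 := by
  unfold period
  field_simp

lemma gapRadius_pos (hε : ε < period m) : 0 < gapRadius m ε := by
  unfold gapRadius
  linarith

lemma gapRadius_lt_one (hε : 0 < ε) : gapRadius m ε < 1 := by
  have h := period_mul (m := m)
  have := period_pos (m := m)
  unfold gapRadius
  nlinarith [mul_nonneg (Nat.cast_nonneg (α := ℝ) m) this.le]

lemma abs_lineHeight_add_lt (hε0 : 0 < ε) (i : Fin m) :
    |lineHeight m ε i| + gapRadius m ε < 1 := by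
  have h := period_mul (m := m)
  have hp := period_pos (m := m)
  have hi : ((i : ℕ) : ℝ) + 1 ≤ m := by exact_mod_cast i.2
  have hi' := mul_le_mul_of_nonneg_right hi hp.le
  have hi0 : 0 ≤ ((i : ℕ) : ℝ) * period m := by positivity
  rw [← lt_sub_iff_add_lt, abs_lt, lineHeight_eq, gapRadius]
  constructor <;> nlinarith

lemma abs_lineHeight_lt (hε0 : 0 < ε) (hε : ε < period m) (i : Fin m) :
    |lineHeight m ε i| < 1 := by
  have := abs_lineHeight_add_lt hε0 i
  have := gapRadius_pos hε
  linarith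

/-- The strips around different lines are disjoint. -/
lemma lineHeight_unique (hε0 : 0 < ε) {y : ℝ} {i j : Fin m}
    (hi : |y - lineHeight m ε i| < gapRadius m ε) (hj : |y - lineHeight m ε j| < gapRadius m ε) :
    i = j := by
  rw [abs_lt, lineHeight_eq, gapRadius] at hi hj
  have hp := period_pos (m := m)
  have key : ∀ a b : ℕ, ((a : ℝ) - b) * period m < period m → a ≤ b := by
    intro a b h
    have h1 : (a : ℝ) < b + 1 := by nlinarith
    exact Nat.lt_succ_iff.1 (by exact_mod_cast h1)
  refine Fin.ext (le_antisymm (key _ _ ?_) (key _ _ ?_)) <;> nlinarith [hi.1, hi.2, hj.1, hj.2]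

lemma mem_planarDomain {u : Plane} : u ∈ planarDomain m ε ↔
    ∀ i : Fin (m + 1), |u 0| ≤ 1 → lowerHeight m i ≤ u 1 → lowerHeight m i + ε < u 1 := by
  change u ∈ (⋃ i : Fin (m + 1), thickInterval m ε i)ᶜ ↔ _
  simp only [mem_compl_iff, mem_iUnion, not_exists, thickInterval, mem_ofPred_eq, not_and, mem_Icc,
    not_le, abs_le]

lemma mem_planarDomain_of_lt_abs_zero {u : Plane} (h : 1 < |u 0|) : u ∈ planarDomain m ε :=
  mem_planarDomain.2 fun _ h' => absurd h' (not_le.2 h)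

lemma mem_planarDomain_of_lt_abs_one (hε : ε < period m) {u : Plane} (h : 1 ≤ |u 1|)
    (h' : u 1 ≠ -1) : u ∈ planarDomain m ε := by
  refine mem_planarDomain.2 fun i _ h1 => ?_
  rw [lowerHeight_eq] at h1 ⊢
  have hp := period_pos (m := m)
  have hm := period_mul (m := m)
  have hi : ((i : ℕ) : ℝ) ≤ m := by exact_mod_cast Nat.lt_succ_iff.1 i.2
  have hi' := mul_le_mul_of_nonneg_right hi hp.le
  have hi0 : 0 ≤ ((i : ℕ) : ℝ) * period m := by positivity
  rcases le_abs.1 h with h | h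
  · nlinarith
  · exact absurd (le_antisymm (by linarith) (by linarith)) h'

lemma mem_planarDomain_of_strip {u : Plane} {i : Fin m}
    (h : |u 1 - lineHeight m ε i| < gapRadius m ε) : u ∈ planarDomain m ε := by
  refine mem_planarDomain.2 fun k _ h1 => ?_
  rw [lowerHeight_eq] at h1 ⊢
  rw [abs_lt, lineHeight_eq, gapRadius] at h
  have hp := period_pos (m := m)
  have h2 : ((k : ℕ) : ℝ) ≤ (i : ℕ) := by
    have h3 : ((k : ℕ) : ℝ) < (i : ℕ) + 1 := by nlinarith [h.2]
    exact_mod_cast Nat.lt_succ_iff.1 (by exact_mod_cast h3)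
  have h4 := mul_le_mul_of_nonneg_right h2 hp.le
  linarith [h.1]

/-- The part of the planar domain between the vertical lines `±1` consists of two half strips and
the strips between the thickened intervals. -/
lemma planarDomain_cases {u : Plane} (hu : u ∈ planarDomain m ε) (h0 : |u 0| ≤ 1) :
    u 1 < -1 ∨ lowerHeight m m + ε < u 1 ∨
      ∃ i : Fin m, |u 1 - lineHeight m ε i| < gapRadius m ε := by
  rw [mem_planarDomain] at hu
  by_cases h1 : u 1 < -1
  · exact Or.inl h1
  push Not at h1
  right
  have hp := period_pos (m := m)
  set n := ⌊(u 1 + 1) / period m⌋₊ with hn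
  have hn1 : (n : ℝ) * period m ≤ u 1 + 1 := by
    have := Nat.floor_le (div_nonneg (by linarith) hp.le : 0 ≤ (u 1 + 1) / period m)
    rwa [← hn, le_div_iff₀ hp] at this
  have hn2 : u 1 + 1 < ((n : ℝ) + 1) * period m := by
    have := Nat.lt_floor_add_one ((u 1 + 1) / period m)
    rwa [← hn, div_lt_iff₀ hp] at this
  by_cases hm : m ≤ n
  · left
    refine hu (Fin.last m) h0 ?_
    rw [lowerHeight_eq, Fin.val_last]
    have : (m : ℝ) ≤ n := by exact_mod_cast hm
    have := mul_le_mul_of_nonneg_right this hp.le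
    linarith
  · right
    push Not at hm
    refine ⟨⟨n, hm⟩, ?_⟩
    have h2 := hu ⟨n, by omega⟩ h0 (by rw [lowerHeight_eq]; simp only; linarith)
    rw [lowerHeight_eq] at h2
    rw [abs_lt, lineHeight_eq, gapRadius]
    simp only at h2 ⊢
    constructor <;> linarith

/-- The union of the exterior of a square and of thin closed strips around the lines. -/
def tube (m : ℕ) (ε R δ : ℝ) : Set Plane :=
  {u | R ≤ |u 0| ∨ R ≤ |u 1| ∨ ∃ i : Fin m, |u 1 - lineHeight m ε i| ≤ δ}

lemma isClosed_tube (R δ : ℝ) : IsClosed (tube m ε R δ) := by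
  have : tube m ε R δ = {u | R ≤ |u 0|} ∪ ({u | R ≤ |u 1|} ∪
      ⋃ i : Fin m, {u | |u 1 - lineHeight m ε i| ≤ δ}) := by
    ext u
    simp [tube]
  rw [this]
  refine (isClosed_le (by fun_prop) (by fun_prop)).union
    ((isClosed_le (by fun_prop) (by fun_prop)).union (isClosed_iUnion_of_finite fun i => ?_))
  exact isClosed_le (by fun_prop) (by fun_prop)

lemma exists_smooth_cutoff {s t : Set ℝ} (hs : IsClosed s) (ht : IsClosed t) (h : Disjoint s t) :
    ∃ f : ℝ → ℝ, ContDiff ℝ ∞ f ∧ (∀ x, 0 ≤ f x) ∧ (∀ x, f x ≤ 1) ∧ (∀ x ∈ s, f x = 0) ∧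
      ∀ x ∈ t, f x = 1 := by
  obtain ⟨f, h0, h1, h2⟩ := exists_contMDiffMap_zero_one_of_isClosed (n := ⊤)
    (modelWithCornersSelf ℝ ℝ) hs ht h
  exact ⟨f, f.contMDiff.contDiff, fun x => (h2 x).1, fun x => (h2 x).2, h0, h1⟩

end Planar

/-! ### Compression of the planar domain -/

section Compression

open Set

variable {m : ℕ} {ε : ℝ}

/-- A spread of the vertical axis that contracts the strips and moves the outer half strips away
from the square of radius `R`. -/
lemma exists_vertical_spread (hε0 : 0 < ε) (hε : ε < period m) {R δ : ℝ} (hR : 0 ≤ R)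
    (hδ : 0 < δ) : ∃ (B : ℝ) (v : ℝ → ℝ) (κ : ℝ),
      Spread B v ∧ R ≤ B ∧ 1 ≤ B ∧ 0 < κ ∧ κ ≤ 1 ∧ κ ≤ δ ∧
      v (-1) ≤ -R ∧ R ≤ v (lowerHeight m m + ε) ∧
      ∀ (i : Fin m) (y : ℝ), |y - lineHeight m ε i| ≤ gapRadius m ε →
        v y = lineHeight m ε i + κ * (y - lineHeight m ε i) := by
  have hp := period_pos (m := m)
  have hpm := period_mul (m := m)
  let S : ℕ → ℝ → ℝ := fun k y => Real.smoothTransition ((y - lowerHeight m k) / ε)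
  have hS0 : ∀ k y, 0 ≤ S k y := fun k y => Real.smoothTransition.nonneg _
  have hS1 : ∀ k y, S k y ≤ 1 := fun k y => Real.smoothTransition.le_one _
  have hSm : ∀ k, Monotone (S k) := fun k a b hab =>
    Real.smoothTransition.monotone (by gcongr)
  have hSc : ∀ k, ContDiff ℝ ∞ (S k) := fun k => Real.smoothTransition.contDiff.comp (by fun_prop)
  have hSz : ∀ k y, y ≤ lowerHeight m k → S k y = 0 := fun k y h =>
    Real.smoothTransition.zero_of_nonpos (div_nonpos_of_nonpos_of_nonneg (by linarith) hε0.le)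
  have hSo : ∀ k y, lowerHeight m k + ε ≤ y → S k y = 1 := fun k y h =>
    Real.smoothTransition.one_of_one_le ((one_le_div hε0).2 (by linarith))
  let T : ℝ → ℝ := fun y => ∑ k ∈ Finset.range (m + 1), S k y
  have hT0 : ∀ y, 0 ≤ T y := fun y => Finset.sum_nonneg fun k _ => hS0 k y
  have hT1 : ∀ y, T y ≤ m + 1 := fun y => by
    have := Finset.sum_le_sum (s := Finset.range (m + 1)) fun k _ => hS1 k y
    simpa using this
  have hTm : Monotone T := fun a b hab => Finset.sum_le_sum fun k _ => hSm k hab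
  have hTc : ContDiff ℝ ∞ T := ContDiff.sum fun k _ => hSc k
  let κ := min (1 / 2) δ
  have hκ0 : 0 < κ := lt_min (by norm_num) hδ
  have hκ1 : κ ≤ 1 / 2 := min_le_left _ _
  -- A crude bound for the heights that occur; the outer steps have height `Q`.
  let c := lineHeight m ε 0 - period m
  let Q := R + 10
  have hc1 : -1 ≤ c + 2 := by
    simp only [c, lineHeight_eq]
    norm_num
    nlinarith [mul_nonneg (Nat.cast_nonneg (α := ℝ) m) hp.le]
  have hc2 : c ≤ 0 := by
    simp only [c, lineHeight_eq]
    norm_num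
    linarith
  let g : ℝ → ℝ := fun y => (1 - κ) * (c + period m * T y) + Q * (S m y + S 0 y - 1)
  have hin : ∀ y, |(1 - κ) * (c + period m * T y)| ≤ 3 := by
    intro y
    have h1 : 0 ≤ period m * T y := mul_nonneg hp.le (hT0 y)
    have h2 : period m * T y ≤ 2 := by
      rw [← hpm, mul_comm ((m : ℝ) + 1)]
      exact mul_le_mul_of_nonneg_left (hT1 y) hp.le
    rw [abs_mul, abs_of_nonneg (by linarith : 0 ≤ 1 - κ)]
    have h3 : |c + period m * T y| ≤ 3 := abs_le.2 ⟨by linarith, by linarith⟩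
    nlinarith [abs_nonneg (c + period m * T y)]
  have hgb : ∀ y, |g y| ≤ 3 + Q := by
    intro y
    refine (abs_add_le _ _).trans (add_le_add (hin y) ?_)
    rw [abs_mul, abs_of_nonneg (by positivity : 0 ≤ Q)]
    have : |S m y + S 0 y - 1| ≤ 1 := abs_le.2
      ⟨by linarith [hS0 m y, hS0 0 y], by linarith [hS1 m y, hS1 0 y]⟩
    exact mul_le_of_le_one_right (by positivity) this
  have hgm : Monotone g := fun a b hab => by
    have h1 := hTm hab
    have h2 := hSm m hab
    have h3 := hSm 0 hab
    refine add_le_add (mul_le_mul_of_nonneg_left ?_ (by linarith))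
      (mul_le_mul_of_nonneg_left (by linarith) (by positivity))
    linarith [mul_le_mul_of_nonneg_left h1 hp.le]
  have hgc : ContDiff ℝ ∞ g :=
    (contDiff_const.mul (contDiff_const.add (contDiff_const.mul hTc))).add
      (contDiff_const.mul (((hSc m).add (hSc 0)).sub contDiff_const))
  refine ⟨2 * (3 + Q), fun t => κ * t + g t, κ, Spread.of_monotone hgc hgm hgb hκ0 hκ1,
    by simp only [Q]; linarith, by simp only [Q]; linarith, hκ0, by linarith, min_le_right _ _,
    ?_, ?_, ?_⟩
  · have h1 : S m (-1) = 0 := hSz m _ (by rw [lowerHeight_eq]; nlinarith)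
    have h2 : S 0 (-1) = 0 := hSz 0 _ (by rw [lowerHeight_eq]; norm_num)
    have h3 := (abs_le.1 (hin (-1))).2
    simp only [g, h1, h2, Q]
    linarith
  · set y := lowerHeight m m + ε with hy
    have hy1 : -1 ≤ y := by
      rw [hy, lowerHeight_eq]
      nlinarith
    have h1 : S m y = 1 := hSo m _ le_rfl
    have h2 : S 0 y = 1 := hSo 0 _ (by
      rw [hy, lowerHeight_eq, lowerHeight_eq]
      norm_num
      positivity)
    have h3 := (abs_le.1 (hin y)).1
    simp only [g, h1, h2, Q]
    nlinarith
  · intro i y hy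
    rw [abs_le, gapRadius] at hy
    have hi : ((i : ℕ) : ℝ) + 1 ≤ m := by exact_mod_cast i.2
    have hlo : ∀ k : ℕ, k ≤ i → S k y = 1 := by
      intro k hk
      refine hSo k y ?_
      have : (k : ℝ) ≤ (i : ℕ) := by exact_mod_cast hk
      have := mul_le_mul_of_nonneg_right this hp.le
      rw [lowerHeight_eq]
      have h1 := hy.1
      rw [lineHeight_eq] at h1
      linarith
    have hhi : ∀ k : ℕ, (i : ℕ) + 1 ≤ k → S k y = 0 := by
      intro k hk
      refine hSz k y ?_
      have : ((i : ℕ) : ℝ) + 1 ≤ k := by exact_mod_cast hk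
      have := mul_le_mul_of_nonneg_right this hp.le
      rw [lowerHeight_eq]
      have h1 := hy.2
      rw [lineHeight_eq] at h1
      linarith
    have hsum : T y = (i : ℕ) + 1 := by
      have h1 : T y = ∑ k ∈ Finset.range (m + 1), if k ≤ (i : ℕ) then (1 : ℝ) else 0 := by
        refine Finset.sum_congr rfl fun k _ => ?_
        split_ifs with h
        · exact hlo k h
        · exact hhi k (by omega)
      rw [h1, ← Finset.sum_filter, Finset.sum_const, nsmul_eq_mul, mul_one]
      have h2 : (Finset.range (m + 1)).filter (fun k => k ≤ (i : ℕ)) =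
          Finset.range ((i : ℕ) + 1) := by
        ext k
        simp only [Finset.mem_filter, Finset.mem_range]
        have := i.2
        omega
      rw [h2, Finset.card_range]
      push_cast
      rfl
    simp only [g, hsum, hlo 0 (by omega), hhi m i.2, c, lineHeight_eq]
    push_cast
    ring

lemma exists_horizontal_spread {R : ℝ} (hR : 1 ≤ R) : ∃ (B : ℝ) (h : ℝ → ℝ), Spread B h ∧ 1 ≤ B ∧
    h (-1) ≤ -R ∧ R ≤ h 1 := by
  have hS : Monotone fun t : ℝ => 2 * R * (Real.smoothTransition ((t + 1) / 2) - 1 / 2) := by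
    intro a b hab
    have : Real.smoothTransition ((a + 1) / 2) ≤ Real.smoothTransition ((b + 1) / 2) :=
      Real.smoothTransition.monotone (by linarith)
    exact mul_le_mul_of_nonneg_left (by linarith) (by linarith)
  have hc : ContDiff ℝ ∞ fun t : ℝ => 2 * R * (Real.smoothTransition ((t + 1) / 2) - 1 / 2) :=
    contDiff_const.mul
      ((Real.smoothTransition.contDiff.comp (f := fun t : ℝ => (t + 1) / 2) (by fun_prop)).sub
        contDiff_const)
  refine ⟨2 * R, _, Spread.of_monotone (κ := 1 / 2) (C := R) hc hS (fun t => ?_)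
    (by norm_num) le_rfl, by linarith, ?_, ?_⟩
  · have h1 := Real.smoothTransition.nonneg ((t + 1) / 2)
    have h2 := Real.smoothTransition.le_one ((t + 1) / 2)
    rw [abs_le]
    constructor <;> nlinarith
  · rw [Real.smoothTransition.zero_of_nonpos (by norm_num)]
    linarith
  · rw [Real.smoothTransition.one_of_one_le (by norm_num)]
    linarith

/-- A compactly supported isotopy `φ` of the plane that fixes the lines pointwise, maps the planar
domain into itself at all times, and finally pushes it into a tube around the lines and the exterior
of a square. -/
structure IsCompression (m : ℕ) (ε R δ : ℝ) (φ : I → Plane → Plane) : Prop where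
  sfam : SFam φ univ
  injective : ∀ κ, Function.Injective (φ κ)
  immersive : ∀ κ u, Function.Injective (fderiv ℝ (φ κ) u)
  zero : ∀ u, φ 0 u = u
  fixed_far : ∃ T, ∀ κ u, T < ‖u‖ → φ κ u = u
  fixed_line : ∀ κ (i : Fin m) (u : Plane), u 1 = lineHeight m ε i → φ κ u = u
  mapsTo : ∀ κ, ∀ u ∈ planarDomain m ε, φ κ u ∈ planarDomain m ε
  compress : ∀ u ∈ planarDomain m ε, φ 1 u ∈ tube m ε R δ

lemma shear_eq_self {j k : Fin 2} {θ : ℝ → ℝ} {B : ℝ} {w : ℝ → ℝ} {κ : I} {u : Plane}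
    (h : θ (u j) = 0 ∨ B + 1 ≤ |u k| ∨ w (u k) = u k) : shear j k θ B w κ u = u := by
  rcases h with h | h | h
  · simp [shear, h]
  · simp [shear, cutoff_eq_zero h]
  · simp [shear, h]

lemma lowerHeight_last_lt (hε : ε < period m) : lowerHeight m m + ε < 1 := by
  rw [lowerHeight_eq]
  linarith [period_mul (m := m)]

lemma neg_one_lt_lowerHeight_last (hε0 : 0 < ε) : -1 < lowerHeight m m + ε := by
  rw [lowerHeight_eq]
  linarith [mul_nonneg (Nat.cast_nonneg (α := ℝ) m) (period_pos (m := m)).le]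

lemma mem_planarDomain_of_last_lt {u : Plane} (h : lowerHeight m m + ε < u 1) :
    u ∈ planarDomain m ε := by
  refine mem_planarDomain.2 fun i _ _ => lt_of_le_of_lt ?_ h
  rw [lowerHeight_eq, lowerHeight_eq]
  have hi : ((i : ℕ) : ℝ) ≤ m := by exact_mod_cast Nat.lt_succ_iff.1 i.2
  linarith [mul_le_mul_of_nonneg_right hi (period_pos (m := m)).le]

lemma mem_planarDomain_of_lt_neg_one {u : Plane} (h : u 1 < -1) : u ∈ planarDomain m ε := by
  refine mem_planarDomain.2 fun i _ h1 => ?_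
  rw [lowerHeight_eq] at h1
  linarith [mul_nonneg (Nat.cast_nonneg (α := ℝ) (i : ℕ)) (period_pos (m := m)).le]

lemma lt_abs_blend {B : ℝ} {w : ℝ → ℝ} (hw : Spread B w) {r R : ℝ} (h0 : 0 ≤ r) (h1 : r ≤ 1)
    (hlo : blend B w r (-1) ≤ -R) (hhi : R ≤ blend B w r 1) {t : ℝ} (ht : 1 < |t|) :
    R < |blend B w r t| := by
  have hm := hw.strictMono_blend h0 h1
  rcases lt_abs.1 ht with h | h
  · exact lt_abs.2 (Or.inl (hhi.trans_lt (hm h)))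
  · have h2 : t < -1 := by linarith
    have := hm h2
    exact lt_abs.2 (Or.inr (by linarith))

/-- A horizontal expansion of `[-1, 1]` performed after a vertical one that contracts the strips.
The horizontal one is switched off on the lines, which are therefore fixed. -/
lemma exists_isCompression (hε0 : 0 < ε) (hε : ε < period m) {R δ : ℝ} (hR : 1 ≤ R)
    (hδ : 0 < δ) : ∃ φ, IsCompression m ε R δ φ := by
  obtain ⟨B, v, κ, hv, hRB, hB, hκ0, hκ1, hκδ, hv1, hv2, hv3⟩ :=
    exists_vertical_spread hε0 hε (R := R) (by linarith) hδ
  obtain ⟨B', h, hh, hB', hh1, hh2⟩ := exists_horizontal_spread hR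
  obtain ⟨θ, hθ, hθ0, hθ1, hθs, hθt⟩ := exists_smooth_cutoff
    (s := (⋃ i : Fin m, {lineHeight m ε i}) ∪ {y | R + 1 ≤ |y|})
    (t := {y | |y| ≤ R} ∩ ⋂ i : Fin m, {y | δ ≤ |y - lineHeight m ε i|})
    ((isClosed_iUnion_of_finite fun i => isClosed_singleton).union
      (isClosed_le (by fun_prop) (by fun_prop)))
    ((isClosed_le (by fun_prop) (by fun_prop)).inter
      (isClosed_iInter fun i => isClosed_le (by fun_prop) (by fun_prop))) (by
      rw [Set.disjoint_left]
      rintro y (hy | hy) ⟨hy1, hy2⟩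
      · obtain ⟨i, hi⟩ := mem_iUnion.1 hy
        have h1 : δ ≤ |y - lineHeight m ε i| := mem_iInter.1 hy2 i
        rw [mem_singleton_iff.1 hi, sub_self, abs_zero] at h1
        linarith
      · have h1 : R + 1 ≤ |y| := hy
        have h2 : |y| ≤ R := hy1
        linarith)
  have h01 : (0 : Fin 2) ≠ 1 := by decide
  have h10 : (1 : Fin 2) ≠ 0 := by decide
  let V : I → Plane → Plane := shear 0 1 (cutoff 1) B v
  let H : I → Plane → Plane := shear 1 0 θ B' h
  have hV0 : ∀ κ u, V κ u 0 = u 0 := fun κ u => shear_apply_other h01 κ u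
  have hV1 : ∀ (κ : I) u, V κ u 1 = blend B v (κ * cutoff 1 (u 0)) (u 1) := fun κ u =>
    shear_apply_self κ u
  have hH0 : ∀ (κ : I) u, H κ u 0 = blend B' h (κ * θ (u 1)) (u 0) := fun κ u =>
    shear_apply_self κ u
  have hH1 : ∀ κ u, H κ u 1 = u 1 := fun κ u => shear_apply_other h10 κ u
  have hVs : SFam V univ := shear_sfam (cutoff_contDiff 1) hv.contDiff
  have hHs : SFam H univ := shear_sfam hθ hh.contDiff
  have hgap : ∀ i : Fin m, |lineHeight m ε i| + gapRadius m ε < 1 := abs_lineHeight_add_lt hε0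
  have hg0 := gapRadius_pos hε
  have hg1 := gapRadius_lt_one (m := m) hε0
  -- The effect of the vertical shear on the boundary of the strips and half strips.
  have hy1 : |lowerHeight m m + ε| ≤ B := (abs_le.2 ⟨(neg_one_lt_lowerHeight_last hε0).le,
    (lowerHeight_last_lt hε).le⟩).trans hB
  have hbot : ∀ r, blend B v r (-1) = (1 - r) * (-1) + r * v (-1) := fun r =>
    blend_of_abs_le (by simpa using hB)
  have htop : ∀ r, blend B v r (lowerHeight m m + ε) =
      (1 - r) * (lowerHeight m m + ε) + r * v (lowerHeight m m + ε) := fun r =>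
    blend_of_abs_le hy1
  have hstrip : ∀ r (i : Fin m) y, |y - lineHeight m ε i| < gapRadius m ε →
      blend B v r y - lineHeight m ε i = (1 - r + r * κ) * (y - lineHeight m ε i) := by
    intro r i y hy
    rw [blend_of_abs_le, hv3 i y hy.le]
    · ring
    · have h2 := abs_add_le (y - lineHeight m ε i) (lineHeight m ε i)
      rw [sub_add_cancel] at h2
      linarith [hgap i]
  have hr0 : ∀ (s : I) t, 0 ≤ (s : ℝ) * cutoff 1 t := fun s t =>
    mul_nonneg s.2.1 (cutoff_nonneg _ _)
  have hr1 : ∀ (s : I) t, (s : ℝ) * cutoff 1 t ≤ 1 := fun s t =>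
    mul_le_one₀ s.2.2 (cutoff_nonneg _ _) (cutoff_le_one _ _)
  have hq0 : ∀ (s : I) t, 0 ≤ (s : ℝ) * θ t := fun s t => mul_nonneg s.2.1 (hθ0 _)
  have hq1 : ∀ (s : I) t, (s : ℝ) * θ t ≤ 1 := fun s t => mul_le_one₀ s.2.2 (hθ0 _) (hθ1 _)
  have hVinj : ∀ s, Function.Injective (V s) := hv.shear_injective h01 (cutoff_nonneg 1)
    (cutoff_le_one 1)
  have hHinj : ∀ s, Function.Injective (H s) := hh.shear_injective h10 hθ0 hθ1
  refine ⟨fun s u => H s (V s u), hHs.comp isOpen_univ isOpen_univ hVs fun _ _ _ => trivial,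
    fun s => (hHinj s).comp (hVinj s), fun s u => ?_, fun u => ?_, ?_, fun s i u hu => ?_,
    fun s u hu => ?_, fun u hu => ?_⟩
  · have e : fderiv ℝ (fun u => H s (V s u)) u = (fderiv ℝ (H s) (V s u)).comp (fderiv ℝ (V s) u) :=
      fderiv_comp u (hHs.differentiableAt isOpen_univ s trivial)
        (hVs.differentiableAt isOpen_univ s trivial)
    rw [e]
    exact (hh.shear_immersive h10 hθ hθ0 hθ1 s _).comp
      (hv.shear_immersive h01 (cutoff_contDiff 1) (cutoff_nonneg 1) (cutoff_le_one 1) s u)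
  · rw [show V 0 u = u from shear_zero u]
    exact shear_zero u
  · refine ⟨2 * (B + B' + R + 3), fun s u hu => ?_⟩
    have h1 : ‖u‖ ≤ |u 0| + |u 1| := by
      rw [EuclideanSpace.norm_eq, Fin.sum_univ_two]
      refine Real.sqrt_le_iff.2 ⟨by positivity, ?_⟩
      simp only [Real.norm_eq_abs]
      nlinarith [abs_nonneg (u 0), abs_nonneg (u 1)]
    have h2 : B + B' + R + 3 < |u 0| ∨ B + B' + R + 3 < |u 1| := by
      by_contra! hcon
      linarith [hcon.1, hcon.2]
    rcases h2 with h2 | h2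
    · rw [show V s u = u from shear_eq_self (Or.inl (cutoff_eq_zero (by linarith)))]
      exact shear_eq_self (Or.inr (Or.inl (by linarith)))
    · rw [show V s u = u from shear_eq_self (Or.inr (Or.inl (by linarith)))]
      exact shear_eq_self (Or.inl (hθs _ (Or.inr (show R + 1 ≤ |u 1| by linarith))))
  · rw [show V s u = u from shear_eq_self (Or.inr (Or.inr (by
      rw [hu, hv3 i _ (by simpa using hg0.le), sub_self, mul_zero, add_zero])))]
    exact shear_eq_self (Or.inl (hθs _ (Or.inl (mem_iUnion.2 ⟨i, hu⟩))))
  · have hVM : V s u ∈ planarDomain m ε := by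
      by_cases h0 : |u 0| ≤ 1
      · have a0 := hr0 s (u 0)
        have a1 := hr1 s (u 0)
        have hm := hv.strictMono_blend a0 a1
        rcases planarDomain_cases hu h0 with h1 | h1 | ⟨i, h1⟩
        · refine mem_planarDomain_of_lt_neg_one ?_
          rw [hV1]
          refine (hm h1).trans_le ?_
          rw [hbot]
          nlinarith
        · refine mem_planarDomain_of_last_lt ?_
          rw [hV1]
          refine lt_of_le_of_lt ?_ (hm h1)
          rw [htop]
          nlinarith [lowerHeight_last_lt hε]
        · refine mem_planarDomain_of_strip (i := i) ?_
          rw [hV1, hstrip _ i _ h1, abs_mul]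
          refine lt_of_le_of_lt (mul_le_of_le_one_left (abs_nonneg _) ?_) h1
          rw [abs_le]
          constructor <;> nlinarith
      · exact mem_planarDomain_of_lt_abs_zero (by rw [hV0]; exact not_le.1 h0)
    change H s (V s u) ∈ _
    by_cases h0 : |V s u 0| ≤ 1
    · rw [mem_planarDomain] at hVM ⊢
      intro i _ h2
      rw [hH1] at h2 ⊢
      exact hVM i h0 h2
    · refine mem_planarDomain_of_lt_abs_zero ?_
      rw [hH0]
      have a0 := hq0 s (V s u 1)
      have a1 := hq1 s (V s u 1)
      refine lt_abs_blend hh a0 a1 ?_ ?_ (not_le.1 h0)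
      · rw [blend_of_abs_le (by simpa using hB')]
        nlinarith
      · rw [blend_of_abs_le (by simpa using hB')]
        nlinarith
  · have hVM : 1 < |V 1 u 0| ∨ R ≤ |V 1 u 1| ∨ ∃ i : Fin m, |V 1 u 1 - lineHeight m ε i| ≤ δ := by
      by_cases h0 : |u 0| ≤ 1
      · right
        have e1 : ((1 : I) : ℝ) * cutoff 1 (u 0) = 1 := by simp [cutoff_eq_one h0]
        rw [hV1, e1]
        have hm := hv.strictMono_blend (r := 1) zero_le_one le_rfl
        rcases planarDomain_cases hu h0 with h1 | h1 | ⟨i, h1⟩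
        · left
          have := hm h1
          rw [hbot] at this
          exact le_abs.2 (Or.inr (by linarith))
        · left
          have := hm h1
          rw [htop] at this
          exact le_abs.2 (Or.inl (by linarith))
        · right
          refine ⟨i, ?_⟩
          rw [hstrip _ i _ h1, abs_mul, sub_self, zero_add, one_mul, abs_of_pos hκ0]
          nlinarith [abs_nonneg (u 1 - lineHeight m ε i)]
      · left
        rw [hV0]
        exact not_le.1 h0
    change H 1 (V 1 u) ∈ _
    by_cases hc : R ≤ |V 1 u 1| ∨ ∃ i : Fin m, |V 1 u 1 - lineHeight m ε i| ≤ δ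
    · right
      rwa [hH1]
    · left
      have h2 := hVM.resolve_right hc
      push Not at hc
      have e1 : ((1 : I) : ℝ) * θ (V 1 u 1) = 1 := by
        rw [hθt _ ⟨hc.1.le, mem_iInter.2 fun i => (hc.2 i).le⟩]
        simp
      rw [hH0, e1]
      refine (lt_abs_blend hh zero_le_one le_rfl ?_ ?_ h2).le
      · rw [blend_of_abs_le (by simpa using hB')]
        linarith
      · rw [blend_of_abs_le (by simpa using hB')]
        linarith

end Compression

/-! ### Transport of frames along a family of nonvanishing vector fields -/

section Frames

open Set Metric
open scoped InnerProductSpace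

variable {P V E : Type} [TopologicalSpace P] [NormedAddCommGroup V] [NormedSpace ℝ V]
  [NormedAddCommGroup E] [InnerProductSpace ℝ E]

/-- The inner product of a real inner product space as a continuous bilinear map. -/
def innerB (E : Type) [NormedAddCommGroup E] [InnerProductSpace ℝ E] : E →L[ℝ] E →L[ℝ] ℝ :=
  (isBoundedBilinearMap_inner (𝕜 := ℝ) (E := E)).toContinuousLinearMap

/-- The linear map `w ↦ w + c⁻¹ ⟪u, w⟫ (u' - u)`. For `c = ⟪u, u⟫` it maps `u` to `u'`, and its
inverse is the same map for `c = -⟪u, u'⟫`. -/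
def turn (c : ℝ) (u u' : E) : E →L[ℝ] E :=
  ContinuousLinearMap.id ℝ E + c⁻¹ • ContinuousLinearMap.smulRightL ℝ E E (innerB E u) (u' - u)

lemma turn_apply (c : ℝ) (u u' w : E) : turn c u u' w = w + c⁻¹ • ⟪u, w⟫_ℝ • (u' - u) := rfl

lemma turn_same (c : ℝ) (u : E) : turn c u u = ContinuousLinearMap.id ℝ E := by
  ext w
  simp [turn_apply]

lemma turn_apply_self {u u' : E} (hu : u ≠ 0) : turn ⟪u, u⟫_ℝ u u' u = u' := by
  rw [turn_apply, smul_smul, inv_mul_cancel₀ (inner_self_ne_zero.2 hu), one_smul,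
    add_sub_cancel]

lemma turn_turn {c c' : ℝ} {u u' : E} (hc : c ≠ 0) (hc' : c' ≠ 0)
    (h : c + c' + ⟪u, u' - u⟫_ℝ = 0) (w : E) : turn c u u' (turn c' u u' w) = w := by
  rw [turn_apply, turn_apply, inner_add_right, real_inner_smul_right, real_inner_smul_right,
    add_assoc, ← smul_assoc, ← smul_assoc, ← add_smul]
  have e : c'⁻¹ • ⟪u, w⟫_ℝ + c⁻¹ • (⟪u, w⟫_ℝ + c'⁻¹ * (⟪u, w⟫_ℝ * ⟪u, u' - u⟫_ℝ)) = 0 := by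
    have h1 : ⟪u, u' - u⟫_ℝ = -c - c' := by linarith
    rw [h1, smul_eq_mul, smul_eq_mul]
    field_simp
    ring
  rw [e, zero_smul, add_zero]

lemma SFam.turn {U : Set V} (hU : IsOpen U) {c : P → V → ℝ} {u u' : P → V → E} (hc : SFam c U)
    (hu : SFam u U) (hu' : SFam u' U) (h0 : ∀ p, ∀ x ∈ U, c p x ≠ 0) :
    SFam (fun p x => turn (c p x) (u p x) (u' p x)) U := by
  have h1 : SFam (fun p x => (c p x)⁻¹) U :=
    SFam.contDiffOn_comp (U := {0}ᶜ) isOpen_compl_singleton hU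
      (fun x hx => (contDiffAt_inv ℝ hx).contDiffWithinAt) hc h0
  exact (SFam.of_continuous continuous_const).add hU (h1.smul hU
    ((hu.clm_apply hU (innerB E)).bilin hU (ContinuousLinearMap.smulRightL ℝ E E)
      (hu'.sub hU hu)))

lemma exists_uniform_inner_pos [CompactSpace P] {v : P × I → ℝ → E} (hv : SFam v univ)
    (hne : ∀ p t, v p t ≠ 0) {e₁ : E} {R : ℝ} (hfar : ∀ p t, R < |t| → v p t = e₁) :
    ∃ δ > 0, ∀ x (s s' : I) t, |(s : ℝ) - s'| < δ → 0 < ⟪v (x, s) t, v (x, s') t⟫_ℝ := by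
  have hd : IsCompact {q : I × I | q.1 = q.2} :=
    (isClosed_eq continuous_fst continuous_snd).isCompact
  obtain ⟨δ, hδ, h⟩ := exists_thickening_forall (P := P × Icc (-R) R) hd
    (S := fun q => 0 < ⟪v (q.1.1, q.2.1) q.1.2, v (q.1.1, q.2.2) q.1.2⟫_ℝ) (by
      rintro ⟨x, t⟩ ⟨s, s'⟩ hs
      obtain rfl : s = s' := hs
      have h1 : Continuous fun q : (P × Icc (-R) R) × I × I =>
          ⟪v (q.1.1, q.2.1) q.1.2, v (q.1.1, q.2.2) q.1.2⟫_ℝ :=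
        (hv.continuous.comp (f := fun q : (P × Icc (-R) R) × I × I =>
          ((q.1.1, q.2.1), (q.1.2 : ℝ))) (by fun_prop)).inner
          (hv.continuous.comp (f := fun q : (P × Icc (-R) R) × I × I =>
          ((q.1.1, q.2.2), (q.1.2 : ℝ))) (by fun_prop))
      exact h1.continuousAt.eventually (lt_mem_nhds (real_inner_self_pos.2 (hne _ _))))
  refine ⟨δ, hδ, fun x s s' t hs => ?_⟩
  by_cases ht : |t| ≤ R
  · refine h (s, s') ?_ (x, ⟨t, abs_le.1 ht⟩)
    rw [mem_thickening_iff]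
    refine ⟨(s, s), rfl, ?_⟩
    rw [Prod.dist_eq, dist_self, max_eq_right dist_nonneg, dist_comm]
    exact hs
  · push Not at ht
    have h2 := hne (x, s) t
    rw [hfar _ _ ht] at h2
    rw [hfar _ _ ht, hfar _ _ ht]
    exact real_inner_self_pos.2 h2

/-- A family of nonvanishing vector fields along the line that starts at a constant field `e₁`, and
equals it far away, is the image of `e₁` under a family of linear automorphisms starting at the
identity. It is the product of the automorphisms that turn a vector into the next one along a fine
subdivision of the time interval. -/
lemma exists_frames [CompactSpace P] {v : P × I → ℝ → E} (hv : SFam v univ)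
    (hne : ∀ p t, v p t ≠ 0) {e₁ : E} {R : ℝ} (h0 : ∀ x t, v (x, 0) t = e₁)
    (hfar : ∀ p t, R < |t| → v p t = e₁) :
    ∃ A B : P × I → ℝ → E →L[ℝ] E, SFam A univ ∧ SFam B univ ∧
      (∀ p t w, A p t (B p t w) = w) ∧ (∀ p t w, B p t (A p t w) = w) ∧
      (∀ x t, A (x, 0) t = ContinuousLinearMap.id ℝ E) ∧
      (∀ p t, R < |t| → A p t = ContinuousLinearMap.id ℝ E) ∧ ∀ p t, A p t e₁ = v p t := by
  obtain ⟨δ, hδ, hpos⟩ := exists_uniform_inner_pos hv hne hfar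
  obtain ⟨N, hN⟩ := exists_nat_one_div_lt hδ
  -- The subdivision points, and the time stopped at them.
  let q : ℕ → I := fun j => projIcc 0 1 zero_le_one (j * (1 / ((N : ℝ) + 1)))
  have hq : ∀ j, |(q (j + 1) : ℝ) - q j| < δ := by
    intro j
    refine (abs_projIcc_sub_projIcc zero_le_one).trans_lt ?_
    rw [← sub_mul]
    push_cast
    rw [add_sub_cancel_left, one_mul, abs_of_pos (by positivity)]
    exact hN
  let st : ℕ → P × I → P × I := fun j p => (p.1, min p.2 (q j))
  have hst : ∀ j, Continuous (st j) := fun j => by fun_prop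
  have key : ∀ j : ℕ, ∃ A B : P × I → ℝ → E →L[ℝ] E, SFam A univ ∧ SFam B univ ∧
      (∀ p t w, A p t (B p t w) = w) ∧ (∀ p t w, B p t (A p t w) = w) ∧
      (∀ x t, A (x, 0) t = ContinuousLinearMap.id ℝ E) ∧
      (∀ p t, R < |t| → A p t = ContinuousLinearMap.id ℝ E) ∧
      ∀ p t, A p t e₁ = v (st j p) t := by
    intro j
    induction j with
    | zero =>
      refine ⟨fun _ _ => ContinuousLinearMap.id ℝ E, fun _ _ => ContinuousLinearMap.id ℝ E,
        SFam.of_continuous continuous_const, SFam.of_continuous continuous_const,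
        fun _ _ _ => rfl, fun _ _ _ => rfl, fun _ _ => rfl, fun _ _ _ => rfl, fun p t => ?_⟩
      have : st 0 p = (p.1, 0) := by
        have hq0 : q 0 = 0 := by
          simp only [q, Nat.cast_zero, zero_mul]
          exact projIcc_left _
        simp only [st, hq0]
        exact congrArg _ (min_eq_right p.2.2.1)
      rw [this, h0]
      rfl
    | succ j ih =>
      obtain ⟨A, B, hA, hB, hAB, hBA, hA0, hAR, hAv⟩ := ih
      have hu := hv.reparam (hst j)
      have hu' := hv.reparam (hst (j + 1))
      have hin : ∀ p t, 0 < ⟪v (st j p) t, v (st (j + 1) p) t⟫_ℝ := by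
        intro p t
        refine hpos p.1 _ _ t ?_
        refine lt_of_le_of_lt ?_ (hq j)
        rw [abs_sub_comm (q (j + 1) : ℝ)]
        exact (abs_min_sub_min_le_max (p.2 : ℝ) (q j) p.2 (q (j + 1))).trans (by simp)
      have hself : ∀ p t, ⟪v (st j p) t, v (st j p) t⟫_ℝ ≠ 0 := fun p t =>
        inner_self_ne_zero.2 (hne _ _)
      have hsum : ∀ p t, ⟪v (st j p) t, v (st j p) t⟫_ℝ + -⟪v (st j p) t, v (st (j + 1) p) t⟫_ℝ +
          ⟪v (st j p) t, v (st (j + 1) p) t - v (st j p) t⟫_ℝ = 0 := fun p t => by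
        rw [inner_sub_right]
        ring
      have hT := SFam.turn isOpen_univ (hu.bilin isOpen_univ (innerB E) hu) hu hu'
        fun p t _ => hself p t
      have hT' := SFam.turn isOpen_univ ((hu.bilin isOpen_univ (innerB E) hu').clm_apply
        isOpen_univ (-ContinuousLinearMap.id ℝ ℝ)) hu hu' fun p t _ => (neg_neg_of_pos (hin p t)).ne
      have hst0 : ∀ i x, st i (x, 0) = (x, 0) := fun i x =>
        Prod.ext rfl (min_eq_left (q i).2.1)
      refine ⟨_, _, hT.clm_comp isOpen_univ hA, hB.clm_comp isOpen_univ hT',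
        fun p t w => ?_, fun p t w => ?_, fun x t => ?_, fun p t ht => ?_, fun p t => ?_⟩
      · rw [ContinuousLinearMap.comp_apply, ContinuousLinearMap.comp_apply, hAB]
        exact turn_turn (hself p t) (neg_neg_of_pos (hin p t)).ne (hsum p t) w
      · refine (congrArg _ (turn_turn (neg_neg_of_pos (hin p t)).ne (hself p t) ?_ _)).trans
          (hBA p t w)
        rw [add_comm (-_)]
        exact hsum p t
      · rw [hst0, hst0, hA0, turn_same]
        rfl
      · rw [hAR p t ht, hfar _ _ ht, hfar _ _ ht, turn_same]
        rfl
      · rw [ContinuousLinearMap.comp_apply, hAv]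
        exact turn_apply_self (hne _ _)
  obtain ⟨A, B, hA, hB, hAB, hBA, hA0, hAR, hAv⟩ := key (N + 1)
  refine ⟨A, B, hA, hB, hAB, hBA, hA0, hAR, fun p t => ?_⟩
  have : st (N + 1) p = p := by
    refine Prod.ext rfl (min_eq_left ?_)
    have hq1 : q (N + 1) = 1 := by
      simp only [q]
      push_cast
      rw [mul_one_div_cancel (by positivity)]
      exact projIcc_right _
    rw [hq1]
    exact p.2.2.2
  rw [hAv, this]

end Frames

/-! ### Maps between spaces of embeddings modulo immersions -/

section Functoriality

open Set

variable {ι ι' V V' F F' P : Type} [NormedAddCommGroup V] [NormedSpace ℝ V]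
  [NormedAddCommGroup V'] [NormedSpace ℝ V'] [NormedAddCommGroup F] [NormedSpace ℝ F]
  [NormedAddCommGroup F'] [NormedSpace ℝ F'] [TopologicalSpace P] {U : ι → Opens V}
  {U' : ι' → Opens V'} {Q : SmoothMap U F → Prop} {Q' : SmoothMap U' F' → Prop}
  {e : SmoothMap U F} {e' : SmoothMap U' F'}

/-- The map of spaces of compactly supported maps induced by a continuous operation on smooth maps
that respects supports. -/
def CptSupp.map (T : SmoothMap U F → SmoothMap U' F') (hT : Continuous T)
    (hQ : ∀ f, Q f → Q' (T f)) (hK : ∀ K : Compacts V, ∃ K' : Compacts V', ∀ f : SmoothMap U F,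
      f.AgreeOutside e K → (T f).AgreeOutside e' K') : C(CptSupp Q e, CptSupp Q' e') where
  toFun f := ⟨T f.1, hQ _ f.2.1, by
    obtain ⟨K, hKc, hf⟩ := f.2.2
    obtain ⟨K', hK'⟩ := hK ⟨K, hKc⟩
    exact ⟨K', K'.isCompact, hK' _ hf⟩⟩
  continuous_toFun := by
    refine continuous_iSup_dom.2 fun K => continuous_coinduced_dom.2 ?_
    obtain ⟨K', hK'⟩ := hK K
    exact CptSupp.continuous_of (hT.comp continuous_subtype_val) K' fun f => hK' _ f.2.2

/-- The map of homotopy fibers induced by a commutative square. -/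
def HomotopyFiber.map {X Y X' Y' : Type} [TopologicalSpace X] [TopologicalSpace Y]
    [TopologicalSpace X'] [TopologicalSpace Y'] {f : C(X, Y)} {f' : C(X', Y')} {y : Y} {y' : Y'}
    (a : C(X, X')) (b : C(Y, Y')) (hy : b y = y') (h : ∀ x, b (f x) = f' (a x)) :
    C(HomotopyFiber f y, HomotopyFiber f' y') where
  toFun p := ⟨(a p.1.1, b.comp p.1.2), (congrArg b p.2.1).trans hy, (congrArg b p.2.2).trans (h _)⟩
  continuous_toFun := by
    refine Continuous.subtype_mk (Continuous.prodMk ?_ ?_) _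
    · exact a.continuous.comp (continuous_fst.comp continuous_subtype_val)
    · exact (ContinuousMap.continuous_postcomp b).comp
        (continuous_snd.comp continuous_subtype_val)

variable {he : e.IsImmersion}

/-- A point of the space of embeddings modulo immersions is determined by its path of
immersions. -/
lemma EmbModImm.ext_path {p q : EmbModImm e he} (h : ∀ s, (p.1.2 s).1 = (q.1.2 s).1) : p = q := by
  have h2 : p.1.2 = q.1.2 := ContinuousMap.ext fun s => Subtype.ext (h s)
  refine Subtype.ext (Prod.ext (Subtype.ext ?_) h2)
  have hp : (p.1.2 1).1 = p.1.1.1 := congrArg Subtype.val p.2.2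
  have hq : (q.1.2 1).1 = q.1.1.1 := congrArg Subtype.val q.2.2
  rw [← hp, ← hq]
  exact h 1

lemma EmbModImm.path_zero (p : EmbModImm e he) : (p.1.2 0).1 = e := congrArg Subtype.val p.2.1

lemma EmbModImm.path_one (p : EmbModImm e he) : (p.1.2 1).1.IsSmoothEmbedding := by
  rw [show (p.1.2 1).1 = p.1.1.1 from congrArg Subtype.val p.2.2]
  exact p.1.1.2.1

lemma EmbModImm.continuous_path (g : C(P, EmbModImm e he)) :
    Continuous fun x : P × I => (g x.1).1.2 x.2 := by
  have h1 : Continuous fun x : P => (g x).1.2 :=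
    continuous_snd.comp (continuous_subtype_val.comp g.continuous)
  exact (h1.comp continuous_fst).eval continuous_snd

/-- A continuous family of paths of immersions with uniformly bounded supports that start at the
reference map and end in embeddings is a continuous family of embeddings modulo immersions. -/
lemma EmbModImm.exists_of_family {Ψ : P × I → SmoothMap U F} (hΨ : Continuous Ψ)
    (himm : ∀ p, (Ψ p).IsImmersion) (hemb : ∀ x, (Ψ (x, 1)).IsSmoothEmbedding) (K : Compacts V)
    (hK : ∀ p, (Ψ p).AgreeOutside e K) (h0 : ∀ x, Ψ (x, 0) = e) :
    ∃ l : C(P, EmbModImm e he), ∀ x s, ((l x).1.2 s).1 = Ψ (x, s) := by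
  let a : P → EmbC e := fun x => ⟨Ψ (x, 1), hemb x, K, K.isCompact, hK _⟩
  let b : P × I → ImmC e := fun p => ⟨Ψ p, himm p, K, K.isCompact, hK _⟩
  have ha : Continuous a := CptSupp.continuous_of
    (hΨ.comp (by fun_prop : Continuous fun x : P => (x, (1 : I)))) K fun _ => hK _
  have hb : Continuous b := CptSupp.continuous_of hΨ K hK
  refine ⟨⟨fun x => ⟨(a x, ContinuousMap.curry ⟨b, hb⟩ x), Subtype.ext (h0 x), rfl⟩, ?_⟩,
    fun x s => rfl⟩
  exact Continuous.subtype_mk (ha.prodMk (ContinuousMap.curry ⟨b, hb⟩).continuous) _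

end Functoriality

/-! ### Restriction to the lines -/

section Restriction

open Set

/-- The affine change `y ↦ a y + b` of the second coordinate of `ℝ^d`. -/
def rescale (d : ℕ) (a b : ℝ) (z : EuclideanSpace ℝ (Fin d)) : EuclideanSpace ℝ (Fin d) :=
  WithLp.toLp 2 fun j => if j.val = 1 then a * z j + b else z j

lemma rescale_apply (d : ℕ) (a b : ℝ) (z : EuclideanSpace ℝ (Fin d)) (j : Fin d) :
    rescale d a b z j = if j.val = 1 then a * z j + b else z j := rfl

lemma rescale_contDiff (d : ℕ) (a b : ℝ) : ContDiff ℝ ∞ (rescale d a b) := by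
  refine contDiff_euclidean.2 fun j => ?_
  simp only [rescale_apply]
  split_ifs <;> fun_prop

lemma rescale_rescale (d : ℕ) {a b a' b' : ℝ} (ha : a * a' = 1) (hb : a * b' + b = 0)
    (z : EuclideanSpace ℝ (Fin d)) : rescale d a b (rescale d a' b' z) = z := by
  ext j
  simp only [rescale_apply]
  split_ifs
  · linear_combination z j * ha + hb
  · rfl

/-- A differentiable map with a differentiable left inverse is an immersion. -/
lemma fderiv_injective_of_leftInverse {E F : Type} [NormedAddCommGroup E] [NormedSpace ℝ E]
    [NormedAddCommGroup F] [NormedSpace ℝ F] {f : E → F} {g : F → E} {x : E}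
    (hf : DifferentiableAt ℝ f x) (hg : DifferentiableAt ℝ g (f x)) (h : ∀ x, g (f x) = x) :
    Function.Injective (fderiv ℝ f x) := by
  have e1 : (fderiv ℝ g (f x)).comp (fderiv ℝ f x) = ContinuousLinearMap.id ℝ E := by
    rw [← fderiv_comp x hg hf, show g ∘ f = id from funext h, fderiv_id]
  exact Function.LeftInverse.injective (g := fderiv ℝ g (f x)) fun v =>
    congrArg (fun L : E →L[ℝ] E => L v) e1

variable (m : ℕ) (ε : ℝ)

/-- The `i`-th line, parametrized by its first coordinate. -/
def line (i : ℕ) (t : ℝ) : Plane := !₂[t, lineHeight m ε i]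

variable {m : ℕ} {ε : ℝ}

lemma line_zero (i : ℕ) (t : ℝ) : line m ε i t 0 = t := rfl

lemma line_one (i : ℕ) (t : ℝ) : line m ε i t 1 = lineHeight m ε i := rfl

lemma line_eq (i : ℕ) (t : ℝ) : line m ε i t =
    t • !₂[(1 : ℝ), 0] + !₂[(0 : ℝ), lineHeight m ε i] := by
  ext j
  fin_cases j <;> simp [line]

lemma line_hasDerivAt (i : ℕ) (t : ℝ) : HasDerivAt (line m ε i) !₂[(1 : ℝ), 0] t := by
  rw [show line m ε i = _ from funext (line_eq i)]
  simpa using ((hasDerivAt_id t).smul_const (!₂[(1 : ℝ), 0] : Plane)).add_const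
    (!₂[(0 : ℝ), lineHeight m ε i] : Plane)

lemma line_contDiff (i : ℕ) : ContDiff ℝ ∞ (line m ε i) := by
  rw [show line m ε i = _ from funext (line_eq i)]
  fun_prop

lemma abs_le_norm_line (i : ℕ) (t : ℝ) : |t| ≤ ‖line m ε i t‖ :=
  PiLp.norm_apply_le (line m ε i t) 0

lemma line_mem (hε : ε < period m) (i : Fin m) (t : ℝ) : line m ε i t ∈ planarDomain m ε :=
  mem_planarDomain_of_strip (i := i) (by simpa [line_one] using gapRadius_pos hε)

variable (m ε) in
/-- The affine map of `ℝ^d` that takes the line of height `lineHeight m ε i` in the plane to the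
line of height `i`. -/
def straightenMap (d : ℕ) : EuclideanSpace ℝ (Fin d) → EuclideanSpace ℝ (Fin d) :=
  rescale d (period m)⁻¹ (-(period m)⁻¹ * lineHeight m ε 0)

variable (m ε) in
/-- The inverse of `straightenMap`. -/
def unstraightenMap (d : ℕ) : EuclideanSpace ℝ (Fin d) → EuclideanSpace ℝ (Fin d) :=
  rescale d (period m) (lineHeight m ε 0)

lemma straighten_unstraighten (d : ℕ) (z : EuclideanSpace ℝ (Fin d)) :
    straightenMap m ε d (unstraightenMap m ε d z) = z :=
  rescale_rescale d (inv_mul_cancel₀ period_pos.ne') (by ring) z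

lemma unstraighten_straighten (d : ℕ) (z : EuclideanSpace ℝ (Fin d)) :
    unstraightenMap m ε d (straightenMap m ε d z) = z :=
  rescale_rescale d (mul_inv_cancel₀ period_pos.ne') (by
    have := (period_pos (m := m)).ne'
    field_simp
    ring) z

lemma straightenMap_contDiff (d : ℕ) : ContDiff ℝ ∞ (straightenMap m ε d) := rescale_contDiff _ _ _

lemma unstraightenMap_contDiff (d : ℕ) : ContDiff ℝ ∞ (unstraightenMap m ε d) :=
  rescale_contDiff _ _ _

lemma straightenMap_planeIncl (d i : ℕ) (t : ℝ) :
    straightenMap m ε d (planeIncl d (line m ε i t)) = strand d i t := by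
  ext j
  have hp := (period_pos (m := m)).ne'
  simp only [straightenMap, rescale_apply, strand, planeIncl, line, lineHeight_eq]
  by_cases hj : j.val = 1
  · simp [hj]
    field_simp
    ring
  · simp [hj]

lemma isEmbedding_line (hε0 : 0 < ε) (hε : ε < period m) :
    Topology.IsEmbedding fun x : Σ _ : Fin m, (⊤ : Opens ℝ) => line m ε x.1 x.2 := by
  have hinj : Function.Injective fun x : Σ _ : Fin m, (⊤ : Opens ℝ) => line m ε x.1 x.2 := by
    rintro ⟨i, s⟩ ⟨j, t⟩ h
    have h0 : (s : ℝ) = t := congrArg (fun u : Plane => u 0) h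
    have h1 : lineHeight m ε i = lineHeight m ε j := congrArg (fun u : Plane => u 1) h
    have hij : i = j := lineHeight_unique hε0 (y := lineHeight m ε i)
      (by simpa using gapRadius_pos hε) (by rw [h1]; simpa using gapRadius_pos hε)
    subst hij
    rw [Subtype.ext h0]
  refine ⟨inducing_sigma.2 ⟨fun i => ?_, fun i => ?_⟩, hinj⟩
  · have h1 : Continuous fun t : (⊤ : Opens ℝ) => line m ε i t :=
      (line_contDiff i).continuous.comp continuous_subtype_val
    have h2 : Topology.IsInducing ((fun u : Plane => u 0) ∘
        fun t : (⊤ : Opens ℝ) => line m ε i t) := Topology.IsInducing.subtypeVal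
    exact Topology.IsInducing.of_comp h1 (by fun_prop) h2
  · refine ⟨{u | |u 1 - lineHeight m ε i| < gapRadius m ε},
      isOpen_lt (by fun_prop) continuous_const, ?_⟩
    rintro ⟨j, t⟩
    change |lineHeight m ε j - lineHeight m ε i| < _ ↔ j = i
    constructor
    · intro h
      exact (lineHeight_unique hε0 h (by simpa using gapRadius_pos hε)).symm
    · rintro rfl
      simpa using gapRadius_pos hε

variable {d : ℕ}

/-- The restriction of a map on the planar domain to the lines, followed by the affine map that
makes the reference maps correspond. -/
def restrictLines (hε : ε < period m)
    (f : SmoothMap (fun _ : Unit => planarDomain m ε) (EuclideanSpace ℝ (Fin d))) :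
    SmoothMap (fun _ : Fin m => (⊤ : Opens ℝ)) (EuclideanSpace ℝ (Fin d)) where
  toFun x := straightenMap m ε d (f.toFun ⟨(), line m ε x.1 x.2, line_mem hε x.1 x.2⟩)
  smooth i := by
    have h1 : ContDiffOn ℝ ∞ (fun t => straightenMap m ε d (f.piece () (line m ε i t))) univ :=
      (straightenMap_contDiff d).comp_contDiffOn ((f.smooth ()).comp (line_contDiff i).contDiffOn
        fun t _ => line_mem hε i t)
    refine (h1.congr fun t _ => ?_).mono (subset_univ _)
    refine (extendZero_apply (fun x : (⊤ : Opens ℝ) => straightenMap m ε d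
      (f.toFun ⟨(), line m ε i x, line_mem hε i x⟩)) ⟨t, trivial⟩).trans ?_
    exact congrArg _ (f.piece_apply () ⟨line m ε i t, line_mem hε i t⟩).symm

variable (hε : ε < period m)
  (f : SmoothMap (fun _ : Unit => planarDomain m ε) (EuclideanSpace ℝ (Fin d)))

lemma piece_restrictLines (i : Fin m) (t : ℝ) : (restrictLines hε f).piece i t =
    straightenMap m ε d (f.piece () (line m ε i t)) := by
  refine ((restrictLines hε f).piece_apply i ⟨t, trivial⟩).trans ?_
  exact congrArg (straightenMap m ε d) (f.piece_apply () ⟨line m ε i t, line_mem hε i t⟩).symm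

lemma continuous_restrictLines : Continuous (restrictLines (d := d) hε) := by
  refine SmoothMap.continuous_iff_sfam.2 fun i => ?_
  have h1 := (SmoothMap.continuous_iff_sfam (f := fun f : SmoothMap (fun _ : Unit =>
    planarDomain m ε) (EuclideanSpace ℝ (Fin d)) => f)).1 continuous_id ()
  have h2 := h1.comp (planarDomain m ε).isOpen isOpen_univ (SFam.of_contDiff (line_contDiff i))
    fun _ t _ => line_mem hε i t
  have h3 := SFam.contDiffOn_comp isOpen_univ isOpen_univ
    (straightenMap_contDiff (m := m) (ε := ε) d).contDiffOn h2 fun _ _ _ => trivial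
  exact (h3.congr isOpen_univ fun f t _ => piece_restrictLines hε f i t).mono (subset_univ _)

lemma restrictLines_isImmersion {f : SmoothMap (fun _ : Unit => planarDomain m ε)
    (EuclideanSpace ℝ (Fin d))} (hf : f.IsImmersion) : (restrictLines hε f).IsImmersion := by
  intro i t
  have h1 : (restrictLines hε f).piece i = straightenMap m ε d ∘ (f.piece () ∘ line m ε i) :=
    funext fun t => piece_restrictLines hε f i t
  have h2 : DifferentiableAt ℝ (f.piece ()) (line m ε i t) :=
    ((f.smooth ()).contDiffAt ((planarDomain m ε).isOpen.mem_nhds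
      (line_mem hε i t))).differentiableAt (by simp)
  have h3 := (line_hasDerivAt (m := m) (ε := ε) i (t : ℝ)).hasFDerivAt
  have h4 : ∀ z, DifferentiableAt ℝ (straightenMap m ε d) z := fun z =>
    (straightenMap_contDiff d).differentiable (by simp) z
  rw [h1, fderiv_comp _ (h4 _) (h2.comp _ h3.differentiableAt),
    fderiv_comp _ h2 h3.differentiableAt, h3.fderiv]
  refine (fderiv_injective_of_leftInverse (h4 _)
    ((unstraightenMap_contDiff d).differentiable (by simp) _)
    (unstraighten_straighten d)).comp ((hf () ⟨_, line_mem hε i t⟩).comp ?_)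
  intro a b hab
  simpa using congrArg (fun u : Plane => u 0) hab

lemma restrictLines_isSmoothEmbedding (hε0 : 0 < ε)
    {f : SmoothMap (fun _ : Unit => planarDomain m ε)
    (EuclideanSpace ℝ (Fin d))} (hf : f.IsSmoothEmbedding) :
    (restrictLines hε f).IsSmoothEmbedding := by
  refine ⟨restrictLines_isImmersion hε hf.1, ?_⟩
  have h1 : Topology.IsEmbedding (straightenMap m ε d) :=
    Topology.IsEmbedding.of_leftInverse (f := unstraightenMap m ε d)
      (unstraighten_straighten d) (unstraightenMap_contDiff d).continuous
      (straightenMap_contDiff d).continuous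
  have h2 : Topology.IsEmbedding fun u : planarDomain m ε =>
      (⟨(), u⟩ : Σ _ : Unit, planarDomain m ε) :=
    (@Topology.IsOpenEmbedding.sigmaMk Unit (fun _ => planarDomain m ε) _ ()).isEmbedding
  have h3 := (isEmbedding_line hε0 hε).codRestrict (planarDomain m ε)
    fun x => line_mem hε x.1 x.2
  exact h1.comp (hf.2.comp (h2.comp h3))

lemma restrictLines_stdPlanar : restrictLines hε (stdPlanar m d ε) = stdLink m d :=
  SmoothMap.ext_toFun fun i t => straightenMap_planeIncl d i t

lemma restrictLines_agreeOutside (K : Compacts Plane) : ∃ K' : Compacts ℝ,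
    ∀ f : SmoothMap (fun _ : Unit => planarDomain m ε) (EuclideanSpace ℝ (Fin d)),
      f.AgreeOutside (stdPlanar m d ε) K → (restrictLines hε f).AgreeOutside (stdLink m d) K' := by
  obtain ⟨R, hR⟩ := K.isCompact.isBounded.subset_closedBall 0
  refine ⟨⟨Metric.closedBall 0 R, isCompact_closedBall 0 R⟩, fun f hf i t ht => ?_⟩
  rw [← restrictLines_stdPlanar hε]
  refine congrArg (straightenMap m ε d) (hf () ⟨line m ε i t, line_mem hε i t⟩ fun h => ht ?_)
  have h1 := hR h
  rw [mem_closedBall_zero_iff] at h1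
  change (t : ℝ) ∈ Metric.closedBall 0 R
  rw [mem_closedBall_zero_iff]
  exact (abs_le_norm_line i t).trans h1

/-- Restriction to the lines as a map from the space of embeddings of the planar domain modulo
immersions to the space of long links modulo immersions. -/
def restrictModImm (hε : ε < period m) (hε0 : 0 < ε) (hd : 3 ≤ d) :
    C(PlanarEmbModImm m d hd ε, LongLinksModImm m d hd) :=
  HomotopyFiber.map
    (CptSupp.map (restrictLines hε) (continuous_restrictLines hε)
      (fun _ => restrictLines_isSmoothEmbedding hε hε0) (restrictLines_agreeOutside hε))
    (CptSupp.map (restrictLines hε) (continuous_restrictLines hε)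
      (fun _ => restrictLines_isImmersion hε) (restrictLines_agreeOutside hε))
    (Subtype.ext (restrictLines_stdPlanar hε)) fun _ => rfl

lemma restrictModImm_path (hε0 : 0 < ε) (hd : 3 ≤ d) (p : PlanarEmbModImm m d hd ε) (s : I) :
    ((restrictModImm hε hε0 hd p).1.2 s).1 = restrictLines hε (p.1.2 s).1 := rfl

end Restriction

/-! ### Families that are standard far away and immersive along the lines -/

section Tube

open Set Metric

variable {m d : ℕ} {ε : ℝ} {P : Type} [TopologicalSpace P]

lemma norm_planeIncl (hd : 3 ≤ d) (u : Plane) : ‖planeIncl d u‖ = ‖u‖ := by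
  obtain ⟨k, rfl⟩ : ∃ k, d = k + 2 := ⟨d - 2, by omega⟩
  rw [EuclideanSpace.norm_eq, EuclideanSpace.norm_eq, Fin.sum_univ_two, Fin.sum_univ_succ,
    Fin.sum_univ_succ]
  simp [planeIncl]

lemma norm_le_abs_add_abs (u : Plane) : ‖u‖ ≤ |u 0| + |u 1| := by
  rw [EuclideanSpace.norm_eq, Fin.sum_univ_two]
  refine Real.sqrt_le_iff.2 ⟨by positivity, ?_⟩
  simp only [Real.norm_eq_abs]
  nlinarith [abs_nonneg (u 0), abs_nonneg (u 1)]

lemma abs_apply_le_norm (u : Plane) (j : Fin 2) : |u j| ≤ ‖u‖ := PiLp.norm_apply_le u j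

/-- A family of maps on the planar domain that are standard outside a square, and immersive at all
points of the lines. -/
structure LineImmersive (m : ℕ) (ε R₀ : ℝ) (F : P → Plane → EuclideanSpace ℝ (Fin d)) : Prop where
  sfam : SFam F (planarDomain m ε)
  far : ∀ p, ∀ u ∈ planarDomain m ε, R₀ < |u 0| ∨ R₀ < |u 1| → F p u = planeIncl d u
  immersive : ∀ p (i : Fin m) t, Function.Injective (fderiv ℝ (F p) (line m ε i t))

lemma mem_planarDomain_of_outer (hε : ε < period m) {R : ℝ} (hR : 1 ≤ R) {u : Plane}
    (hu : R < |u 0| ∨ R < |u 1|) : u ∈ planarDomain m ε := by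
  rcases hu with hu | hu
  · exact mem_planarDomain_of_lt_abs_zero (hR.trans_lt hu)
  · refine mem_planarDomain_of_lt_abs_one hε (hR.trans hu.le) fun h => ?_
    rw [h] at hu
    norm_num at hu
    linarith

lemma tube_subset_planarDomain (hε : ε < period m) {R δ : ℝ} (hR : 1 < R)
    (hδ : δ < gapRadius m ε) : tube m ε R δ ⊆ planarDomain m ε := by
  intro u hu
  obtain ⟨r, hr, hrR⟩ := exists_between hR
  rcases hu with hu | hu | ⟨i, hi⟩
  · exact mem_planarDomain_of_outer hε hr.le (Or.inl (hrR.trans_le hu))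
  · exact mem_planarDomain_of_outer hε hr.le (Or.inr (hrR.trans_le hu))
  · exact mem_planarDomain_of_strip (hi.trans_lt hδ)

/-- The part in the ball of radius `T` of the union of the lines and of the exterior of the square of
radius `R`, that is, of the tube of thickness `0`. -/
def coreSet (m : ℕ) (ε R T : ℝ) : Set Plane := tube m ε R 0 ∩ closedBall 0 T

lemma isCompact_coreSet (R T : ℝ) : IsCompact (coreSet m ε R T) :=
  (isCompact_closedBall 0 T).inter_left (isClosed_tube R 0)

/-- The bounded part of a thin tube is close to the bounded part of the tube of thickness `0`. -/
lemma mem_thickening_coreSet (hε0 : 0 < ε) (hε : ε < period m) {R T δ r : ℝ}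
    (hT : R + 1 ≤ T) (hδ : δ < r) {u : Plane} (hu : u ∈ tube m ε R δ) (huT : ‖u‖ ≤ T) (hr : 0 < r) :
    u ∈ thickening r (coreSet m ε R T) := by
  rw [mem_thickening_iff]
  have hout : R ≤ |u 0| ∨ R ≤ |u 1| → ∃ z ∈ coreSet m ε R T, dist u z < r := by
    intro h
    refine ⟨u, ⟨?_, mem_closedBall_zero_iff.2 huT⟩, by rwa [dist_self]⟩
    rcases h with h | h
    · exact Or.inl h
    · exact Or.inr (Or.inl h)
  by_cases h0 : R ≤ |u 0|
  · exact hout (Or.inl h0)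
  rcases hu with hu | hu | ⟨i, hi⟩
  · exact hout (Or.inl hu)
  · exact hout (Or.inr hu)
  · push Not at h0
    refine ⟨line m ε i (u 0), ⟨Or.inr (Or.inr ⟨i, by simp [line_one]⟩), ?_⟩, ?_⟩
    · rw [mem_closedBall_zero_iff]
      refine (norm_le_abs_add_abs _).trans ?_
      rw [line_zero, line_one]
      linarith [abs_lineHeight_lt hε0 hε i]
    · rw [dist_eq_norm]
      refine lt_of_le_of_lt ((norm_le_abs_add_abs _).trans ?_) hδ
      simpa [line_zero, line_one] using hi

namespace LineImmersive

variable {R₀ : ℝ} {F : P → Plane → EuclideanSpace ℝ (Fin d)}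

lemma injective_fderiv_of_outer (hd : 3 ≤ d) (hε : ε < period m) (hR₀ : 1 ≤ R₀)
    (hF : LineImmersive m ε R₀ F) (p : P) {u : Plane} (hu : R₀ < |u 0| ∨ R₀ < |u 1|) :
    Function.Injective (fderiv ℝ (F p) u) := by
  have h1 : F p =ᶠ[𝓝 u] planeIncl d := by
    have h2 : IsOpen {u : Plane | R₀ < |u 0| ∨ R₀ < |u 1|} :=
      (isOpen_lt (f := fun _ => R₀) (g := fun u : Plane => |u 0|) continuous_const
        (by fun_prop)).union (isOpen_lt (f := fun _ => R₀) (g := fun u : Plane => |u 1|)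
          continuous_const (by fun_prop))
    filter_upwards [h2.mem_nhds hu] with w hw
    exact hF.far p w (mem_planarDomain_of_outer hε hR₀ hw) hw
  rw [h1.fderiv_eq, ContinuousLinearMap.fderiv]
  exact planeIncl_injective hd

lemma injective_fderiv_of_mem_core (hd : 3 ≤ d) (hε : ε < period m) (hR₀ : 1 ≤ R₀) {R T : ℝ}
    (hR : R₀ < R) (hF : LineImmersive m ε R₀ F) (p : P) {u : Plane} (hu : u ∈ coreSet m ε R T) :
    Function.Injective (fderiv ℝ (F p) u) := by
  rcases hu.1 with h | h | ⟨i, hi⟩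
  · exact hF.injective_fderiv_of_outer hd hε hR₀ p (Or.inl (hR.trans_le h))
  · exact hF.injective_fderiv_of_outer hd hε hR₀ p (Or.inr (hR.trans_le h))
  · have h1 : u = line m ε i (u 0) := by
      refine plane_ext (j := 0) (k := 1) (by decide) rfl ?_
      rw [line_one]
      exact sub_eq_zero.1 (abs_nonpos_iff.1 hi)
    rw [h1]
    exact hF.immersive p i _

lemma coreSet_subset (hε : ε < period m) {R T : ℝ} (hR : 1 < R) :
    coreSet m ε R T ⊆ planarDomain m ε := fun _ hu =>
  tube_subset_planarDomain hε hR (gapRadius_pos hε) hu.1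

/-- The members of a compact family are immersions on a sufficiently thin tube. -/
lemma exists_immersive_tube [CompactSpace P] (hd : 3 ≤ d) (hε0 : 0 < ε) (hε : ε < period m)
    (hR₀ : 1 ≤ R₀) {R : ℝ} (hR : R₀ < R) (hF : LineImmersive m ε R₀ F) : ∃ r > 0, ∀ δ < r,
      ∀ p, ∀ u ∈ tube m ε R δ, Function.Injective (fderiv ℝ (F p) u) := by
  obtain ⟨r, hr, h⟩ := (hF.sfam 1).exists_thickening_immersive (planarDomain m ε).isOpen
    (isCompact_coreSet R (2 * R + 1)) (coreSet_subset hε (hR₀.trans_lt hR))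
    fun p u hu => hF.injective_fderiv_of_mem_core hd hε hR₀ hR p hu
  refine ⟨r, hr, fun δ hδ p u hu => ?_⟩
  by_cases h0 : R₀ < |u 0| ∨ R₀ < |u 1|
  · exact hF.injective_fderiv_of_outer hd hε hR₀ p h0
  · push Not at h0
    refine h u (mem_thickening_coreSet hε0 hε (by linarith) hδ hu ?_ hr) p
    linarith [norm_le_abs_add_abs u, h0.1, h0.2]

/-- The members of a compact family that are injective on the union of the lines, and map the
inner parts of the lines into the ball of radius `R`, are closed embeddings of a sufficiently thin
tube: the inner parts of the lines avoid the standard exterior part for reasons of norm. -/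
lemma exists_embedded_tube [CompactSpace P] (hd : 3 ≤ d) (hε0 : 0 < ε) (hε : ε < period m)
    (hR₀ : 1 ≤ R₀) {R : ℝ} (hR : R₀ < R) (hF : LineImmersive m ε R₀ F)
    (hinj : ∀ p (i j : Fin m) s t, F p (line m ε i s) = F p (line m ε j t) →
      line m ε i s = line m ε j t)
    (hball : ∀ p (i : Fin m) t, |t| ≤ R₀ → ‖F p (line m ε i t)‖ < R) : ∃ r > 0, ∀ δ < r, ∀ p,
      Topology.IsClosedEmbedding fun u : tube m ε R δ => F p u := by
  have hM := (planarDomain m ε).isOpen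
  have hR1 : 1 < R := hR₀.trans_lt hR
  have hg := gapRadius_pos hε
  -- A bound for the inner part of a fixed tube.
  let K : Set Plane := closedBall 0 (2 * R) ∩ tube m ε R (gapRadius m ε / 2)
  have hK : IsCompact K := (isCompact_closedBall 0 _).inter_right (isClosed_tube _ _)
  have hKM : K ⊆ planarDomain m ε := fun u hu =>
    tube_subset_planarDomain hε hR1 (by linarith) hu.2
  obtain ⟨b, hb⟩ := ((isCompact_univ (X := P)).prod hK).exists_bound_of_continuousOn
    (hF.sfam.mono hKM).continuousOn
  let T : ℝ := max b (2 * R) + 1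
  have hTb : b < T := (le_max_left _ _).trans_lt (lt_add_one _)
  have hTR : 2 * R < T := (le_max_right _ _).trans_lt (lt_add_one _)
  have hfar : ∀ p u, R ≤ |u 0| ∨ R ≤ |u 1| → F p u = planeIncl d u := by
    intro p u hu
    have h1 : R₀ < |u 0| ∨ R₀ < |u 1| := hu.imp hR.trans_le hR.trans_le
    exact hF.far p u (mem_planarDomain_of_outer hε hR₀ h1) h1
  have hnorm : ∀ u : Plane, R ≤ |u 0| ∨ R ≤ |u 1| → R ≤ ‖u‖ := fun u hu =>
    hu.elim (fun h => h.trans (abs_apply_le_norm u 0)) fun h => h.trans (abs_apply_le_norm u 1)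
  have hlarge : ∀ u : Plane, 2 * R < ‖u‖ → R ≤ |u 0| ∨ R ≤ |u 1| := by
    intro u hu
    by_contra! hcon
    linarith [norm_le_abs_add_abs u, hcon.1, hcon.2]
  have hcore : ∀ p, InjOn (F p) (coreSet m ε R T) := by
    have hmix : ∀ p (u : Plane), R ≤ |u 0| ∨ R ≤ |u 1| → ∀ (i : Fin m) t,
        F p u = F p (line m ε i t) → u = line m ε i t := by
      intro p u hu i t h
      by_cases ht : |t| ≤ R₀
      · have h1 := hball p i t ht
        rw [← h, hfar p u hu, norm_planeIncl hd] at h1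
        linarith [hnorm u hu]
      · rw [hfar p u hu, hF.far p _ (line_mem hε i t) (Or.inl (not_le.1 ht))] at h
        exact planeIncl_injective hd h
    have hcase : ∀ u ∈ coreSet m ε R T, (R ≤ |u 0| ∨ R ≤ |u 1|) ∨
        ∃ (i : Fin m) (t : ℝ), u = line m ε i t := by
      rintro u ⟨h | h | ⟨i, hi⟩, -⟩
      · exact Or.inl (Or.inl h)
      · exact Or.inl (Or.inr h)
      · refine Or.inr ⟨i, u 0, plane_ext (j := 0) (k := 1) (by decide) rfl ?_⟩
        rw [line_one]
        exact sub_eq_zero.1 (abs_nonpos_iff.1 hi)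
    intro p u hu w hw h
    rcases hcase u hu with hu' | ⟨i, s, rfl⟩ <;> rcases hcase w hw with hw' | ⟨j, t, rfl⟩
    · rw [hfar p u hu', hfar p w hw'] at h
      exact planeIncl_injective hd h
    · exact hmix p u hu' j t h
    · exact (hmix p w hw' i s h.symm).symm
    · exact hinj p i j s t h
  obtain ⟨r, hr, h⟩ := (hF.sfam 1).exists_thickening_injOn hM
    (isCompact_coreSet R T) (coreSet_subset hε hR1)
    (fun p u hu => hF.injective_fderiv_of_mem_core hd hε hR₀ hR p hu) hcore
  refine ⟨min r (gapRadius m ε / 2), lt_min hr (by linarith), fun δ hδ p => ?_⟩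
  have hδr : δ < r := hδ.trans_le (min_le_left _ _)
  have hδg : δ < gapRadius m ε / 2 := hδ.trans_le (min_le_right _ _)
  refine isClosedEmbedding_of_norm_le (isClosed_tube R δ) (R := 2 * R) ?_ ?_ ?_
  · refine ContinuousOn.mono ?_ (tube_subset_planarDomain hε hR1 (δ := δ) (by linarith))
    exact (hF.sfam.contDiffOn hM p).continuousOn
  · -- A point far away is standard, and no other point of the tube has an image of its norm.
    have hfarinj : ∀ u w : Plane, w ∈ tube m ε R δ → T < ‖u‖ → F p u = F p w → u = w := by
      intro u w hw hu hfw
      have hu' := hlarge u (hTR.trans hu)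
      by_cases hw' : R ≤ |w 0| ∨ R ≤ |w 1|
      · rw [hfar p u hu', hfar p w hw'] at hfw
        exact planeIncl_injective hd hfw
      · push Not at hw'
        have hwK : w ∈ K := by
          refine ⟨mem_closedBall_zero_iff.2 (by linarith [norm_le_abs_add_abs w, hw'.1, hw'.2]), ?_⟩
          rcases hw with h | h | ⟨i, hi⟩
          · exact Or.inl h
          · exact Or.inr (Or.inl h)
          · exact Or.inr (Or.inr ⟨i, hi.trans hδg.le⟩)
        have h1 := hb (p, w) ⟨trivial, hwK⟩
        simp only at h1
        rw [← hfw, hfar p u hu', norm_planeIncl hd] at h1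
        linarith
    intro u hu w hw hfw
    by_cases huT : ‖u‖ ≤ T
    · by_cases hwT : ‖w‖ ≤ T
      · exact h p (mem_thickening_coreSet hε0 hε (by linarith) hδr hu huT hr)
          (mem_thickening_coreSet hε0 hε (by linarith) hδr hw hwT hr) hfw
      · exact (hfarinj w u hu (not_le.1 hwT) hfw.symm).symm
    · exact hfarinj u w hw (not_le.1 huT) hfw
  · intro u _ hu
    rw [hfar p u (hlarge u hu), norm_planeIncl hd]

end LineImmersive

end Tube

/-! ### Linear thickening of strands -/

section Thicken

open Set

variable {m d : ℕ} {ε : ℝ} {P : Type}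

/-- Cutoff functions around the lines, equal to `1` near them. -/
structure LineCutoffs (m : ℕ) (ε : ℝ) (χ : Fin m → ℝ → ℝ) : Prop where
  contDiff : ∀ i, ContDiff ℝ ∞ (χ i)
  eq_one : ∀ (i : Fin m) y, |y - lineHeight m ε i| ≤ gapRadius m ε / 2 → χ i y = 1
  eq_zero : ∀ (i : Fin m) y, gapRadius m ε ≤ |y - lineHeight m ε i| → χ i y = 0

lemma exists_lineCutoffs (hε : ε < period m) : ∃ χ, LineCutoffs m ε χ := by
  have hg := gapRadius_pos hε
  have h : ∀ i : Fin m, ∃ f : ℝ → ℝ, ContDiff ℝ ∞ f ∧ (∀ x, 0 ≤ f x) ∧ (∀ x, f x ≤ 1) ∧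
      (∀ x ∈ {y | gapRadius m ε ≤ |y - lineHeight m ε i|}, f x = 0) ∧
      ∀ x ∈ {y | |y - lineHeight m ε i| ≤ gapRadius m ε / 2}, f x = 1 := fun i => by
    refine exists_smooth_cutoff (isClosed_le (by fun_prop) (by fun_prop))
      (isClosed_le (by fun_prop) (by fun_prop)) (Set.disjoint_left.2 fun y h1 h2 => ?_)
    have h1' : gapRadius m ε ≤ |y - lineHeight m ε i| := h1
    have h2' : |y - lineHeight m ε i| ≤ gapRadius m ε / 2 := h2
    linarith
  choose χ h1 _ _ h4 h5 using h
  exact ⟨χ, h1, fun i y hy => h5 i y hy, fun i y hy => h4 i y hy⟩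

/-- The vertical unit vector of the plane. -/
def vert : Plane := !₂[(0 : ℝ), 1]

/-- The map of the plane that near the `i`-th line is affine in the vertical direction, with value
`γ i` and vertical derivative `w i` on the line, and is standard away from the lines. -/
def thicken (ε : ℝ) (χ : Fin m → ℝ → ℝ) (γ w : Fin m → P → ℝ → EuclideanSpace ℝ (Fin d)) (p : P)
    (u : Plane) : EuclideanSpace ℝ (Fin d) :=
  planeIncl d u + ∑ i, χ i (u 1) •
    (γ i p (u 0) + (u 1 - lineHeight m ε i) • w i p (u 0) - planeIncl d u)

variable {χ : Fin m → ℝ → ℝ} {γ w : Fin m → P → ℝ → EuclideanSpace ℝ (Fin d)}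

lemma planeIncl_eq_line (i : ℕ) (u : Plane) : planeIncl d u =
    planeIncl d (line m ε i (u 0)) + (u 1 - lineHeight m ε i) • planeIncl d vert := by
  rw [← map_smul, ← map_add]
  congr 1
  ext j
  fin_cases j <;> simp [line, vert]

lemma thicken_sfam [TopologicalSpace P] (hχ : LineCutoffs m ε χ) (hγ : ∀ i, SFam (γ i) univ)
    (hw : ∀ i, SFam (w i) univ) : SFam (thicken ε χ γ w) univ := by
  have hc : ∀ j : Fin 2, ContDiff ℝ ∞ fun u : Plane => u j := fun j => by fun_prop
  have h0 : ∀ {f : P → ℝ → EuclideanSpace ℝ (Fin d)}, SFam f univ →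
      SFam (fun p (u : Plane) => f p (u 0)) univ := fun hf =>
    hf.comp isOpen_univ isOpen_univ (SFam.of_contDiff (hc 0)) fun _ _ _ => trivial
  have hp : SFam (fun (_ : P) (u : Plane) => planeIncl d u) univ :=
    SFam.of_contDiff (planeIncl d).contDiff
  refine hp.add isOpen_univ (SFam.sum isOpen_univ _ fun i => SFam.smul isOpen_univ
    (SFam.of_contDiff ((hχ.contDiff i).comp (hc 1))) (((h0 (hγ i)).add isOpen_univ
      (SFam.smul isOpen_univ (SFam.of_contDiff ((hc 1).sub contDiff_const)) (h0 (hw i)))).sub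
        isOpen_univ hp))

lemma thicken_of_strip (hε0 : 0 < ε) (hε : ε < period m) (hχ : LineCutoffs m ε χ) (p : P)
    {u : Plane} {i : Fin m} (h : |u 1 - lineHeight m ε i| ≤ gapRadius m ε / 2) :
    thicken ε χ γ w p u = γ i p (u 0) + (u 1 - lineHeight m ε i) • w i p (u 0) := by
  have hg := gapRadius_pos hε
  rw [thicken, Finset.sum_eq_single i, hχ.eq_one i _ h, one_smul, add_sub_cancel]
  · intro j _ hj
    rw [hχ.eq_zero j, zero_smul]
    by_contra! hlt
    exact hj (lineHeight_unique hε0 hlt (h.trans_lt (by linarith)))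
  · intro h
    exact absurd (Finset.mem_univ i) h

lemma thicken_line (hε0 : 0 < ε) (hε : ε < period m) (hχ : LineCutoffs m ε χ) (p : P) (i : Fin m)
    (t : ℝ) : thicken ε χ γ w p (line m ε i t) = γ i p t := by
  have hg := gapRadius_pos hε
  rw [thicken_of_strip hε0 hε hχ p (i := i) (by rw [line_one, sub_self, abs_zero]; linarith),
    line_one, sub_self, zero_smul, add_zero, line_zero]

/-- Where the strands and the vertical vectors are standard, so is the thickening. -/
lemma thicken_of_std (p : P) {u : Plane} (hγ : ∀ i, γ i p (u 0) = planeIncl d (line m ε i (u 0)))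
    (hw : ∀ i, w i p (u 0) = planeIncl d vert) : thicken ε χ γ w p u = planeIncl d u := by
  have : ∀ i : Fin m, γ i p (u 0) + (u 1 - lineHeight m ε i) • w i p (u 0) - planeIncl d u = 0 := by
    intro i
    rw [hγ, hw, ← planeIncl_eq_line, sub_self]
  simp [thicken, this]

lemma thicken_of_one_le (hε0 : 0 < ε) (hχ : LineCutoffs m ε χ) (p : P) {u : Plane}
    (h : 1 ≤ |u 1|) : thicken ε χ γ w p u = planeIncl d u := by
  have : ∀ i : Fin m, χ i (u 1) = 0 := by
    intro i
    refine hχ.eq_zero i _ ?_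
    have h1 := abs_lineHeight_add_lt hε0 i
    have h2 := abs_sub_abs_le_abs_sub (u 1) (lineHeight m ε i)
    linarith
  simp [thicken, this]

lemma fderiv_thicken_line [TopologicalSpace P] (hε0 : 0 < ε) (hε : ε < period m)
    (hχ : LineCutoffs m ε χ) (hγ : ∀ i, SFam (γ i) univ) (hw : ∀ i, SFam (w i) univ) (p : P)
    (i : Fin m) (t : ℝ) (z : Plane) : fderiv ℝ (thicken ε χ γ w p) (line m ε i t) z =
      z 0 • deriv (γ i p) t + z 1 • w i p t := by
  have hg := gapRadius_pos hε
  have h1 : thicken ε χ γ w p =ᶠ[𝓝 (line m ε i t)] fun u =>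
      γ i p (u 0) + (u 1 - lineHeight m ε i) • w i p (u 0) := by
    have h2 : IsOpen {u : Plane | |u 1 - lineHeight m ε i| < gapRadius m ε / 2} :=
      isOpen_lt (by fun_prop) continuous_const
    filter_upwards [h2.mem_nhds (show |line m ε i t 1 - lineHeight m ε i| < _ by
      rw [line_one, sub_self, abs_zero]; linarith)] with u hu
    exact thicken_of_strip hε0 hε hχ p (le_of_lt hu)
  rw [h1.fderiv_eq]
  have hp : ∀ j : Fin 2, HasFDerivAt (fun u : Plane => u j)
      (EuclideanSpace.proj j : Plane →L[ℝ] ℝ) (line m ε i t) := fun j =>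
    (EuclideanSpace.proj j : Plane →L[ℝ] ℝ).hasFDerivAt
  have hγ' : HasDerivAt (γ i p) (deriv (γ i p) t) (line m ε i t 0) :=
    ((hγ i).differentiableAt isOpen_univ p (mem_univ t)).hasDerivAt
  have hw' : HasDerivAt (w i p) (deriv (w i p) t) (line m ε i t 0) :=
    ((hw i).differentiableAt isOpen_univ p (mem_univ t)).hasDerivAt
  have e1 := hγ'.hasFDerivAt.comp (line m ε i t) (hp 0)
  have e2 := ((hp 1).sub_const (lineHeight m ε i)).smul (hw'.hasFDerivAt.comp (line m ε i t) (hp 0))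
  have e3 := (e1.add e2).fderiv
  refine (congrArg (fun L : Plane →L[ℝ] EuclideanSpace ℝ (Fin d) => L z) e3).trans ?_
  simp [line_one, line_zero]

end Thicken

/-! ### Families of strands and their thickenings -/

section Strands

open Set

variable {m d : ℕ} {ε R₀ : ℝ} {P P' : Type} [TopologicalSpace P] [TopologicalSpace P']

/-- The horizontal unit vector of the plane. -/
def horiz : Plane := !₂[(1 : ℝ), 0]

lemma plane_eq (z : Plane) : z = z 0 • horiz + z 1 • vert := by
  ext j
  fin_cases j <;> simp [horiz, vert]

/-- A family of paths of immersed strands that starts at the reference lines and ends in links. -/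
structure StrandFamily (ε R₀ : ℝ) (γ : Fin m → P × I → ℝ → EuclideanSpace ℝ (Fin d)) : Prop where
  sfam : ∀ i, SFam (γ i) univ
  zero : ∀ i x t, γ i (x, 0) t = planeIncl d (line m ε i t)
  far : ∀ i p t, R₀ < |t| → γ i p t = planeIncl d (line m ε i t)
  deriv_ne : ∀ i p t, deriv (γ i p) t ≠ 0
  inj : ∀ x i j s t, γ i (x, 1) s = γ j (x, 1) t → line m ε i s = line m ε j t

/-- A family of paths of immersions of the planar domain that starts at the reference map and ends
in embeddings. -/
structure PlanarFamily (m : ℕ) (ε R₀ : ℝ) (Γ : P × I → Plane → EuclideanSpace ℝ (Fin d)) :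
    Prop where
  sfam : SFam Γ (planarDomain m ε)
  zero : ∀ x, ∀ u ∈ planarDomain m ε, Γ (x, 0) u = planeIncl d u
  far : ∀ p, ∀ u ∈ planarDomain m ε, R₀ < |u 0| ∨ R₀ < |u 1| → Γ p u = planeIncl d u
  immersive : ∀ p, ∀ u ∈ planarDomain m ε, Function.Injective (fderiv ℝ (Γ p) u)
  embedding : ∀ x, Topology.IsEmbedding fun u : planarDomain m ε => Γ (x, 1) u

/-- Linear automorphisms `A`, with inverses `B`, that transport the tangent vectors of the reference
lines to those of a family of strands. -/
structure StrandFrames (R₀ : ℝ) (γ : Fin m → P × I → ℝ → EuclideanSpace ℝ (Fin d))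
    (A B : Fin m → P × I → ℝ → EuclideanSpace ℝ (Fin d) →L[ℝ] EuclideanSpace ℝ (Fin d)) :
    Prop where
  sfam : ∀ i, SFam (A i) univ
  sfam_inv : ∀ i, SFam (B i) univ
  right_inv : ∀ i p t w, A i p t (B i p t w) = w
  left_inv : ∀ i p t w, B i p t (A i p t w) = w
  zero : ∀ i x t, A i (x, 0) t = ContinuousLinearMap.id ℝ _
  far : ∀ i p t, R₀ < |t| → A i p t = ContinuousLinearMap.id ℝ _
  apply : ∀ i p t, A i p t (planeIncl d horiz) = deriv (γ i p) t

variable {γ : Fin m → P × I → ℝ → EuclideanSpace ℝ (Fin d)}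
  {A B : Fin m → P × I → ℝ → EuclideanSpace ℝ (Fin d) →L[ℝ] EuclideanSpace ℝ (Fin d)}
  {Γ : P × I → Plane → EuclideanSpace ℝ (Fin d)} {χ : Fin m → ℝ → ℝ}

lemma deriv_planeIncl_line (i : ℕ) (t : ℝ) :
    deriv (fun t => planeIncl d (line m ε i t)) t = planeIncl d horiz :=
  ((planeIncl d).hasFDerivAt.comp_hasDerivAt t (line_hasDerivAt i t)).deriv

lemma SFam.deriv {E : Type} [NormedAddCommGroup E] [NormedSpace ℝ E] {f : P → ℝ → E}
    (hf : SFam f univ) : SFam (fun p => deriv (f p)) univ :=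
  hf.fderiv.clm_apply isOpen_univ (ContinuousLinearMap.apply ℝ E (1 : ℝ))

lemma StrandFamily.deriv_far (hγ : StrandFamily ε R₀ γ) (i : Fin m) (p : P × I) {t : ℝ}
    (ht : R₀ < |t|) : deriv (γ i p) t = planeIncl d horiz := by
  rw [← deriv_planeIncl_line (m := m) (ε := ε) i t]
  apply Filter.EventuallyEq.deriv_eq
  filter_upwards [(isOpen_lt continuous_const continuous_abs).mem_nhds ht] with s hs
  exact hγ.far i p s hs

lemma StrandFamily.exists_strandFrames [CompactSpace P] (hγ : StrandFamily ε R₀ γ) :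
    ∃ A B, StrandFrames R₀ γ A B := by
  have h := fun i => exists_frames (hγ.sfam i).deriv (hγ.deriv_ne i) (e₁ := planeIncl d horiz)
    (R := R₀) (fun x t => by
      rw [show γ i (x, 0) = fun t => planeIncl d (line m ε i t) from funext (hγ.zero i x)]
      exact deriv_planeIncl_line i t) fun p t ht => hγ.deriv_far i p ht
  choose A B h1 h2 h3 h4 h5 h6 h7 using h
  exact ⟨A, B, h1, h2, h3, h4, h5, h6, h7⟩

lemma StrandFamily.reparam (hγ : StrandFamily ε R₀ γ) {f : P' → P} (hf : Continuous f) :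
    StrandFamily ε R₀ fun i (p : P' × I) => γ i (f p.1, p.2) where
  sfam i := (hγ.sfam i).reparam (q := fun p : P' × I => (f p.1, p.2)) (by fun_prop)
  zero i x t := hγ.zero i (f x) t
  far i p t h := hγ.far i _ t h
  deriv_ne i p t := hγ.deriv_ne i _ t
  inj x := hγ.inj (f x)

lemma StrandFrames.reparam (h : StrandFrames R₀ γ A B) {f : P' → P} (hf : Continuous f) :
    StrandFrames R₀ (fun i (p : P' × I) => γ i (f p.1, p.2)) (fun i p => A i (f p.1, p.2))
      fun i p => B i (f p.1, p.2) where
  sfam i := (h.sfam i).reparam (q := fun p : P' × I => (f p.1, p.2)) (by fun_prop)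
  sfam_inv i := (h.sfam_inv i).reparam (q := fun p : P' × I => (f p.1, p.2)) (by fun_prop)
  right_inv i p := h.right_inv i _
  left_inv i p := h.left_inv i _
  zero i x := h.zero i (f x)
  far i p := h.far i _
  apply i p := h.apply i _

lemma StrandFrames.inv_zero (h : StrandFrames R₀ γ A B) (i : Fin m) (x : P) (t : ℝ)
    (w : EuclideanSpace ℝ (Fin d)) : B i (x, 0) t w = w := by
  have := h.left_inv i (x, 0) t w
  rwa [h.zero] at this

lemma StrandFrames.inv_far (h : StrandFrames R₀ γ A B) (i : Fin m) (p : P × I) {t : ℝ}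
    (ht : R₀ < |t|) (w : EuclideanSpace ℝ (Fin d)) : B i p t w = w := by
  have := h.left_inv i p t w
  rwa [h.far i p t ht] at this

/-- The thickening of a family of strands by the transported vertical vector. -/
def framedThicken (ε : ℝ) (χ : Fin m → ℝ → ℝ)
    (γ : Fin m → P × I → ℝ → EuclideanSpace ℝ (Fin d))
    (A : Fin m → P × I → ℝ → EuclideanSpace ℝ (Fin d) →L[ℝ] EuclideanSpace ℝ (Fin d)) :
    P × I → Plane → EuclideanSpace ℝ (Fin d) :=
  thicken ε χ γ fun i p t => A i p t (planeIncl d vert)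

lemma framedThicken_zero (hγ : StrandFamily ε R₀ γ) (hA : StrandFrames R₀ γ A B) (x : P)
    (u : Plane) : framedThicken ε χ γ A (x, 0) u = planeIncl d u :=
  thicken_of_std _ (fun i => hγ.zero i x _) fun i => by rw [hA.zero]; rfl

lemma lineImmersive_framedThicken (hd : 3 ≤ d) (hε0 : 0 < ε) (hε : ε < period m) (hR₀ : 1 ≤ R₀)
    (hχ : LineCutoffs m ε χ) (hγ : StrandFamily ε R₀ γ) (hA : StrandFrames R₀ γ A B) :
    LineImmersive m ε R₀ (framedThicken ε χ γ A) where
  sfam := (thicken_sfam hχ hγ.sfam fun i => (hA.sfam i).app isOpen_univ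
    (SFam.of_continuous continuous_const)).mono (subset_univ _)
  far p u _ h := by
    rcases h with h | h
    · exact thicken_of_std _ (fun i => hγ.far i p _ h) fun i => by rw [hA.far i p _ h]; rfl
    · exact thicken_of_one_le hε0 hχ p (hR₀.trans h.le)
  immersive p i t := by
    have h1 : ⇑(fderiv ℝ (framedThicken ε χ γ A p) (line m ε i t)) =
        fun z => A i p t (planeIncl d z) := by
      funext z
      refine (fderiv_thicken_line hε0 hε hχ hγ.sfam (fun i => (hA.sfam i).app isOpen_univ
        (SFam.of_continuous continuous_const)) p i t z).trans ?_
      rw [← hA.apply i p t]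
      conv_rhs => rw [plane_eq z]
      simp only [map_add, map_smul]
    rw [h1]
    exact (Function.LeftInverse.injective (hA.left_inv i p t)).comp (planeIncl_injective hd)

/-- The weight of the thickening in the interpolation below. -/
def weight (θ : I) : I := projIcc 0 1 zero_le_one (2 * (θ : ℝ))

/-- The time from which the vertical vectors are transported in the interpolation below, as a
fraction of the current time. -/
def transportTime (θ : I) : I := projIcc 0 1 zero_le_one (2 - 2 * (θ : ℝ))

lemma continuous_weight : Continuous weight := continuous_projIcc.comp (by fun_prop)

lemma continuous_transportTime : Continuous transportTime := continuous_projIcc.comp (by fun_prop)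

lemma weight_zero : weight 0 = 0 := by simp [weight]

lemma weight_one : weight 1 = 1 := projIcc_of_right_le zero_le_one (by norm_num)

lemma transportTime_one : transportTime 1 = 0 := by simp [transportTime]

lemma weight_or_transportTime (θ : I) : weight θ = 1 ∨ transportTime θ = 1 := by
  by_cases h : (1 : ℝ) ≤ 2 * θ
  · exact Or.inl (projIcc_of_right_le zero_le_one h)
  · exact Or.inr (projIcc_of_right_le zero_le_one (by linarith))

/-- The vertical derivative along the lines at an earlier time, transported to the current time. -/
def transported (ε : ℝ) (A B : Fin m → P × I → ℝ →
    EuclideanSpace ℝ (Fin d) →L[ℝ] EuclideanSpace ℝ (Fin d))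
    (Γ : P × I → Plane → EuclideanSpace ℝ (Fin d)) (i : Fin m) (p : (P × I) × I) (t : ℝ) :
    EuclideanSpace ℝ (Fin d) :=
  A i p.1 t (B i (p.1.1, transportTime p.2 * p.1.2) t
    (fderiv ℝ (Γ (p.1.1, transportTime p.2 * p.1.2)) (line m ε i t) vert))

/-- The homotopy, with time `p.2`, from a family of maps of the planar domain to the thickening of
its restriction to the lines. In the first half the family is interpolated with its linearization
along the lines; in the second half the vertical derivative is replaced by the vectors obtained by
transport from earlier and earlier times. -/
def interpolate (ε : ℝ) (χ : Fin m → ℝ → ℝ) (γ : Fin m → P × I → ℝ → EuclideanSpace ℝ (Fin d))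
    (A B : Fin m → P × I → ℝ → EuclideanSpace ℝ (Fin d) →L[ℝ] EuclideanSpace ℝ (Fin d))
    (Γ : P × I → Plane → EuclideanSpace ℝ (Fin d)) (p : (P × I) × I) (u : Plane) :
    EuclideanSpace ℝ (Fin d) :=
  Γ p.1 u + (weight p.2 : ℝ) •
    (thicken ε χ (fun i (p : (P × I) × I) => γ i p.1) (transported ε A B Γ) p u - Γ p.1 u)

lemma interpolate_start {X : Type} {γ : Fin m → X × I → ℝ → EuclideanSpace ℝ (Fin d)}
    {A B : Fin m → X × I → ℝ → EuclideanSpace ℝ (Fin d) →L[ℝ] EuclideanSpace ℝ (Fin d)}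
    {Γ : X × I → Plane → EuclideanSpace ℝ (Fin d)} (p : X × I) (u : Plane) :
    interpolate ε χ γ A B Γ (p, 0) u = Γ p u := by
  simp [interpolate, weight_zero]

lemma PlanarFamily.fderiv_zero (hε : ε < period m) (hΓ : PlanarFamily m ε R₀ Γ) (x : P)
    (i : Fin m) (t : ℝ) : fderiv ℝ (Γ (x, 0)) (line m ε i t) = planeIncl d := by
  have h1 : Γ (x, 0) =ᶠ[𝓝 (line m ε i t)] planeIncl d := by
    filter_upwards [(planarDomain m ε).isOpen.mem_nhds (line_mem hε i t)] with u hu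
    exact hΓ.zero x u hu
  rw [h1.fderiv_eq, ContinuousLinearMap.fderiv]

lemma PlanarFamily.fderiv_far (hε : ε < period m) (hΓ : PlanarFamily m ε R₀ Γ) (p : P × I)
    (i : Fin m) {t : ℝ} (ht : R₀ < |t|) : fderiv ℝ (Γ p) (line m ε i t) = planeIncl d := by
  have h1 : Γ p =ᶠ[𝓝 (line m ε i t)] planeIncl d := by
    have h2 : IsOpen {u : Plane | R₀ < |u 0|} := isOpen_lt continuous_const (by fun_prop)
    filter_upwards [(planarDomain m ε).isOpen.mem_nhds (line_mem hε i t),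
      h2.mem_nhds (show R₀ < |line m ε i t 0| from ht)] with u hu hu'
    exact hΓ.far p u hu (Or.inl hu')
  rw [h1.fderiv_eq, ContinuousLinearMap.fderiv]

lemma transported_of_zero (hε : ε < period m) (hΓ : PlanarFamily m ε R₀ Γ)
    (hA : StrandFrames R₀ γ A B) (i : Fin m) (p : (P × I) × I) (t : ℝ)
    (hp : transportTime p.2 * p.1.2 = 0) :
    transported ε A B Γ i p t = A i p.1 t (planeIncl d vert) := by
  rw [transported, hp, hΓ.fderiv_zero hε, hA.inv_zero]

lemma interpolate_end (hε : ε < period m) (hΓ : PlanarFamily m ε R₀ Γ)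
    (hA : StrandFrames R₀ γ A B) (p : P × I) (u : Plane) :
    interpolate ε χ γ A B Γ (p, 1) u = framedThicken ε χ γ A p u := by
  have h : ∀ i t, transported ε A B Γ i (p, 1) t = A i p t (planeIncl d vert) := fun i t =>
    transported_of_zero hε hΓ hA i (p, 1) t (by rw [transportTime_one, zero_mul])
  simp [interpolate, weight_one, framedThicken, thicken, h]

lemma interpolate_time_zero (hε : ε < period m) (hγ : StrandFamily ε R₀ γ)
    (hΓ : PlanarFamily m ε R₀ Γ) (hA : StrandFrames R₀ γ A B) (x : P) (θ : I) {u : Plane}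
    (hu : u ∈ planarDomain m ε) : interpolate ε χ γ A B Γ ((x, 0), θ) u = planeIncl d u := by
  have h : thicken ε χ (fun i (p : (P × I) × I) => γ i p.1) (transported ε A B Γ) ((x, 0), θ) u =
      planeIncl d u := by
    refine thicken_of_std _ (fun i => hγ.zero i x _) fun i => ?_
    rw [transported_of_zero hε hΓ hA i _ _ (mul_zero _), hA.zero]
    rfl
  rw [interpolate, h, hΓ.zero x u hu, sub_self, smul_zero, add_zero]

lemma interpolate_line {X : Type} {γ : Fin m → X × I → ℝ → EuclideanSpace ℝ (Fin d)}
    {A B : Fin m → X × I → ℝ → EuclideanSpace ℝ (Fin d) →L[ℝ] EuclideanSpace ℝ (Fin d)}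
    {Γ : X × I → Plane → EuclideanSpace ℝ (Fin d)} (hε0 : 0 < ε) (hε : ε < period m)
    (hχ : LineCutoffs m ε χ) (hr : ∀ (i : Fin m) p t, Γ p (line m ε i t) = γ i p t)
    (p : (X × I) × I) (i : Fin m) (t : ℝ) :
    interpolate ε χ γ A B Γ p (line m ε i t) = γ i p.1 t := by
  rw [interpolate, thicken_line hε0 hε hχ, hr, sub_self, smul_zero, add_zero]

/-- The interpolation stays immersive along the lines: at each time either the thickening has the
derivative of the original family there, or its derivative is obtained from that of the original
family at an earlier time by a linear automorphism. -/
lemma lineImmersive_interpolate (hε0 : 0 < ε) (hε : ε < period m) (hR₀ : 1 ≤ R₀)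
    (hχ : LineCutoffs m ε χ) (hγ : StrandFamily ε R₀ γ) (hΓ : PlanarFamily m ε R₀ Γ)
    (hA : StrandFrames R₀ γ A B) (hr : ∀ (i : Fin m) p t, Γ p (line m ε i t) = γ i p t) :
    LineImmersive m ε R₀ (interpolate ε χ γ A B Γ) := by
  have hM := (planarDomain m ε).isOpen
  have hc : Continuous fun p : (P × I) × I => (p.1.1, transportTime p.2 * p.1.2) := by
    have := continuous_transportTime
    fun_prop
  have hγ' : ∀ i, SFam (fun p : (P × I) × I => γ i p.1) univ := fun i =>
    (hγ.sfam i).reparam continuous_fst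
  have hν : ∀ i : Fin m, SFam (fun p t => fderiv ℝ (Γ p) (line m ε i t) vert) univ := fun i =>
    (hΓ.sfam.fderiv.comp hM isOpen_univ (SFam.of_contDiff (line_contDiff i))
      fun _ t _ => line_mem hε i t).clm_apply isOpen_univ
        (ContinuousLinearMap.apply ℝ (EuclideanSpace ℝ (Fin d)) vert)
  have hw : ∀ i, SFam (transported ε A B Γ i) univ := fun i =>
    ((hA.sfam i).reparam continuous_fst).app isOpen_univ
      (((hA.sfam_inv i).reparam hc).app isOpen_univ ((hν i).reparam hc))
  have hth := thicken_sfam hχ hγ' hw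
  have hΓ' : SFam (fun p : (P × I) × I => Γ p.1) (planarDomain m ε) :=
    hΓ.sfam.reparam continuous_fst
  have hwt : SFam (fun (p : (P × I) × I) (_ : Plane) => (weight p.2 : ℝ)) (planarDomain m ε) :=
    SFam.of_continuous (continuous_subtype_val.comp (continuous_weight.comp continuous_snd))
  have hsub := (hth.mono (subset_univ _)).sub hM hΓ'
  refine ⟨hΓ'.add hM (hwt.smul hM hsub), fun p u hu h => ?_, fun p i t => ?_⟩
  · have h1 : thicken ε χ (fun i (p : (P × I) × I) => γ i p.1) (transported ε A B Γ) p u =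
        planeIncl d u := by
      rcases h with h | h
      · refine thicken_of_std _ (fun i => hγ.far i _ _ h) fun i => ?_
        rw [transported, hΓ.fderiv_far hε _ i h, hA.inv_far i _ h, hA.far i _ _ h]
        rfl
      · exact thicken_of_one_le hε0 hχ p (hR₀.trans h.le)
    rw [interpolate, h1, hΓ.far _ u hu h, sub_self, smul_zero, add_zero]
  · have hl := line_mem hε i t
    -- The derivative of the original family along the lines.
    have hdΓ : ∀ (q : P × I) (z : Plane), fderiv ℝ (Γ q) (line m ε i t) z =
        z 0 • deriv (γ i q) t + z 1 • fderiv ℝ (Γ q) (line m ε i t) vert := by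
      intro q z
      have e1 := (hΓ.sfam.differentiableAt hM q hl).hasFDerivAt.comp_hasDerivAt t
        (line_hasDerivAt i t)
      have e2 : deriv (γ i q) t = fderiv ℝ (Γ q) (line m ε i t) horiz := by
        rw [← show (Γ q ∘ line m ε i) = γ i q from funext fun t => hr i q t]
        exact e1.deriv
      rw [e2]
      conv_lhs => rw [plane_eq z]
      simp only [map_add, map_smul]
    have hdF : ∀ z : Plane, fderiv ℝ (interpolate ε χ γ A B Γ p) (line m ε i t) z =
        fderiv ℝ (Γ p.1) (line m ε i t) z + (weight p.2 : ℝ) •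
          (z 0 • deriv (γ i p.1) t + z 1 • transported ε A B Γ i p t -
            fderiv ℝ (Γ p.1) (line m ε i t) z) := by
      intro z
      have e1 := (hΓ.sfam.differentiableAt hM p.1 hl).hasFDerivAt
      have e2 := (hth.differentiableAt isOpen_univ p (mem_univ (line m ε i t))).hasFDerivAt
      have e3 := (e1.add ((e2.sub e1).const_smul (weight p.2 : ℝ))).fderiv
      refine (congrArg (fun L : Plane →L[ℝ] EuclideanSpace ℝ (Fin d) => L z) e3).trans ?_
      rw [← fderiv_thicken_line hε0 hε hχ hγ' hw p i t z]
      rfl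
    have hT : ∀ z : Plane, z 0 • deriv (γ i p.1) t + z 1 • transported ε A B Γ i p t =
        A i p.1 t (B i (p.1.1, transportTime p.2 * p.1.2) t
          (fderiv ℝ (Γ (p.1.1, transportTime p.2 * p.1.2)) (line m ε i t) z)) := by
      intro z
      rw [hdΓ]
      simp only [map_add, map_smul]
      rw [← hA.apply i (p.1.1, transportTime p.2 * p.1.2), hA.left_inv, hA.apply]
      rfl
    rcases weight_or_transportTime p.2 with h1 | h1
    · have e : ⇑(fderiv ℝ (interpolate ε χ γ A B Γ p) (line m ε i t)) = fun z =>
          A i p.1 t (B i (p.1.1, transportTime p.2 * p.1.2) t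
            (fderiv ℝ (Γ (p.1.1, transportTime p.2 * p.1.2)) (line m ε i t) z)) := by
        funext z
        rw [hdF, hT, h1]
        simp
      rw [e]
      exact (Function.LeftInverse.injective (hA.left_inv i p.1 t)).comp
        ((Function.LeftInverse.injective (hA.right_inv i _ t)).comp (hΓ.immersive _ _ hl))
    · have e : ⇑(fderiv ℝ (interpolate ε χ γ A B Γ p) (line m ε i t)) =
          fderiv ℝ (Γ p.1) (line m ε i t) := by
        funext z
        rw [hdF, hT, h1, one_mul, hA.right_inv, sub_self, smul_zero, add_zero]
      rw [e]
      exact hΓ.immersive _ _ hl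

end Strands

/-! ### Passage between continuous maps and families -/

section Passage

open Set

variable {m d : ℕ} {ε : ℝ} {P : Type} [TopologicalSpace P]

/-- The strands, moved back to the reference lines in the planar domain, of a family of long links
modulo immersions. -/
def strandsOf (ε : ℝ) {hd : 3 ≤ d} (β : C(P, LongLinksModImm m d hd)) (i : Fin m) (p : P × I)
    (t : ℝ) : EuclideanSpace ℝ (Fin d) :=
  unstraightenMap m ε d (((β p.1).1.2 p.2).1.piece i t)

lemma exists_strandFamily [CompactSpace P] (hd : 3 ≤ d) (β : C(P, LongLinksModImm m d hd)) :
    ∃ R₁, 1 ≤ R₁ ∧ ∀ R₀, R₁ ≤ R₀ → StrandFamily ε R₀ (strandsOf ε β) := by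
  have hc := EmbModImm.continuous_path β
  obtain ⟨R, hR⟩ := CptSupp.exists_agreeOutside hc
  have hs := SmoothMap.continuous_iff_sfam.1 (CptSupp.continuous_val.comp hc)
  have hsf : ∀ i, SFam (strandsOf ε β i) univ := fun i =>
    SFam.contDiffOn_comp isOpen_univ isOpen_univ
      (unstraightenMap_contDiff (m := m) (ε := ε) d).contDiffOn (hs i) fun _ _ _ => trivial
  have hpiece : ∀ (f : SmoothMap (fun _ : Fin m => (⊤ : Opens ℝ)) (EuclideanSpace ℝ (Fin d))) i t,
      f.piece i t = f.toFun ⟨i, t, trivial⟩ := fun f i t => f.piece_apply i ⟨t, trivial⟩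
  have hstd : ∀ (i : Fin m) t, unstraightenMap m ε d ((stdLink m d).toFun ⟨i, t, trivial⟩) =
      planeIncl d (line m ε i t) := by
    intro i t
    rw [show (stdLink m d).toFun ⟨i, t, trivial⟩ = strand d i t from rfl,
      ← straightenMap_planeIncl (m := m) (ε := ε), unstraighten_straighten]
  refine ⟨max 1 R, le_max_left _ _, fun R₀ hR₀ => ⟨hsf, fun i x t => ?_, fun i p t ht => ?_,
    fun i p t => ?_, fun x i j s t h => ?_⟩⟩
  · rw [strandsOf, EmbModImm.path_zero, hpiece]
    exact hstd i t
  · rw [strandsOf, hpiece, ← hstd i t]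
    refine congrArg _ (hR p i ⟨t, trivial⟩ fun h => ?_)
    have h1 : ‖t‖ ≤ R := mem_closedBall_zero_iff.1 h
    rw [Real.norm_eq_abs] at h1
    linarith [le_max_right 1 R]
  · have himm : Function.Injective (fderiv ℝ (((β p.1).1.2 p.2).1.piece i) t) :=
      ((β p.1).1.2 p.2).2.1 i ⟨t, trivial⟩
    have h1 : DifferentiableAt ℝ (((β p.1).1.2 p.2).1.piece i) t :=
      (hs i).differentiableAt isOpen_univ p (mem_univ t)
    have h2 : DifferentiableAt ℝ (unstraightenMap m ε d) (((β p.1).1.2 p.2).1.piece i t) :=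
      (unstraightenMap_contDiff d).differentiable (by simp) _
    have h3 : Function.Injective (fderiv ℝ (strandsOf ε β i p) t) := by
      rw [show strandsOf ε β i p = unstraightenMap m ε d ∘ ((β p.1).1.2 p.2).1.piece i from rfl,
        fderiv_comp t h2 h1]
      exact (fderiv_injective_of_leftInverse h2
        ((straightenMap_contDiff d).differentiable (by simp) _)
        (straighten_unstraighten (m := m) (ε := ε) d)).comp himm
    intro h0
    have h4 : fderiv ℝ (strandsOf ε β i p) t 1 = fderiv ℝ (strandsOf ε β i p) t 0 := by
      rw [map_zero]
      exact h0
    exact one_ne_zero (h3 h4)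
  · have hemb := (EmbModImm.path_one (β x)).2.injective
    rw [strandsOf, strandsOf, hpiece, hpiece] at h
    have h1 := hemb ((Function.LeftInverse.injective (straighten_unstraighten d)) h)
    obtain ⟨rfl, h2⟩ := Sigma.mk.inj_iff.1 h1
    have h3 : s = t := congrArg Subtype.val (eq_of_heq h2)
    rw [h3]

/-- The maps on the planar domain, extended by zero, of a family of embeddings modulo immersions. -/
def planarOf {hd : 3 ≤ d} (α : C(P, PlanarEmbModImm m d hd ε)) (p : P × I) :
    Plane → EuclideanSpace ℝ (Fin d) := ((α p.1).1.2 p.2).1.piece ()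

lemma planarOf_apply {hd : 3 ≤ d} (α : C(P, PlanarEmbModImm m d hd ε)) (p : P × I)
    (u : planarDomain m ε) : planarOf α p u = ((α p.1).1.2 p.2).1.toFun ⟨(), u⟩ :=
  ((α p.1).1.2 p.2).1.piece_apply () u

lemma exists_planarFamily [CompactSpace P] (hd : 3 ≤ d) (α : C(P, PlanarEmbModImm m d hd ε)) :
    ∃ R₂, 1 ≤ R₂ ∧ ∀ R₀, R₂ ≤ R₀ → PlanarFamily m ε R₀ (planarOf α) := by
  have hc := EmbModImm.continuous_path α
  obtain ⟨R, hR⟩ := CptSupp.exists_agreeOutside hc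
  have hs := SmoothMap.continuous_iff_sfam.1 (CptSupp.continuous_val.comp hc)
  refine ⟨max 1 R, le_max_left _ _, fun R₀ hR₀ => ⟨hs (), fun x u hu => ?_, fun p u hu h => ?_,
    fun p u hu => ((α p.1).1.2 p.2).2.1 () ⟨u, hu⟩, fun x => ?_⟩⟩
  · refine (planarOf_apply α _ ⟨u, hu⟩).trans ?_
    rw [EmbModImm.path_zero]
    rfl
  · refine (planarOf_apply α _ ⟨u, hu⟩).trans (hR p () ⟨u, hu⟩ fun h' => ?_)
    have h1 : ‖u‖ ≤ R := mem_closedBall_zero_iff.1 h'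
    have h2 := le_max_right 1 R
    rcases h with h | h
    · linarith [abs_apply_le_norm u 0]
    · linarith [abs_apply_le_norm u 1]
  · simp only [planarOf_apply]
    exact (EmbModImm.path_one (α x)).2.comp
      (@Topology.IsOpenEmbedding.sigmaMk Unit (fun _ => planarDomain m ε) _ ()).isEmbedding

lemma planarOf_line (hε0 : 0 < ε) (hε : ε < period m) {hd : 3 ≤ d}
    (α : C(P, PlanarEmbModImm m d hd ε)) (β : C(P, LongLinksModImm m d hd))
    (h : ∀ x, restrictModImm hε hε0 hd (α x) = β x) (i : Fin m) (p : P × I) (t : ℝ) :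
    planarOf α p (line m ε i t) = strandsOf ε β i p t := by
  rw [strandsOf, ← h, restrictModImm_path, piece_restrictLines, unstraighten_straighten]
  rfl

/-- A family of maps on the planar domain that satisfies the conditions pointwise defines a
continuous map to the space of embeddings modulo immersions. -/
lemma exists_planar_of_family (hd : 3 ≤ d) {Ψ : P × I → Plane → EuclideanSpace ℝ (Fin d)}
    (hs : SFam Ψ (planarDomain m ε))
    (himm : ∀ p, ∀ u ∈ planarDomain m ε, Function.Injective (fderiv ℝ (Ψ p) u))
    (hemb : ∀ x, Topology.IsEmbedding fun u : planarDomain m ε => Ψ (x, 1) u) {R : ℝ}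
    (hfar : ∀ p, ∀ u ∈ planarDomain m ε, R < ‖u‖ → Ψ p u = planeIncl d u)
    (h0 : ∀ x, ∀ u ∈ planarDomain m ε, Ψ (x, 0) u = planeIncl d u) :
    ∃ l : C(P, PlanarEmbModImm m d hd ε), ∀ x s (u : planarDomain m ε),
      ((l x).1.2 s).1.toFun ⟨(), u⟩ = Ψ (x, s) u := by
  have hM := (planarDomain m ε).isOpen
  have hext : ∀ p, ∀ u ∈ planarDomain m ε,
      extendZero (fun u : planarDomain m ε => Ψ p u) u = Ψ p u := fun p u hu =>
    extendZero_apply (fun u : planarDomain m ε => Ψ p u) ⟨u, hu⟩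
  let S : P × I → SmoothMap (fun _ : Unit => planarDomain m ε) (EuclideanSpace ℝ (Fin d)) :=
    fun p => ⟨fun x => Ψ p x.2, fun _ => (hs.contDiffOn hM p).congr (hext p)⟩
  have hSd : ∀ p, ∀ u ∈ planarDomain m ε, fderiv ℝ ((S p).piece ()) u = fderiv ℝ (Ψ p) u := by
    intro p u hu
    apply Filter.EventuallyEq.fderiv_eq
    filter_upwards [hM.mem_nhds hu] with w hw using hext p w hw
  have hSi : ∀ p, (S p).IsImmersion := by
    rintro p ⟨⟩ u
    rw [hSd p u u.2]
    exact himm p u u.2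
  have hsnd : Topology.IsEmbedding fun x : Σ _ : Unit, planarDomain m ε => x.2 :=
    Topology.IsEmbedding.of_leftInverse (f := fun u => ⟨(), u⟩) (fun _ => rfl)
      (@Topology.IsOpenEmbedding.sigmaMk Unit (fun _ => planarDomain m ε) _ ()).continuous
      (continuous_sigma fun _ => continuous_id)
  obtain ⟨l, hl⟩ := EmbModImm.exists_of_family (he := stdPlanar_isImmersion m hd ε) (Ψ := S)
    (SmoothMap.continuous_iff_sfam.2 fun _ => hs.congr hM hext) hSi
    (fun x => ⟨hSi _, (hemb x).comp hsnd⟩) ⟨Metric.closedBall 0 R, isCompact_closedBall 0 R⟩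
    (fun p _ u hu => hfar p u u.2 (by
      by_contra! h
      exact hu (mem_closedBall_zero_iff.2 h)))
    fun x => SmoothMap.ext_toFun fun _ u => h0 x u u.2
  exact ⟨l, fun x s u => by rw [hl]⟩

end Passage

/-! ### Restriction to the lines is a weak equivalence -/

section Main

open Set

variable {m d : ℕ} {ε : ℝ} {P P' : Type} [TopologicalSpace P] [TopologicalSpace P']

lemma LineImmersive.reparam {R₀ : ℝ} {F : P → Plane → EuclideanSpace ℝ (Fin d)}
    (hF : LineImmersive m ε R₀ F) {q : P' → P} (hq : Continuous q) :
    LineImmersive m ε R₀ fun p => F (q p) :=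
  ⟨hF.sfam.reparam hq, fun _ => hF.far _, fun _ => hF.immersive _⟩

lemma IsCompression.injective_fderiv_comp {R δ : ℝ} {φ : I → Plane → Plane}
    (hφ : IsCompression m ε R δ φ) (κ : I) {f : Plane → EuclideanSpace ℝ (Fin d)} {u : Plane}
    (hf : DifferentiableAt ℝ f (φ κ u)) (hi : Function.Injective (fderiv ℝ f (φ κ u))) :
    Function.Injective (fderiv ℝ (fun u => f (φ κ u)) u) := by
  rw [show (fun u => f (φ κ u)) = f ∘ φ κ from rfl,
    fderiv_comp u hf (hφ.sfam.differentiableAt isOpen_univ κ (mem_univ u))]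
  exact hi.comp (hφ.immersive κ u)

lemma IsCompression.isEmbedding {R δ : ℝ} {φ : I → Plane → Plane} (hφ : IsCompression m ε R δ φ)
    (κ : I) : Topology.IsEmbedding (φ κ) := by
  obtain ⟨T, hT⟩ := hφ.fixed_far
  have hc : Continuous (φ κ) :=
    hφ.sfam.continuous.comp (by fun_prop : Continuous fun u : Plane => (κ, u))
  have h := (isClosedEmbedding_of_norm_le isClosed_univ (f := φ κ) hc.continuousOn
    (hφ.injective κ).injOn (R := T) fun u _ hu => by rw [hT κ u hu]).isEmbedding
  exact h.comp (Homeomorph.Set.univ Plane).symm.isEmbedding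

lemma IsCompression.isEmbedding_comp {R δ : ℝ} {φ : I → Plane → Plane}
    (hφ : IsCompression m ε R δ φ) (κ : I) {Z : Set Plane}
    (hZ : ∀ u ∈ planarDomain m ε, φ κ u ∈ Z) {f : Plane → EuclideanSpace ℝ (Fin d)}
    (hf : Topology.IsEmbedding fun u : Z => f u) :
    Topology.IsEmbedding fun u : planarDomain m ε => f (φ κ u) :=
  hf.comp (((hφ.isEmbedding κ).comp Topology.IsEmbedding.subtypeVal).codRestrict Z
    fun u : planarDomain m ε => hZ u u.2)

/-- The point of the unit interval closest to a real number. -/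
def clamp (x : ℝ) : I := projIcc 0 1 zero_le_one x

lemma continuous_clamp : Continuous clamp := continuous_projIcc (h := zero_le_one)

lemma clamp_of_nonpos {x : ℝ} (h : x ≤ 0) : clamp x = 0 := projIcc_of_le_left zero_le_one h

lemma clamp_of_one_le {x : ℝ} (h : 1 ≤ x) : clamp x = 1 := projIcc_of_right_le zero_le_one h

lemma clamp_coe (x : I) : clamp x = x := projIcc_val zero_le_one x

/-- The reparametrization of the paths of immersions at time `τ` of the homotopy. It starts at the
identity; from `τ = 1 / 4` on, the paths are constant in their first half. -/
def delay (τ s : I) : I := clamp ((1 + clamp (4 * τ)) * s - clamp (4 * τ))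

/-- The amount of compression at time `τ` of the homotopy and time `s` of the paths. It vanishes up
to `τ = 1 / 4`; from `τ = 1 / 2` on, the compression takes place in the first half of the paths. -/
def squeeze (τ s : I) : I := clamp (4 * τ - 1) * clamp (2 * s)

/-- The amount of interpolation, which vanishes up to `τ = 1 / 2`. -/
def late (τ : I) : I := clamp (2 * τ - 1)

lemma continuous_delay : Continuous fun p : I × I => delay p.1 p.2 := by
  have := continuous_clamp
  unfold delay
  fun_prop

lemma continuous_squeeze : Continuous fun p : I × I => squeeze p.1 p.2 := by
  have := continuous_clamp
  unfold squeeze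
  fun_prop

lemma continuous_late : Continuous late := by
  have := continuous_clamp
  unfold late
  fun_prop

lemma delay_start (s : I) : delay 0 s = s := by
  simp [delay, clamp_of_nonpos, clamp_coe]

lemma delay_zero (τ : I) : delay τ 0 = 0 :=
  clamp_of_nonpos (by simpa using (clamp (4 * τ)).2.1)

lemma delay_one (τ : I) : delay τ 1 = 1 := clamp_of_one_le (by simp)

lemma squeeze_start (s : I) : squeeze 0 s = 0 := by
  simp [squeeze, clamp_of_nonpos]

lemma squeeze_zero (τ : I) : squeeze τ 0 = 0 := by
  simp [squeeze, clamp_of_nonpos]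

lemma late_start : late 0 = 0 := clamp_of_nonpos (by norm_num)

lemma late_end : late 1 = 1 := clamp_of_one_le (by norm_num)

/-- Once the interpolation has begun, the paths either still rest at the reference map or the
compression is complete. -/
lemma late_cases (τ s : I) : late τ = 0 ∨ delay τ s = 0 ∨ squeeze τ s = 1 := by
  by_cases h : (τ : ℝ) ≤ 1 / 2
  · exact Or.inl (clamp_of_nonpos (by linarith))
  · push Not at h
    have h1 : clamp (4 * τ) = 1 := clamp_of_one_le (by linarith)
    have h2 : clamp (4 * τ - 1) = 1 := clamp_of_one_le (by linarith)
    right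
    by_cases hs : (s : ℝ) ≤ 1 / 2
    · left
      rw [delay, h1]
      exact clamp_of_nonpos (by simp only [Icc.coe_one]; linarith)
    · right
      rw [squeeze, h2, one_mul]
      exact clamp_of_one_le (by linarith)

lemma squeeze_one_of_late {τ : I} (h : late τ ≠ 0) : squeeze τ 1 = 1 := by
  rcases late_cases τ 1 with h1 | h1 | h1
  · exact absurd h1 h
  · rw [delay_one] at h1
    exact absurd h1 one_ne_zero
  · exact h1

/-- Over `D` the lift is the framed thickening of the strands, precomposed with a compression into a
tube on which it is embedded. Over the closed subset the given family is first compressed and then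
interpolated to the thickening, after the paths have been reparametrized so that the compression
takes place while the maps are still the reference map. -/
lemma restrictModImm_liftsUpToHomotopy (hd : 3 ≤ d) (hε0 : 0 < ε) (hε : ε < period m) :
    LiftsUpToHomotopy (restrictModImm (d := d) hε hε0 hd) := by
  intro D _ _ S hS α β hαβ
  have : CompactSpace S := isCompact_iff_compactSpace.1 hS.isCompact
  have hM := (planarDomain m ε).isOpen
  -- The two families and a common bound for their supports.
  obtain ⟨R₁, hR₁, hβ⟩ := exists_strandFamily (ε := ε) hd β
  obtain ⟨R₂, hR₂, hα⟩ := exists_planarFamily hd α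
  set R₀ := max R₁ R₂ with hR₀def
  have hR₀ : 1 ≤ R₀ := hR₁.trans (le_max_left _ _)
  have hγ := hβ R₀ (le_max_left _ _)
  have hΓ := hα R₀ (le_max_right _ _)
  set γ := strandsOf ε β with hγdef
  set Γ := planarOf α with hΓdef
  let γ' : Fin m → S × I → ℝ → EuclideanSpace ℝ (Fin d) := fun i p => γ i (p.1, p.2)
  have hγ' : StrandFamily ε R₀ γ' := hγ.reparam continuous_subtype_val
  have hr : ∀ (i : Fin m) p t, Γ p (line m ε i t) = γ' i p t := by
    intro i p t
    exact planarOf_line hε0 hε α (β.comp ⟨Subtype.val, continuous_subtype_val⟩) hαβ i p t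
  obtain ⟨A, B, hA⟩ := hγ.exists_strandFrames
  have hA' := hA.reparam (f := fun a : S => (a : D)) continuous_subtype_val
  obtain ⟨χ, hχ⟩ := exists_lineCutoffs (m := m) hε
  -- The thickening over `D` and the interpolation over `S`.
  let L : D × I → Plane → EuclideanSpace ℝ (Fin d) := framedThicken ε χ γ A
  let F : (S × I) × I → Plane → EuclideanSpace ℝ (Fin d) :=
    interpolate ε χ γ' (fun i p => A i (p.1, p.2)) (fun i p => B i (p.1, p.2)) Γ
  have hL : LineImmersive m ε R₀ L := lineImmersive_framedThicken hd hε0 hε hR₀ hχ hγ hA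
  have hF : LineImmersive m ε R₀ F := lineImmersive_interpolate hε0 hε hR₀ hχ hγ' hΓ hA' hr
  have hLline : ∀ p (i : Fin m) t, L p (line m ε i t) = γ i p t := fun p i t =>
    thicken_line hε0 hε hχ p i t
  have hFline : ∀ p (i : Fin m) t, F p (line m ε i t) = γ' i p.1 t := fun p i t =>
    interpolate_line hε0 hε hχ hr p i t
  -- The radius of a square that contains the inner parts of the final strands.
  obtain ⟨R, hR, hball⟩ : ∃ R, R₀ < R ∧ ∀ x (i : Fin m) t, |t| ≤ R₀ → ‖γ i (x, 1) t‖ < R := by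
    have h1 : ∀ i, ∃ b, ∀ x t, |t| ≤ R₀ → ‖γ i (x, 1) t‖ ≤ b := by
      intro i
      obtain ⟨b, hb⟩ := ((isCompact_univ (X := D)).prod
        (isCompact_Icc (a := -R₀) (b := R₀))).exists_bound_of_continuousOn
        (((hγ.sfam i).reparam (q := fun x : D => (x, (1 : I))) (by
          fun_prop)).continuous.continuousOn)
      exact ⟨b, fun x t ht => hb (x, t) ⟨trivial, abs_le.1 ht⟩⟩
    choose b hb using h1
    obtain ⟨c, hc⟩ := (Set.finite_range b).bddAbove
    refine ⟨max R₀ c + 1, (le_max_left _ _).trans_lt (lt_add_one _), fun x i t ht => ?_⟩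
    exact ((hb i x t ht).trans (hc ⟨i, rfl⟩)).trans_lt
      ((le_max_right _ _).trans_lt (lt_add_one _))
  -- A tube on which all maps in question are immersions or embeddings.
  obtain ⟨r₁, hr₁, hLi⟩ := hL.exists_immersive_tube hd hε0 hε hR₀ hR
  obtain ⟨r₂, hr₂, hFi⟩ := hF.exists_immersive_tube hd hε0 hε hR₀ hR
  obtain ⟨r₃, hr₃, hLe⟩ := (hL.reparam (q := fun x : D => (x, (1 : I)))
    (by fun_prop)).exists_embedded_tube hd hε0 hε hR₀ hR
    (fun x i j s t h => hγ.inj x i j s t (by rwa [hLline, hLline] at h))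
    fun x i t ht => by
      rw [hLline]
      exact hball x i t ht
  obtain ⟨r₄, hr₄, hFe⟩ := (hF.reparam (q := fun x : S × I => ((x.1, (1 : I)), x.2))
    (by fun_prop)).exists_embedded_tube hd hε0 hε hR₀ hR
    (fun x i j s t h => hγ'.inj x.1 i j s t (by rwa [hFline, hFline] at h))
    fun x i t ht => by
      rw [hFline]
      exact hball x.1 i t ht
  obtain ⟨δ, hδ0, hδ⟩ := exists_between (lt_min (lt_min hr₁ hr₂) (lt_min hr₃ hr₄))
  obtain ⟨hδ12, hδ34⟩ := lt_min_iff.1 hδ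
  obtain ⟨hδ1, hδ2⟩ := lt_min_iff.1 hδ12
  obtain ⟨hδ3, hδ4⟩ := lt_min_iff.1 hδ34
  obtain ⟨φ, hφ⟩ := exists_isCompression (m := m) hε0 hε (R := R) (δ := δ) (by linarith) hδ0
  obtain ⟨T, hT⟩ := hφ.fixed_far
  have hφs : ∀ {Q : Type} [TopologicalSpace Q] {k : Q → I}, Continuous k →
      SFam (fun q => φ (k q)) (planarDomain m ε) := fun hk =>
    (hφ.sfam.reparam hk).mono (subset_univ _)
  have houter : ∀ u : Plane, max T (2 * R₀) < ‖u‖ → R₀ < |u 0| ∨ R₀ < |u 1| := by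
    intro u hu
    have := (le_max_right T (2 * R₀)).trans_lt hu
    by_contra! hcon
    linarith [norm_le_abs_add_abs u, hcon.1, hcon.2]
  have hdL : ∀ p, ∀ u ∈ planarDomain m ε, DifferentiableAt ℝ (L p) u := fun p u hu =>
    hL.sfam.differentiableAt hM p hu
  have hdF : ∀ p, ∀ u ∈ planarDomain m ε, DifferentiableAt ℝ (F p) u := fun p u hu =>
    hF.sfam.differentiableAt hM p hu
  have hplane : ∀ (f : Plane → EuclideanSpace ℝ (Fin d)), (∀ u ∈ planarDomain m ε,
      f u = planeIncl d u) → ∀ u ∈ planarDomain m ε, Function.Injective (fderiv ℝ f u) := by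
    intro f hf u hu
    have h1 : f =ᶠ[𝓝 u] planeIncl d := by
      filter_upwards [hM.mem_nhds hu] with w hw using hf w hw
    rw [h1.fderiv_eq, ContinuousLinearMap.fderiv]
    exact planeIncl_injective hd
  have hL0 : ∀ x u, L (x, 0) u = planeIncl d u := framedThicken_zero hγ hA
  have hF0 : ∀ a θ, ∀ u ∈ planarDomain m ε, F ((a, 0), θ) u = planeIncl d u := fun a θ u hu =>
    interpolate_time_zero hε hγ' hΓ hA' a θ hu
  have hFs : ∀ p u, F (p, 0) u = Γ p u := interpolate_start
  have hF1 : ∀ (p : S × I) u, F (p, 1) u = L (p.1, p.2) u := fun p u =>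
    interpolate_end hε hΓ hA' p u
  -- The lift of the final family over `D`.
  have hcd := continuous_delay
  have hcs := continuous_squeeze
  have hcl := continuous_late
  obtain ⟨l, hl⟩ := exists_planar_of_family (m := m) (ε := ε) (P := D) hd
    (Ψ := fun p u => L (p.1, delay 1 p.2) (φ (squeeze 1 p.2) u)) (R := max T (2 * R₀))
    ((hL.sfam.reparam (q := fun p : D × I => (p.1, delay 1 p.2)) (by fun_prop)).comp hM hM
      (hφs (by fun_prop)) fun p u hu => hφ.mapsTo _ u hu)
    (fun p u hu => by
      refine hφ.injective_fderiv_comp _ (hdL _ _ (hφ.mapsTo _ u hu)) ?_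
      rcases late_cases 1 p.2 with h | h | h
      · rw [late_end] at h
        exact absurd h one_ne_zero
      · rw [h]
        exact hplane _ (fun w _ => hL0 _ w) _ (hφ.mapsTo _ u hu)
      · rw [h]
        exact hLi δ hδ1 _ _ (hφ.compress u hu))
    (fun x => by
      have h1 : squeeze 1 1 = 1 := squeeze_one_of_late (by rw [late_end]; exact one_ne_zero)
      simp only [delay_one, h1]
      exact hφ.isEmbedding_comp 1 hφ.compress (hLe δ hδ3 x).isEmbedding)
    (fun p u hu hun => by
      simp only [hT _ u ((le_max_left _ _).trans_lt hun)]
      exact hL.far _ u hu (houter u hun))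
    (fun x u hu => by simp only [delay_zero, squeeze_zero, hφ.zero, hL0])
  -- The homotopy over `S`.
  obtain ⟨α', hα'⟩ := exists_planar_of_family (m := m) (ε := ε) (P := I × S) hd
    (Ψ := fun p u => F ((p.1.2, delay p.1.1 p.2), late p.1.1) (φ (squeeze p.1.1 p.2) u))
    (R := max T (2 * R₀))
    ((hF.sfam.reparam (q := fun p : (I × S) × I => ((p.1.2, delay p.1.1 p.2), late p.1.1))
      (by fun_prop)).comp hM hM (hφs (by fun_prop)) fun p u hu => hφ.mapsTo _ u hu)
    (fun p u hu => by
      refine hφ.injective_fderiv_comp _ (hdF _ _ (hφ.mapsTo _ u hu)) ?_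
      rcases late_cases p.1.1 p.2 with h | h | h
      · rw [h, show F ((p.1.2, delay p.1.1 p.2), 0) = Γ (p.1.2, delay p.1.1 p.2) from
          funext (hFs _)]
        exact hΓ.immersive _ _ (hφ.mapsTo _ u hu)
      · rw [h]
        exact hplane _ (hF0 _ _) _ (hφ.mapsTo _ u hu)
      · rw [h]
        exact hFi δ hδ2 _ _ (hφ.compress u hu))
    (fun x => by
      simp only [delay_one]
      by_cases h : late x.1 = 0
      · simp only [h, hFs]
        exact hφ.isEmbedding_comp _ (Z := planarDomain m ε) (hφ.mapsTo _) (hΓ.embedding x.2)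
      · simp only [squeeze_one_of_late h]
        exact hφ.isEmbedding_comp 1 hφ.compress (hFe δ hδ4 (x.2, late x.1)).isEmbedding)
    (fun p u hu hun => by
      simp only [hT _ u ((le_max_left _ _).trans_lt hun)]
      exact hF.far _ u hu (houter u hun))
    (fun x u hu => by
      simp only [delay_zero, squeeze_zero, hφ.zero]
      exact hF0 _ _ u hu)
  -- The homotopy over `D` reparametrizes the paths.
  let β' : C(I × D, LongLinksModImm m d hd) :=
    ⟨fun p => ⟨((β p.2).1.1, (β p.2).1.2.comp ⟨delay p.1, by fun_prop⟩),
      by simp only [ContinuousMap.comp_apply, ContinuousMap.coe_mk, delay_zero]; exact (β p.2).2.1,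
      by simp only [ContinuousMap.comp_apply, ContinuousMap.coe_mk, delay_one]; exact (β p.2).2.2⟩,
      by
        refine Continuous.subtype_mk (Continuous.prodMk ?_ ?_) _
        · exact continuous_fst.comp (continuous_subtype_val.comp (β.continuous.comp continuous_snd))
        · refine ContinuousMap.continuous_of_continuous_uncurry _ ?_
          exact (EmbModImm.continuous_path β).comp
            (f := fun p : (I × D) × I => (p.1.2, delay p.1.1 p.2)) (by fun_prop)⟩
  have hβ' : ∀ τ x s, (β' (τ, x)).1.2 s = (β x).1.2 (delay τ s) := fun _ _ _ => rfl
  have hst : ∀ x (s : I) (i : Fin m) (t : (⊤ : Opens ℝ)),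
      straightenMap m ε d (γ i (x, s) t) = ((β x).1.2 s).1.toFun ⟨i, t⟩ := by
    intro x s i t
    rw [hγdef, strandsOf, straighten_unstraighten]
    exact ((β x).1.2 s).1.piece_apply i t
  have hφl : ∀ κ (i : Fin m) t, φ κ (line m ε i t) = line m ε i t := fun κ i t =>
    hφ.fixed_line κ i _ rfl
  refine ⟨α', β', l, fun a => ?_, fun x => ?_, fun τ a => ?_, fun a => ?_, fun x => ?_⟩
  · refine EmbModImm.ext_path fun s => SmoothMap.ext_toFun fun _ u => ?_
    rw [hα', delay_start, squeeze_start, late_start, hφ.zero, hFs]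
    exact planarOf_apply α _ u
  · refine EmbModImm.ext_path fun s => ?_
    rw [hβ', delay_start]
  · refine EmbModImm.ext_path fun s => SmoothMap.ext_toFun fun i t => ?_
    rw [hβ', ← hst, restrictModImm_path]
    refine congrArg (straightenMap m ε d) ((hα' _ _ _).trans ?_)
    simp only
    rw [hφl, hFline]
  · refine EmbModImm.ext_path fun s => SmoothMap.ext_toFun fun _ u => ?_
    rw [hα', hl, late_end, hF1]
  · refine EmbModImm.ext_path fun s => SmoothMap.ext_toFun fun i t => ?_
    rw [hβ', ← hst, restrictModImm_path]
    refine congrArg (straightenMap m ε d) ((hl _ _ _).trans ?_)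
    simp only
    rw [hφl, hLline]

end Main

end LongLinks

end

theorem mainTheorem10 (m d : ℕ) (hm : 1 ≤ m) (hd : 3 ≤ d) (ε : ℝ) (hε0 : 0 < ε)
    (hε : ε < 2 / ((m : ℝ) + 1)) :
    LongLinks.WeaklyEquivalent (LongLinks.LongLinksModImm m d hd)
      (LongLinks.PlanarEmbModImm m d hd ε) :=
  Relation.EqvGen.symm _ _ (Relation.EqvGen.rel _ _ ⟨LongLinks.restrictModImm hε hε0 hd,
    (LongLinks.restrictModImm_liftsUpToHomotopy hd hε0 hε).isWeakHomotopyEquiv⟩)
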